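/- Let $\beta=\frac{\sqrt{17}-3}{2}$ and $K_1=\frac{\Gamma(2\beta+2)\,\Gamma(\beta+2)}{2\,\Gamma(\beta+1)^3\,\Gamma(\beta/2+1)^2}$. Let $p_1,p_2,\dots$ be independent uniform points of $[0,1]^2$. Let $C_n(s)$, $s\in[0,1]$, be the number of nodes visited by the partial match query for the first coordinate $s$ in the point quadtree built by inserting $p_1,\dots,p_n$ successively; that is, the number of nodes whose region is met by the vertical line at $s$, where a line through a stored point counts as lying to the right of that point. Let $\mathcal D[0,1]$ be the space of càdlàg functions on $[0,1]$ with the norm $\|f\|=\sup_{s\in[0,1]}|f(s)|$ and the $\sigma$-algebra generated by the evaluations $f\mapsto f(s)$. Convergence in distribution of $X_n$ to $X$ in $(\mathcal D[0,1],\|\cdot\|)$ means $\mathbf E F(X_n)\to\mathbf E F(X)$ for all bounded measurable $F:\mathcal D[0,1]\to\mathbb R$ that are continuous for $\|\cdot\|$. Consider, for the law of a random function $Z$ in $\mathcal D[0,1]$, the recursive distributional equation $$Z(s)\stackrel{d}{=}\mathbf 1_{\{s<U\}}\Big[(UV)^\beta Z^{(1)}\big(\tfrac sU\big)+(U(1-V))^\beta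 Z^{(2)}\big(\tfrac sU\big)\Big]+\mathbf 1_{\{s\ge U\}}\Big[((1-U)V)^\beta Z^{(3)}\big(\tfrac{s-U}{1-U}\big)+((1-U)(1-V))^\beta Z^{(4)}\big(\tfrac{s-U}{1-U}\big)\Big]\qquad(*)$$ (an equality in law of random functions of $s\in[0,1]$), where $U,V$ are uniform on $[0,1]$, $Z^{(1)},\dots,Z^{(4)}$ are copies of $Z$, and $U,V,Z^{(1)},\dots,Z^{(4)}$ are independent. There is a probability law $\mu$ on $\mathcal D[0,1]$ such that: 1. $\mu$ is concentrated on the continuous functions, it is a solution of $(*)$, and if $Z$ has law $\mu$, then $\mathbf E Z(s)=(s(1-s))^{\beta/2}$ for all $s\in[0,1]$ and $\mathbf E\|Z\|^2<\infty$; 2. $\mu$ is the only probability law on $\mathcal D[0,1]$ that solves $(*)$ and has these two moment properties; 3. if a random function $Z$ in $\mathcal D[0,1]$ is the limit in distribution of $\big(\frac{C_n(s)}{K_1n^\beta},\,s\in[0,1]\big)$ in $(\mathcal D[0,1],\|\cdot\|)$, then $Z$ has law $\mu$. Thus the limit process $Z$ of the rescaled partial match costs solves $(*)$, and its law is the unique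 solution of $(*)$ with $\mathbf E Z(s)=(s(1-s))^{\beta/2}$ for all $s\in[0,1]$ and $\mathbf E\|Z\|^2<\infty$. -/

import Mathlib

open MeasureTheory ProbabilityTheory Filter Topology Set
open scoped unitInterval ENNReal UniformConvergence

noncomputable section

/-! ### The space of càdlàg functions on the unit interval -/

/-- Right-continuous with left limits on `[0,1]` (the left limit at `0` is vacuous). -/
def IsCadlag (f : I → ℝ) : Prop :=
  ∀ t, ContinuousWithinAt f (Ici t) t ∧ ∃ l, Tendsto f (𝓝[<] t) (𝓝 l)

theorem IsCadlag.const (c : ℝ) : IsCadlag (fun _ => c) :=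
  fun _ => ⟨continuousWithinAt_const, c, tendsto_const_nhds⟩

theorem IsCadlag.add {f g : I → ℝ} (hf : IsCadlag f) (hg : IsCadlag g) :
    IsCadlag (fun s => f s + g s) := by
  intro t
  obtain ⟨l, hl⟩ := (hf t).2
  obtain ⟨m, hm⟩ := (hg t).2
  exact ⟨(hf t).1.add (hg t).1, l + m, hl.add hm⟩

theorem IsCadlag.const_mul {f : I → ℝ} (hf : IsCadlag f) (c : ℝ) :
    IsCadlag (fun s => c * f s) := by
  intro t
  obtain ⟨l, hl⟩ := (hf t).2
  exact ⟨continuousWithinAt_const.mul (hf t).1, c * l, hl.const_mul c⟩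

theorem IsCadlag.comp {f : I → ℝ} (hf : IsCadlag f) {φ : I → I} (hm : Monotone φ)
    (hc : Continuous φ) : IsCadlag (fun s => f (φ s)) := by
  intro t
  refine ⟨(hf (φ t)).1.comp hc.continuousWithinAt (fun s hs => hm hs), ?_⟩
  by_cases h : ∃ s₀ < t, φ s₀ = φ t
  · obtain ⟨s₀, h₀, he⟩ := h
    refine ⟨f (φ t), tendsto_const_nhds.congr' ?_⟩
    filter_upwards [self_mem_nhdsWithin, mem_nhdsWithin_of_mem_nhds (Ioi_mem_nhds h₀)]
      with s hs hs'
    have h1 : φ s ≤ φ t := hm (le_of_lt hs)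
    have h2 : φ s₀ ≤ φ s := hm (le_of_lt hs')
    rw [le_antisymm h1 (he ▸ h2)]
  · push Not at h
    obtain ⟨l, hl⟩ := (hf (φ t)).2
    refine ⟨l, hl.comp ?_⟩
    refine tendsto_nhdsWithin_iff.2 ⟨(hc.tendsto t).mono_left nhdsWithin_le_nhds, ?_⟩
    filter_upwards [self_mem_nhdsWithin] with s hs
    exact lt_of_le_of_ne (hm (le_of_lt hs)) (h s hs)

theorem IsCadlag.ite {f g : I → ℝ} (hf : IsCadlag f) (hg : IsCadlag g) (x : I) :
    IsCadlag (fun s => if s < x then f s else g s) := by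
  intro t
  constructor
  · rcases lt_or_ge t x with h | h
    · refine (hf t).1.congr_of_eventuallyEq ?_ (by simp [h])
      filter_upwards [mem_nhdsWithin_of_mem_nhds (Iio_mem_nhds h)] with s hs
      simp [mem_Iio.1 hs]
    · refine (hg t).1.congr (fun s hs => ?_) (by simp [not_lt.2 h])
      simp [not_lt.2 (h.trans hs)]
  · rcases le_or_gt t x with h | h
    · obtain ⟨l, hl⟩ := (hf t).2
      refine ⟨l, hl.congr' ?_⟩
      filter_upwards [self_mem_nhdsWithin] with s hs
      simp [(mem_Iio.1 hs).trans_le h]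
    · obtain ⟨l, hl⟩ := (hg t).2
      refine ⟨l, hl.congr' ?_⟩
      filter_upwards [mem_nhdsWithin_of_mem_nhds (Ioi_mem_nhds h)] with s hs
      simp [not_lt.2 (le_of_lt (mem_Ioi.1 hs))]

/-- The space `𝒟[0,1]` of càdlàg functions on the unit interval. -/
structure CadlagFun where
  toFun : I → ℝ
  isCadlag : IsCadlag toFun

namespace CadlagFun

instance : CoeFun CadlagFun (fun _ => I → ℝ) := ⟨toFun⟩

/-- The topology of the supremum norm, i.e. of uniform convergence on `[0,1]`. -/
instance : TopologicalSpace CadlagFun :=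
  TopologicalSpace.induced (fun f => UniformFun.ofFun f.toFun)
    (inferInstance : TopologicalSpace (I →ᵤ ℝ))

/-- The `σ`-algebra generated by the evaluations `f ↦ f s`. (The supremum norm being
non-separable on `𝒟[0,1]`, this is smaller than its Borel `σ`-algebra.) -/
instance : MeasurableSpace CadlagFun :=
  MeasurableSpace.comap toFun MeasurableSpace.pi

/-- The supremum norm `‖f‖ = sup_{s ∈ [0,1]} |f s|`, with values in `[0,∞]`. -/
def supNorm (f : CadlagFun) : ℝ≥0∞ := ⨆ s, ‖f s‖ₑ

end CadlagFun

/-- Convergence in distribution in `(𝒟[0,1], ‖·‖)` of the random functions `X n`, defined on a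
probability space with measure `P`, to the probability law `ν`: convergence of the expectations
of all bounded measurable functionals that are continuous for the supremum norm. -/
def ConvergesInDistribution {Ω : Type*} [MeasurableSpace Ω] (P : Measure Ω)
    (X : ℕ → Ω → CadlagFun) (ν : Measure CadlagFun) : Prop :=
  ∀ F : CadlagFun → ℝ, Continuous F → Measurable F → (∃ C, ∀ f, |F f| ≤ C) →
    Tendsto (fun n => ∫ ω, F (X n ω) ∂P) atTop (𝓝 (∫ f, F f ∂ν))

/-! ### Quadtrees and partial match queries -/

/-- Point quadtrees with data in the unit square. The four subtrees of `node p a b c d` hold the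
points that lie, relative to `p`, to the lower left, upper left, lower right and upper right. -/
inductive QuadTree where
  | nil : QuadTree
  | node (p : I × I) (a b c d : QuadTree) : QuadTree

namespace QuadTree

/-- Insertion of a point: it is stored at the leaf of the region that it falls in. -/
def insert (q : I × I) : QuadTree → QuadTree
  | nil => node q nil nil nil nil
  | node p a b c d =>
    if q.1 < p.1 then
      if q.2 < p.2 then node p (insert q a) b c d else node p a (insert q b) c d
    else
      if q.2 < p.2 then node p a b (insert q c) d else node p a b c (insert q d)

/-- The number of nodes visited by the partial match query that asks for all points with first
coordinate `s`, i.e. of nodes whose region is met by the vertical line at `s` (the regions to the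
right of a point contain their left boundary). -/
def cost : QuadTree → I → ℕ
  | nil, _ => 0
  | node p a b c d, s => 1 + if s < p.1 then cost a s + cost b s else cost c s + cost d s

/-- The quadtree obtained by inserting `p 0, …, p (n - 1)` in this order. -/
def build (p : ℕ → I × I) : ℕ → QuadTree
  | 0 => nil
  | n + 1 => insert (p n) (build p n)

theorem isCadlag_cost (t : QuadTree) : IsCadlag (fun s => (t.cost s : ℝ)) := by
  induction t with
  | nil => simpa [cost] using IsCadlag.const 0
  | node p a b c d ha hb hc hd =>
    have h := (IsCadlag.const 1).add ((ha.add hb).ite (hc.add hd) p.1)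
    convert h using 2 with s
    simp only [cost]
    split_ifs <;> push_cast <;> rfl

end QuadTree

/-! ### The constants, the rescaled cost process and the limit equation -/

/-- The exponent `β = (√17 - 3) / 2`. -/
def qβ : ℝ := (√17 - 3) / 2

/-- The constant `K₁ = Γ(2β+2) Γ(β+2) / (2 Γ(β+1)³ Γ(β/2+1)²)`. -/
def qK₁ : ℝ :=
  Real.Gamma (2 * qβ + 2) * Real.Gamma (qβ + 2) /
    (2 * Real.Gamma (qβ + 1) ^ 3 * Real.Gamma (qβ / 2 + 1) ^ 2)

/-- The rescaled cost process `s ↦ C_n(s) / (K₁ n^β)` for the points `p 0, …, p (n - 1)`. -/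
def rescaledCost (p : ℕ → I × I) (n : ℕ) : CadlagFun where
  toFun s := (qK₁ * (n : ℝ) ^ qβ)⁻¹ * ((QuadTree.build p n).cost s : ℝ)
  isCadlag := (QuadTree.isCadlag_cost _).const_mul _

/-- The point `s / x` of `[0,1]`; it is used for `s < x` only. -/
def leftPos (x s : I) : I := projIcc 0 1 zero_le_one ((s : ℝ) / x)

/-- The point `(s - x) / (1 - x)` of `[0,1]`; it is used for `s ≥ x` only. -/
def rightPos (x s : I) : I := projIcc 0 1 zero_le_one (((s : ℝ) - x) / (1 - x))

theorem coe_leftPos {x s : I} (h : s < x) : (leftPos x s : ℝ) = (s : ℝ) / x := by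
  have hx : (0 : ℝ) ≤ x := x.2.1
  have h' : (s : ℝ) ≤ x := le_of_lt h
  exact congrArg Subtype.val (projIcc_of_mem zero_le_one
    ⟨div_nonneg s.2.1 hx, div_le_one_of_le₀ h' hx⟩)

theorem coe_rightPos {x s : I} (h : x ≤ s) :
    (rightPos x s : ℝ) = ((s : ℝ) - x) / (1 - x) := by
  have hx : (0 : ℝ) ≤ 1 - x := sub_nonneg.2 x.2.2
  have h' : (x : ℝ) ≤ s := h
  have h1 : (s : ℝ) ≤ 1 := s.2.2
  exact congrArg Subtype.val (projIcc_of_mem zero_le_one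
    ⟨div_nonneg (by linarith) hx, div_le_one_of_le₀ (by linarith) hx⟩)

theorem isCadlag_comp_leftPos (f : CadlagFun) (x : I) :
    IsCadlag (fun s => f (leftPos x s)) := by
  refine f.isCadlag.comp (fun s t h => ?_) ?_
  · exact monotone_projIcc _ (div_le_div_of_nonneg_right h x.2.1)
  · exact continuous_projIcc.comp (continuous_subtype_val.div_const _)

theorem isCadlag_comp_rightPos (f : CadlagFun) (x : I) :
    IsCadlag (fun s => f (rightPos x s)) := by
  refine f.isCadlag.comp (fun s t h => ?_) ?_
  · exact monotone_projIcc _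
      (div_le_div_of_nonneg_right (sub_le_sub_right (show (s : ℝ) ≤ t from h) _)
        (sub_nonneg.2 x.2.2))
  · exact continuous_projIcc.comp ((continuous_subtype_val.sub continuous_const).div_const _)

/-- The right-hand side of the recursive distributional equation, for `(U, V) = (x, y)` and
`Z⁽¹⁾, …, Z⁽⁴⁾ = f 0, …, f 3`. -/
def quadMap (x y : I) (f : Fin 4 → CadlagFun) : CadlagFun where
  toFun s :=
    if s < x then
      ((x : ℝ) * y) ^ qβ * f 0 (leftPos x s) + ((x : ℝ) * (1 - y)) ^ qβ * f 1 (leftPos x s)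
    else
      ((1 - (x : ℝ)) * y) ^ qβ * f 2 (rightPos x s)
        + ((1 - (x : ℝ)) * (1 - y)) ^ qβ * f 3 (rightPos x s)
  isCadlag :=
    (((isCadlag_comp_leftPos (f 0) x).const_mul _).add
      ((isCadlag_comp_leftPos (f 1) x).const_mul _)).ite
    (((isCadlag_comp_rightPos (f 2) x).const_mul _).add
      ((isCadlag_comp_rightPos (f 3) x).const_mul _)) x

/-- The law `μ` on `𝒟[0,1]` solves the recursive distributional equation: it is the law of
`quadMap U V Z` if `U`, `V` are uniform on `[0,1]`, the four functions `Z i` have law `μ`, and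
all of them are independent. -/
def IsFixedPointLaw (μ : Measure CadlagFun) : Prop :=
  Measure.map (fun q : (I × I) × (Fin 4 → CadlagFun) => quadMap q.1.1 q.1.2 q.2)
    ((volume : Measure (I × I)).prod (Measure.pi fun _ => μ)) = μ

/-- `E Z(s) = (s (1 - s))^{β/2}` for all `s`, and `E ‖Z‖² < ∞`, for `Z` of law `μ`. -/
def HasLimitMoments (μ : Measure CadlagFun) : Prop :=
  (∀ s : I, ∫ f, f s ∂μ = ((s : ℝ) * (1 - s)) ^ (qβ / 2)) ∧
    ∫⁻ f, f.supNorm ^ 2 ∂μ < ∞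

end

/-!
The recursive equation describes a map on laws: a uniform point cuts the unit square into four
quadrants, and four independent functions, scaled by the areas of the quadrants to the power `β`,
are spliced along the first coordinate of the point. Everything rests on the behaviour of this map
on moments. For the mean function the map acts through the operator `meanOp`, which fixes
`(s (1 - s))^{β/2}` because `(β + 1) (β + 2) = 4` (`integral_sum_qwt_mul_qh`). For a centred random
function the cross terms vanish, so second moments are contracted by `4 / (2β + 1)² < 1`
(`spliceSum_second_moment`).

*Uniqueness.* Two solutions with the same mean function can be coupled by using the same splitting
points in all generations. The difference of the two components is centred, so that its pointwise
second moment after `n` generations is at most `C θⁿ` with `θ = 4 / (2β + 1)²` (`exists_coupling`).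
Hence the finite-dimensional characteristic functions agree, and these determine a law on the space
of càdlàg functions (`fixedPointLaw_unique`). Only bounded second moments of the one-dimensional
marginals are needed, not those of the supremum; this matters for the limits below.

*Existence.* The recursion is run on a quaternary tree of independent splitting points, started at
depth `n` with the mean function; the increment from depth `n` to depth `n + 1` is again centred.
Its even moments of order `2m + 2` decay like `(9 / (m + 10))ⁿ`, uniformly in the position
(`exists_integral_incr_pow_le`), and it is Hölder continuous of exponent `β / 2` with a constant that
grows like `4ⁿ`. A grid of `Rⁿ` points is fine enough to control the increment by its values on the
grid, and since `m` may be taken large compared with `R`, a union bound over the grid still gives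
geometric decay. So the approximations converge uniformly, with a square-integrable bound
(`exists_incr_le`), and the limit is a continuous solution (`exists_limitLaw`).

*Limits in distribution solve the equation.* The cost of a query depends only on the relative order
of the coordinates, so conditionally on the first point and on the numbers of points in the four
quadrants, the costs in the four subtrees are independent costs of trees of uniform points
(`qhit_mul_listCost`, `EE_prod_subList`). This yields a recursion for the characteristic functions
of the costs. By the law of large numbers the proportions of points in the quadrants converge to
their areas, and the recursion passes to the limit
(`isFixedPointLaw_of_convergesInDistribution`).

*Their moments.* By uniqueness it remains to find the mean function of a limit and to bound its
second moments. Averaged over a uniform location, the mean cost obeys a second order recurrence;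
its generating function, increased by `1 / (1 - z)`, is the product of `(1 - z)^{-1-β}` and a Gauss
hypergeometric series, so Gauss's summation theorem gives the exact asymptotics (`tendsto_avgCost`).
The bound for the average and a contraction near the boundary of the interval give a bound of order
`n^β` for the mean cost, uniform in the location, and then one of order `n^{2β}` for the second
moment (`exists_meanCost_le`, `exists_sqCost_le`). Therefore the second moments of the limit are
bounded and the rescaled means converge pointwise and boundedly to its mean function
(`limit_moments`). This mean function is invariant under `meanOp` and has the integral
`Γ(β/2+1)² / Γ(β+2)` of `(s (1 - s))^{β/2}`, which is what the constant `K₁` is chosen for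
(`integral_qh_eq_div`). Finally `meanOp` preserves integrals and has a kernel bounded below by
`s² (1 - s)²`, so that an invariant function of integral zero vanishes (`eq_zero_of_meanOp_eq`), and
the mean function of the limit is `(s (1 - s))^{β/2}`
(`hasWeakMoments_of_convergesInDistribution`).
-/

noncomputable section

/-! ### Splitting the unit square at a point -/

/-- The side indicator: `qhit q s j` is `1` if the vertical line at `s` meets the `j`-th quadrant
of the unit square cut at `q`, and `0` otherwise. -/
def qhit (q : I × I) (s : I) : Fin 4 → ℝ :=
  ![if s < q.1 then 1 else 0, if s < q.1 then 1 else 0,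
    if s < q.1 then 0 else 1, if s < q.1 then 0 else 1]

/-- The area of the `j`-th quadrant of the unit square cut at `q`, in the order of the subtrees
of `QuadTree.node`. -/
def qarea (q : I × I) : Fin 4 → ℝ :=
  ![(q.1 : ℝ) * q.2, (q.1 : ℝ) * (1 - q.2), (1 - (q.1 : ℝ)) * q.2, (1 - (q.1 : ℝ)) * (1 - q.2)]

/-- The position of `s` relative to the horizontal extent of the `j`-th quadrant. -/
def qpos (q : I × I) (s : I) : Fin 4 → I :=
  ![leftPos q.1 s, leftPos q.1 s, rightPos q.1 s, rightPos q.1 s]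

/-- The quadrant of the unit square cut at `q` that contains `p`. -/
def quad (q p : I × I) : Fin 4 :=
  if p.1 < q.1 then (if p.2 < q.2 then 0 else 1) else (if p.2 < q.2 then 2 else 3)

/-- The affine map that takes the `j`-th quadrant of the unit square cut at `q` to the unit
square. -/
def qscale (q : I × I) (j : Fin 4) (p : I × I) : I × I :=
  (![leftPos q.1 p.1, leftPos q.1 p.1, rightPos q.1 p.1, rightPos q.1 p.1] j,
    ![leftPos q.2 p.2, rightPos q.2 p.2, leftPos q.2 p.2, rightPos q.2 p.2] j)

/-- The factor of the `j`-th function in `quadMap`. -/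
def qwt (q : I × I) (s : I) (j : Fin 4) : ℝ := qhit q s j * qarea q j ^ qβ

theorem quadMap_eq_sum (q : I × I) (f : Fin 4 → CadlagFun) (s : I) :
    quadMap q.1 q.2 f s = ∑ j, qwt q s j * f j (qpos q s j) := by
  simp only [quadMap, qwt, Fin.sum_univ_four, qhit, qarea, qpos]
  by_cases h : s < q.1 <;> simp [h]

theorem sqrt17_bounds : 4.123 < √17 ∧ √17 < 4.1232 := by
  constructor
  · exact Real.lt_sqrt_of_sq_lt (by norm_num)
  · exact (Real.sqrt_lt' (by norm_num)).2 (by norm_num)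

theorem qβ_gt : (0.5615 : ℝ) < qβ := by
  have := sqrt17_bounds.1
  unfold qβ; linarith

theorem qβ_lt : qβ < (0.5616 : ℝ) := by
  have := sqrt17_bounds.2
  unfold qβ; linarith

theorem qβ_pos : 0 < qβ := by linarith [qβ_gt]

/-- The exponent `β` is the positive root of `(β + 1) (β + 2) = 4`. -/
theorem qβ_eq : (qβ + 1) * (qβ + 2) = 4 := by
  have h : √17 * √17 = 17 := Real.mul_self_sqrt (by norm_num)
  unfold qβ; nlinarith

theorem qhit_nonneg (q s j) : 0 ≤ qhit q s j := by
  fin_cases j <;> simp only [qhit] <;> by_cases h : s < q.1 <;> simp [h]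

theorem qhit_le_one (q s j) : qhit q s j ≤ 1 := by
  fin_cases j <;> simp only [qhit] <;> by_cases h : s < q.1 <;> simp [h]

theorem qhit_eq_zero_or_one (q s j) : qhit q s j = 0 ∨ qhit q s j = 1 := by
  fin_cases j <;> simp only [qhit] <;> by_cases h : s < q.1 <;> simp [h]

theorem qarea_nonneg (q j) : 0 ≤ qarea q j := by
  have h1 := q.1.2.1; have h2 := q.1.2.2; have h3 := q.2.2.1; have h4 := q.2.2.2
  fin_cases j <;> simp only [qarea] <;>
  simp <;> apply mul_nonneg <;> linarith

theorem qarea_le_one (q j) : qarea q j ≤ 1 := by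
  have h1 := q.1.2.1; have h2 := q.1.2.2; have h3 := q.2.2.1; have h4 := q.2.2.2
  fin_cases j <;> simp only [qarea] <;>
  simp <;> apply mul_le_one₀ <;> linarith

theorem qwt_nonneg (q s j) : 0 ≤ qwt q s j :=
  mul_nonneg (qhit_nonneg _ _ _) (Real.rpow_nonneg (qarea_nonneg _ _) _)

theorem qwt_le_one (q s j) : qwt q s j ≤ 1 :=
  mul_le_one₀ (qhit_le_one _ _ _) (Real.rpow_nonneg (qarea_nonneg _ _) _)
    (Real.rpow_le_one (qarea_nonneg _ _) (qarea_le_one _ _) qβ_pos.le)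

theorem qwt_pow (q s j) {m : ℕ} (hm : m ≠ 0) :
    qwt q s j ^ m = qhit q s j * qarea q j ^ (m * qβ) := by
  rw [qwt, mul_pow, ← Real.rpow_mul_natCast (qarea_nonneg _ _), mul_comm qβ]
  rcases qhit_eq_zero_or_one q s j with h | h <;> simp [h, hm]

/-! ### Measurability -/

theorem measurable_leftPos : Measurable fun p : I × I => leftPos p.1 p.2 := by
  unfold leftPos
  exact continuous_projIcc.measurable.comp
    ((measurable_subtype_coe.comp measurable_snd).div (measurable_subtype_coe.comp measurable_fst))

theorem measurable_rightPos : Measurable fun p : I × I => rightPos p.1 p.2 := by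
  unfold rightPos
  exact continuous_projIcc.measurable.comp
    (((measurable_subtype_coe.comp measurable_snd).sub
      (measurable_subtype_coe.comp measurable_fst)).div
      (measurable_const.sub (measurable_subtype_coe.comp measurable_fst)))

theorem measurable_qpos (j : Fin 4) : Measurable fun p : (I × I) × I => qpos p.1 p.2 j := by
  have hl : Measurable fun p : (I × I) × I => leftPos p.1.1 p.2 :=
    measurable_leftPos.comp ((measurable_fst.comp measurable_fst).prodMk measurable_snd)
  have hr : Measurable fun p : (I × I) × I => rightPos p.1.1 p.2 :=
    measurable_rightPos.comp ((measurable_fst.comp measurable_fst).prodMk measurable_snd)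
  fin_cases j <;> simpa [qpos]

theorem measurable_qhit (j : Fin 4) : Measurable fun p : (I × I) × I => qhit p.1 p.2 j := by
  have h : MeasurableSet {p : (I × I) × I | p.2 < p.1.1} :=
    measurableSet_lt measurable_snd (measurable_fst.comp measurable_fst)
  have h0 : Measurable fun p : (I × I) × I => if p.2 < p.1.1 then (1 : ℝ) else 0 :=
    Measurable.ite h measurable_const measurable_const
  have h1 : Measurable fun p : (I × I) × I => if p.2 < p.1.1 then (0 : ℝ) else 1 :=
    Measurable.ite h measurable_const measurable_const
  fin_cases j <;> simpa [qhit]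

theorem measurable_qarea (j : Fin 4) : Measurable fun q : I × I => qarea q j := by
  have h1 : Measurable fun q : I × I => (q.1 : ℝ) := by fun_prop
  have h2 : Measurable fun q : I × I => (q.2 : ℝ) := by fun_prop
  fin_cases j <;> simp only [qarea]
  · exact h1.mul h2
  · exact h1.mul (measurable_const.sub h2)
  · exact (measurable_const.sub h1).mul h2
  · exact (measurable_const.sub h1).mul (measurable_const.sub h2)

theorem measurable_qwt (j : Fin 4) : Measurable fun p : (I × I) × I => qwt p.1 p.2 j :=
  (measurable_qhit j).mul (((measurable_qarea j).comp measurable_fst).pow_const _)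

theorem measurable_quad : Measurable fun p : (I × I) × (I × I) => quad p.1 p.2 := by
  have h1 : MeasurableSet {p : (I × I) × (I × I) | p.2.1 < p.1.1} :=
    measurableSet_lt (by fun_prop) (by fun_prop)
  have h2 : MeasurableSet {p : (I × I) × (I × I) | p.2.2 < p.1.2} :=
    measurableSet_lt (by fun_prop) (by fun_prop)
  unfold quad
  exact Measurable.ite h1 (Measurable.ite h2 measurable_const measurable_const)
    (Measurable.ite h2 measurable_const measurable_const)

theorem measurable_qscale (j : Fin 4) :
    Measurable fun p : (I × I) × (I × I) => qscale p.1 j p.2 := by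
  have l1 : Measurable fun p : (I × I) × (I × I) => leftPos p.1.1 p.2.1 :=
    measurable_leftPos.comp (by fun_prop : Measurable fun p : (I × I) × (I × I) => (p.1.1, p.2.1))
  have r1 : Measurable fun p : (I × I) × (I × I) => rightPos p.1.1 p.2.1 :=
    measurable_rightPos.comp (by fun_prop : Measurable fun p : (I × I) × (I × I) => (p.1.1, p.2.1))
  have l2 : Measurable fun p : (I × I) × (I × I) => leftPos p.1.2 p.2.2 :=
    measurable_leftPos.comp (by fun_prop : Measurable fun p : (I × I) × (I × I) => (p.1.2, p.2.2))
  have r2 : Measurable fun p : (I × I) × (I × I) => rightPos p.1.2 p.2.2 :=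
    measurable_rightPos.comp (by fun_prop : Measurable fun p : (I × I) × (I × I) => (p.1.2, p.2.2))
  fin_cases j
  · exact l1.prodMk l2
  · exact l1.prodMk r2
  · exact r1.prodMk l2
  · exact r1.prodMk r2

namespace CadlagFun

theorem measurable_eval (s : I) : Measurable fun f : CadlagFun => f s :=
  (measurable_pi_apply s).comp (comap_measurable toFun)

theorem measurable_iff {α : Type*} [MeasurableSpace α] {g : α → CadlagFun} :
    Measurable g ↔ ∀ s, Measurable fun a => g a s := by
  refine ⟨fun h s => (measurable_eval s).comp h, fun h => ?_⟩
  exact measurable_comap_iff.2 (measurable_pi_iff.2 h)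

/-- A point of the grid of mesh `1 / (k + 1)` to the right of `t`, cut off at `1`. -/
def gridRight (k n : ℕ) : I := projIcc 0 1 zero_le_one (((n : ℝ) + 1) / (k + 1))

theorem tendsto_gridRight (t : I) :
    Tendsto (fun k : ℕ => gridRight k ⌊(t : ℝ) * (k + 1)⌋₊) atTop (𝓝[≥] t) := by
  have ht := t.2.1
  have lower : ∀ k : ℕ, (t : ℝ) ≤ ((⌊(t : ℝ) * (k + 1)⌋₊ : ℝ) + 1) / (k + 1) := fun k => by
    rw [le_div_iff₀ (by positivity)]
    exact (Nat.lt_floor_add_one _).le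
  have upper : ∀ k : ℕ, ((⌊(t : ℝ) * (k + 1)⌋₊ : ℝ) + 1) / (k + 1) ≤ t + 1 / (k + 1) := fun k => by
    rw [add_div, add_le_add_iff_right, div_le_iff₀ (by positivity)]
    exact Nat.floor_le (by positivity)
  refine tendsto_nhdsWithin_iff.2 ⟨?_, Eventually.of_forall fun k => ?_⟩
  · have h : Tendsto (fun k : ℕ => ((⌊(t : ℝ) * (k + 1)⌋₊ : ℝ) + 1) / (k + 1)) atTop (𝓝 (t : ℝ)) := by
      refine tendsto_of_tendsto_of_tendsto_of_le_of_le tendsto_const_nhds ?_ lower upper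
      simpa using tendsto_const_nhds.add (tendsto_one_div_add_atTop_nhds_zero_nat (𝕜 := ℝ))
    have h2 := (continuous_projIcc (h := zero_le_one (α := ℝ))).continuousAt.tendsto.comp h
    simp only [projIcc_val] at h2
    exact h2
  · have := monotone_projIcc (zero_le_one (α := ℝ)) (lower k)
    rwa [projIcc_val] at this

/-- Joint measurability of the evaluation, by right-continuity. -/
theorem measurable_uncurry_eval : Measurable fun p : CadlagFun × I => p.1 p.2 := by
  refine measurable_of_tendsto_metrizable
    (f := fun (k : ℕ) (p : CadlagFun × I) => p.1 (gridRight k ⌊(p.2 : ℝ) * (k + 1)⌋₊))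
    (fun k => ?_) ?_
  · have h : Measurable fun p : CadlagFun × ℕ => p.1 (gridRight k p.2) :=
      measurable_from_prod_countable_left fun n => measurable_eval (gridRight k n)
    have h2 : Measurable fun p : CadlagFun × I => (p.1, ⌊(p.2 : ℝ) * (k + 1)⌋₊) :=
      measurable_fst.prodMk
        (((measurable_subtype_coe.comp measurable_snd).mul_const _).nat_floor)
    exact h.comp h2
  · rw [tendsto_pi_nhds]
    intro p
    exact ((p.1.isCadlag p.2).1.tendsto).comp (tendsto_gridRight p.2)

theorem measurable_apply {α : Type*} [MeasurableSpace α] {g : α → CadlagFun} {t : α → I}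
    (hg : Measurable g) (ht : Measurable t) : Measurable fun a => g a (t a) :=
  measurable_uncurry_eval.comp (hg.prodMk ht)

end CadlagFun

theorem measurable_quadMap :
    Measurable fun q : (I × I) × (Fin 4 → CadlagFun) => quadMap q.1.1 q.1.2 q.2 := by
  refine CadlagFun.measurable_iff.2 fun s => ?_
  simp only [quadMap_eq_sum]
  refine Finset.measurable_sum _ fun j _ => ?_
  have h : Measurable fun q : (I × I) × (Fin 4 → CadlagFun) => (q.1, s) :=
    measurable_fst.prodMk measurable_const
  exact ((measurable_qwt j).comp h).mul (CadlagFun.measurable_apply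
    ((measurable_pi_apply j).comp measurable_snd) ((measurable_qpos j).comp h))

/-! ### Integrals over the splitting point -/

theorem integral_unitInterval (f : ℝ → ℝ) : ∫ x : I, f x = ∫ x in (0 : ℝ)..1, f x := by
  rw [intervalIntegral.integral_of_le zero_le_one, ← integral_Icc_eq_integral_Ioc]
  exact integral_subtype measurableSet_Icc f

theorem integral_unitInterval_symm (f : I → ℝ) : ∫ x : I, f (unitInterval.symm x) = ∫ x : I, f x :=
  unitInterval.measurePreserving_symm.integral_comp
    unitInterval.symmMeasurableEquiv.measurableEmbedding f

theorem integral_rpow_unitInterval {κ : ℝ} (hκ : 0 ≤ κ) : ∫ x : I, (x : ℝ) ^ κ = 1 / (κ + 1) := by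
  rw [integral_unitInterval (fun x => x ^ κ), integral_rpow (Or.inl (by linarith))]
  simp [Real.zero_rpow (by linarith : κ + 1 ≠ 0)]

theorem integral_one_sub_rpow_unitInterval {κ : ℝ} (hκ : 0 ≤ κ) :
    ∫ x : I, (1 - (x : ℝ)) ^ κ = 1 / (κ + 1) := by
  rw [← integral_rpow_unitInterval hκ, ← integral_unitInterval_symm]
  simp [unitInterval.coe_symm_eq]

/-- Integral of the product of a function of the first coordinate with a power of the area. -/
theorem integral_mul_qarea_rpow (g : I → ℝ) {κ : ℝ} (hκ : 0 ≤ κ) (j : Fin 4) :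
    ∫ q : I × I, g q.1 * qarea q j ^ κ =
      (∫ x : I, g x * (if j = 0 ∨ j = 1 then (x : ℝ) else 1 - x) ^ κ) * (1 / (κ + 1)) := by
  have key : ∀ a b : I → ℝ, (∀ x, 0 ≤ a x) → (∀ y, 0 ≤ b y) → ∫ y, b y ^ κ = 1 / (κ + 1) →
      ∫ q : I × I, g q.1 * (a q.1 * b q.2) ^ κ = (∫ x : I, g x * a x ^ κ) * (1 / (κ + 1)) := by
    intro a b ha hb hbi
    rw [← hbi, ← integral_prod_mul]
    refine integral_congr_ae (Eventually.of_forall fun q => ?_)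
    simp only [Real.mul_rpow (ha _) (hb _)]; ring
  have h1 : ∀ x : I, (0 : ℝ) ≤ x := fun x => x.2.1
  have h2 : ∀ x : I, (0 : ℝ) ≤ 1 - x := fun x => sub_nonneg.2 x.2.2
  fin_cases j
  · simpa [qarea] using key _ _ h1 h1 (integral_rpow_unitInterval hκ)
  · simpa [qarea] using key _ _ h1 h2 (integral_one_sub_rpow_unitInterval hκ)
  · simpa [qarea] using key _ _ h2 h1 (integral_rpow_unitInterval hκ)
  · simpa [qarea] using key _ _ h2 h2 (integral_one_sub_rpow_unitInterval hκ)

theorem integral_qarea_rpow {κ : ℝ} (hκ : 0 ≤ κ) (j : Fin 4) :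
    ∫ q : I × I, qarea q j ^ κ = 1 / (κ + 1) ^ 2 := by
  have := integral_mul_qarea_rpow (fun _ => 1) hκ j
  simp only [one_mul] at this
  rw [this]
  split_ifs
  · rw [integral_rpow_unitInterval hκ, div_mul_div_comm, one_mul, sq]
  · rw [integral_one_sub_rpow_unitInterval hκ, div_mul_div_comm, one_mul, sq]

theorem integrable_of_bdd {α : Type*} [MeasurableSpace α] {μ : Measure α} [IsFiniteMeasure μ]
    {f : α → ℝ} (hf : Measurable f) (C : ℝ) (h : ∀ a, |f a| ≤ C) : Integrable f μ :=
  Integrable.of_bound hf.aestronglyMeasurable C (Eventually.of_forall h)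

theorem integrable_qhit_mul_qarea (s : I) (j : Fin 4) {κ : ℝ} (hκ : 0 ≤ κ) :
    Integrable fun q : I × I => qhit q s j * qarea q j ^ κ := by
  refine integrable_of_bdd (((measurable_qhit j).comp (measurable_id.prodMk measurable_const)).mul
    ((measurable_qarea j).pow_const _)) 1 fun q => ?_
  rw [abs_of_nonneg (mul_nonneg (qhit_nonneg _ _ _) (Real.rpow_nonneg (qarea_nonneg _ _) _))]
  exact mul_le_one₀ (qhit_le_one _ _ _) (Real.rpow_nonneg (qarea_nonneg _ _) _)
    (Real.rpow_le_one (qarea_nonneg _ _) (qarea_le_one _ _) hκ)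

theorem integral_qhit_mul_qarea_le (s : I) (j : Fin 4) {κ : ℝ} (hκ : 0 ≤ κ) :
    ∫ q : I × I, qhit q s j * qarea q j ^ κ ≤ 1 / (κ + 1) ^ 2 := by
  rw [← integral_qarea_rpow hκ j]
  refine integral_mono (integrable_qhit_mul_qarea s j hκ) ?_ fun q => ?_
  · refine integrable_of_bdd ((measurable_qarea j).pow_const _) 1 fun q => ?_
    rw [abs_of_nonneg (Real.rpow_nonneg (qarea_nonneg _ _) _)]
    exact Real.rpow_le_one (qarea_nonneg _ _) (qarea_le_one _ _) hκ
  · exact mul_le_of_le_one_left (Real.rpow_nonneg (qarea_nonneg _ _) _) (qhit_le_one _ _ _)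

theorem sum_integral_qhit_mul_qarea_le (s : I) {κ : ℝ} (hκ : 0 ≤ κ) :
    ∑ j, ∫ q : I × I, qhit q s j * qarea q j ^ κ ≤ 4 / (κ + 1) ^ 2 := by
  refine (Finset.sum_le_sum fun j _ => integral_qhit_mul_qarea_le s j hκ).trans ?_
  rw [Finset.sum_const, Finset.card_univ, Fintype.card_fin, nsmul_eq_mul]
  apply le_of_eq; push_cast; ring

/-! ### Rescaling uniform points of a quadrant -/

/-- A uniform point conditioned to lie to the left of `x` is uniform there, and is rescaled to a
uniform point of `[0,1]`. -/
theorem map_leftPos_restrict (x : I) :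
    ((volume : Measure I).restrict (Iio x)).map (leftPos x) = ENNReal.ofReal x • volume := by
  have hm : Measurable (leftPos x) := measurable_leftPos.comp (measurable_const.prodMk measurable_id)
  have : IsFiniteMeasure (ENNReal.ofReal x • (volume : Measure I)) := by
    constructor; simp
  refine Measure.ext_of_Iic _ _ fun a => ?_
  rw [Measure.map_apply hm measurableSet_Iic, Measure.restrict_apply (hm measurableSet_Iic)]
  simp only [Measure.smul_apply, smul_eq_mul, unitInterval.volume_Iic]
  rw [← ENNReal.ofReal_mul x.2.1]
  have hxa : (x : ℝ) * a ≤ x := mul_le_of_le_one_right x.2.1 a.2.2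
  rcases eq_or_lt_of_le a.2.2 with h1 | h1
  · have : leftPos x ⁻¹' Iic a ∩ Iio x = Iio x := by
      have ha : a = 1 := Subtype.ext h1
      ext s; simp [ha, unitInterval.le_one']
    rw [this, h1]; simp
  · have : leftPos x ⁻¹' Iic a ∩ Iio x ⊆ Iic (x * a) ∧ Iio (x * a) ⊆ leftPos x ⁻¹' Iic a ∩ Iio x := by
      constructor
      · rintro s ⟨h2, h3⟩
        have h3' : (s : ℝ) < x := h3
        have h2' : (leftPos x s : ℝ) ≤ a := h2
        rw [coe_leftPos h3, div_le_iff₀ (lt_of_le_of_lt s.2.1 h3')] at h2'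
        show (s : ℝ) ≤ x * a
        linarith
      · intro s hs
        have hs' : (s : ℝ) < x * a := hs
        have h3 : (s : ℝ) < x := hs'.trans_le hxa
        refine ⟨?_, h3⟩
        show (leftPos x s : ℝ) ≤ a
        rw [coe_leftPos h3, div_le_iff₀ (lt_of_le_of_lt s.2.1 h3)]
        linarith
    refine le_antisymm ((measure_mono this.1).trans ?_) (le_trans ?_ (measure_mono this.2))
    · simp
    · simp

theorem map_rightPos_restrict (x : I) :
    ((volume : Measure I).restrict (Ici x)).map (rightPos x)
      = ENNReal.ofReal (1 - x) • volume := by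
  have hm : Measurable (rightPos x) :=
    measurable_rightPos.comp (measurable_const.prodMk measurable_id)
  have : IsFiniteMeasure (ENNReal.ofReal (1 - x) • (volume : Measure I)) := by
    constructor; simp
  refine Measure.ext_of_Iic _ _ fun a => ?_
  rw [Measure.map_apply hm measurableSet_Iic, Measure.restrict_apply (hm measurableSet_Iic)]
  simp only [Measure.smul_apply, smul_eq_mul, unitInterval.volume_Iic]
  have hx : (0 : ℝ) ≤ 1 - x := sub_nonneg.2 x.2.2
  rw [← ENNReal.ofReal_mul hx]
  rcases eq_or_lt_of_le hx with h1 | h1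
  · have hx1 : x = 1 := Subtype.ext (by push_cast; linarith)
    have h : volume (rightPos x ⁻¹' Iic a ∩ Ici x) ≤ volume (Ici x) := measure_mono inter_subset_right
    rw [← h1, zero_mul, ENNReal.ofReal_zero]
    refine le_antisymm (h.trans ?_) zero_le
    simp [hx1]
  · have hb : (x : ℝ) + (1 - x) * a ∈ Icc (0 : ℝ) 1 := by
      have := a.2.1; have := a.2.2; have := x.2.1
      constructor <;> nlinarith
    have : rightPos x ⁻¹' Iic a ∩ Ici x = Icc x ⟨_, hb⟩ := by
      ext s
      simp only [mem_inter_iff, mem_preimage, mem_Iic, mem_Ici, mem_Icc]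
      rw [and_comm]
      refine and_congr_right fun h => ?_
      rw [← Subtype.coe_le_coe, coe_rightPos h, div_le_iff₀ h1, ← Subtype.coe_le_coe]
      constructor <;> intro h' <;> simp only at h' ⊢ <;> linarith
    rw [this, unitInterval.volume_Icc]
    congr 1; simp

theorem quad_preimage (q : I × I) (j : Fin 4) : quad q ⁻¹' {j} =
    (![Iio q.1, Iio q.1, Ici q.1, Ici q.1] j) ×ˢ (![Iio q.2, Ici q.2, Iio q.2, Ici q.2] j) := by
  ext p
  rw [mem_preimage, mem_singleton_iff, mem_prod]
  by_cases h1 : p.1 < q.1 <;> by_cases h2 : p.2 < q.2 <;> fin_cases j <;>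
    simp [quad, h1, h2, not_lt.1]

/-- A uniform point, restricted to the `j`-th quadrant and rescaled, is uniform with mass the area
of the quadrant. -/
theorem map_qscale_restrict (q : I × I) (j : Fin 4) :
    ((volume : Measure (I × I)).restrict (quad q ⁻¹' {j})).map (qscale q j)
      = ENNReal.ofReal (qarea q j) • volume := by
  have hl : ∀ x, Measurable (leftPos x) := fun x =>
    measurable_leftPos.comp (measurable_const.prodMk measurable_id)
  have hr : ∀ x, Measurable (rightPos x) := fun x =>
    measurable_rightPos.comp (measurable_const.prodMk measurable_id)
  have key : ∀ (A B : Set I) (f g : I → I) (a b : ℝ), Measurable f → Measurable g → 0 ≤ a →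
      ((volume : Measure I).restrict A).map f = ENNReal.ofReal a • volume →
      ((volume : Measure I).restrict B).map g = ENNReal.ofReal b • volume →
      ((volume : Measure (I × I)).restrict (A ×ˢ B)).map (fun p => (f p.1, g p.2))
        = ENNReal.ofReal (a * b) • volume := by
    intro A B f g a b hf hg ha h1 h2
    rw [Measure.volume_eq_prod, ← Measure.prod_restrict]
    have := Measure.map_prod_map (volume.restrict A) (volume.restrict B) hf hg
    rw [h1, h2] at this
    rw [show (fun p : I × I => (f p.1, g p.2)) = Prod.map f g from rfl, ← this,
      Measure.prod_smul_left, Measure.prod_smul_right, smul_smul, ENNReal.ofReal_mul ha]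
  have h0 : (0 : ℝ) ≤ q.1 := q.1.2.1
  have h0' : (0 : ℝ) ≤ 1 - q.1 := sub_nonneg.2 q.1.2.2
  rw [quad_preimage]
  fin_cases j
  · exact key _ _ _ _ _ _ (hl _) (hl _) h0 (map_leftPos_restrict _) (map_leftPos_restrict _)
  · exact key _ _ _ _ _ _ (hl _) (hr _) h0 (map_leftPos_restrict _) (map_rightPos_restrict _)
  · exact key _ _ _ _ _ _ (hr _) (hl _) h0' (map_rightPos_restrict _) (map_leftPos_restrict _)
  · exact key _ _ _ _ _ _ (hr _) (hr _) h0' (map_rightPos_restrict _) (map_rightPos_restrict _)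

/-! ### The recursive construction and its moments -/

/-- The weighted sum on the right-hand side of the recursive equation, for a random function `Y`
that need not be càdlàg. -/
def spliceSum {Θ : Type*} (Y : Θ → I → ℝ) (q : I × I) (F : Fin 4 → Θ) (s : I) : ℝ :=
  ∑ j, qwt q s j * Y (F j) (qpos q s j)

section Moments

variable {Θ : Type*} [MeasurableSpace Θ] {π : Measure Θ} [IsProbabilityMeasure π]

theorem measurable_spliceSum {Y : Θ → I → ℝ} (hY : Measurable fun p : Θ × I => Y p.1 p.2) (s : I) :
    Measurable fun p : (I × I) × (Fin 4 → Θ) => spliceSum Y p.1 p.2 s := by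
  have h : Measurable fun q : (I × I) × (Fin 4 → Θ) => (q.1, s) :=
    measurable_fst.prodMk measurable_const
  refine Finset.measurable_sum _ fun j _ => ((measurable_qwt j).comp h).mul ?_
  exact hY.comp (((measurable_pi_apply j).comp measurable_snd).prodMk ((measurable_qpos j).comp h))

/-- Independent centred random variables are orthogonal. -/
theorem integral_sq_sum_eval {g : Fin 4 → Θ → ℝ} (hg : ∀ j, MemLp (g j) 2 π)
    (h0 : ∀ j, ∫ θ, g j θ ∂π = 0) :
    ∫ F : Fin 4 → Θ, (∑ j, g j (F j)) ^ 2 ∂Measure.pi (fun _ => π) = ∑ j, ∫ θ, g j θ ^ 2 ∂π := by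
  have h := variance_sum_pi (μ := fun _ : Fin 4 => π) hg
  have hm : ∀ j, MemLp (fun F : Fin 4 → Θ => g j (F j)) 2 (Measure.pi fun _ => π) := fun j =>
    (hg j).comp_measurePreserving (measurePreserving_eval (fun _ : Fin 4 => π) j)
  rw [variance_of_integral_eq_zero] at h
  · rw [Finset.sum_congr rfl fun j _ =>
      variance_of_integral_eq_zero (hg j).aestronglyMeasurable.aemeasurable (h0 j)] at h
    rw [← h]
    simp
  · exact (memLp_finsetSum' _ fun j _ => hm j).aestronglyMeasurable.aemeasurable
  · simp only [Finset.sum_apply]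
    rw [integral_finsetSum _ fun j _ => (hm j).integrable (by norm_num)]
    refine Finset.sum_eq_zero fun j _ => ?_
    rw [integral_comp_eval (μ := fun _ : Fin 4 => π) (hg j).aestronglyMeasurable, h0 j]

theorem integral_spliceSum {Y : Θ → I → ℝ} {s : I} (hi : ∀ t, Integrable (fun θ => Y θ t) π)
    (hs : Integrable (fun p : (I × I) × (Fin 4 → Θ) => spliceSum Y p.1 p.2 s)
      ((volume : Measure (I × I)).prod (Measure.pi fun _ => π))) :
    ∫ p : (I × I) × (Fin 4 → Θ), spliceSum Y p.1 p.2 s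
        ∂((volume : Measure (I × I)).prod (Measure.pi fun _ => π))
      = ∫ q : I × I, ∑ j, qwt q s j * ∫ θ, Y θ (qpos q s j) ∂π := by
  rw [integral_prod _ hs]
  refine integral_congr_ae (Eventually.of_forall fun q => ?_)
  simp only [spliceSum]
  rw [integral_finsetSum _ fun j _ => (integrable_comp_eval (μ := fun _ : Fin 4 => π) (i := j)
    (f := fun θ => Y θ (qpos q s j)) (hi _)).const_mul _]
  refine Finset.sum_congr rfl fun j _ => ?_
  rw [integral_const_mul, integral_comp_eval (μ := fun _ : Fin 4 => π) (i := j)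
    (f := fun θ => Y θ (qpos q s j)) (hi _).aestronglyMeasurable]

/-- The contraction factor `4 / (2β + 1)²` of the second moments. -/
def qθ : ℝ := 4 / (2 * qβ + 1) ^ 2

theorem qθ_nonneg : 0 ≤ qθ := by unfold qθ; positivity

theorem qθ_lt : qθ < 0.888 := by
  have := qβ_gt
  unfold qθ
  rw [div_lt_iff₀ (by nlinarith)]
  nlinarith

/-- For a centred random function, one step of the recursion contracts the second moments. -/
theorem spliceSum_second_moment {Y : Θ → I → ℝ} (hY : Measurable fun p : Θ × I => Y p.1 p.2)
    (h2 : ∀ t, MemLp (fun θ => Y θ t) 2 π) (h0 : ∀ t, ∫ θ, Y θ t ∂π = 0) {A : ℝ}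
    (hA : ∀ t, ∫ θ, Y θ t ^ 2 ∂π ≤ A) (s : I) :
    MemLp (fun p : (I × I) × (Fin 4 → Θ) => spliceSum Y p.1 p.2 s) 2
        ((volume : Measure (I × I)).prod (Measure.pi fun _ => π)) ∧
      ∫ p : (I × I) × (Fin 4 → Θ), spliceSum Y p.1 p.2 s ^ 2
        ∂((volume : Measure (I × I)).prod (Measure.pi fun _ => π)) ≤ qθ * A := by
  have hm := measurable_spliceSum hY s
  have hA0 : 0 ≤ A := (integral_nonneg fun θ => sq_nonneg _).trans (hA s)
  have hgj : ∀ q : I × I, ∀ j, MemLp (fun θ => qwt q s j * Y θ (qpos q s j)) 2 π :=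
    fun q j => (h2 _).const_mul _
  have inner : ∀ q : I × I, ∫ F : Fin 4 → Θ, spliceSum Y q F s ^ 2 ∂Measure.pi (fun _ => π)
      = ∑ j, qwt q s j ^ 2 * ∫ θ, Y θ (qpos q s j) ^ 2 ∂π := by
    intro q
    have := integral_sq_sum_eval (hgj q) (fun j => by rw [integral_const_mul, h0, mul_zero])
    simp only [spliceSum]
    rw [this]
    refine Finset.sum_congr rfl fun j _ => ?_
    rw [← integral_const_mul]
    simp only [mul_pow]
  have bound : ∀ q : I × I, ∑ j, qwt q s j ^ 2 * ∫ θ, Y θ (qpos q s j) ^ 2 ∂π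
      ≤ ∑ j, (qhit q s j * qarea q j ^ (2 * qβ)) * A := by
    intro q
    refine Finset.sum_le_sum fun j _ => ?_
    have := qwt_pow q s j (two_ne_zero)
    push_cast at this
    rw [← this]
    exact mul_le_mul_of_nonneg_left (hA _) (sq_nonneg _)
  have hi : Integrable (fun p : (I × I) × (Fin 4 → Θ) => spliceSum Y p.1 p.2 s ^ 2)
      ((volume : Measure (I × I)).prod (Measure.pi fun _ => π)) := by
    refine (integrable_prod_iff (hm.pow_const 2).aestronglyMeasurable).2 ⟨?_, ?_⟩
    · refine Eventually.of_forall fun q => ?_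
      have : MemLp (fun F : Fin 4 → Θ => ∑ j, qwt q s j * Y (F j) (qpos q s j)) 2
          (Measure.pi fun _ => π) := memLp_finsetSum _ fun j _ =>
        (hgj q j).comp_measurePreserving (measurePreserving_eval (fun _ : Fin 4 => π) j)
      exact this.integrable_sq
    · have e : (fun q : I × I => ∫ F : Fin 4 → Θ, ‖spliceSum Y q F s ^ 2‖ ∂Measure.pi fun _ => π)
          = fun q => ∑ j, qwt q s j ^ 2 * ∫ θ, Y θ (qpos q s j) ^ 2 ∂π := by
        funext q
        rw [← inner q]
        simp
      have hmeas : Measurable fun q : I × I =>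
          ∫ F : Fin 4 → Θ, ‖spliceSum Y q F s ^ 2‖ ∂Measure.pi fun _ => π :=
        ((hm.pow_const 2).norm.stronglyMeasurable.integral_prod_right').measurable
      refine integrable_of_bdd hmeas (4 * A) fun q => ?_
      have e' := congrFun e q
      rw [e', abs_of_nonneg (Finset.sum_nonneg fun j _ => mul_nonneg (sq_nonneg _)
        (integral_nonneg fun θ => sq_nonneg _))]
      calc _ ≤ ∑ _j : Fin 4, A := Finset.sum_le_sum fun j _ =>
            (mul_le_of_le_one_left (integral_nonneg fun θ => sq_nonneg _)
              (pow_le_one₀ (qwt_nonneg _ _ _) (qwt_le_one _ _ _))).trans (hA _)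
        _ = 4 * A := by simp
  refine ⟨(memLp_two_iff_integrable_sq hm.aestronglyMeasurable).2 hi, ?_⟩
  rw [integral_prod _ hi]
  simp only [inner]
  have hκ : 0 ≤ 2 * qβ := by linarith [qβ_pos]
  have hI : Integrable fun q : I × I => ∑ j, (qhit q s j * qarea q j ^ (2 * qβ)) * A :=
    integrable_finsetSum _ fun j _ => (integrable_qhit_mul_qarea s j hκ).mul_const _
  refine (integral_mono_of_nonneg (Eventually.of_forall fun q => Finset.sum_nonneg fun j _ =>
    mul_nonneg (sq_nonneg _) (integral_nonneg fun θ => sq_nonneg _)) hI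
    (Eventually.of_forall bound)).trans ?_
  rw [integral_finsetSum _ fun j _ => (integrable_qhit_mul_qarea s j hκ).mul_const _]
  simp only [integral_mul_const]
  rw [← Finset.sum_mul]
  exact mul_le_mul_of_nonneg_right (sum_integral_qhit_mul_qarea_le s hκ) hA0

end Moments

/-! ### Finite-dimensional characteristic functions -/

theorem norm_cexp_sub_cexp_le (a b : ℝ) :
    ‖Complex.exp (a * Complex.I) - Complex.exp (b * Complex.I)‖ ≤ |a - b| := by
  have : Complex.exp (a * Complex.I) - Complex.exp (b * Complex.I)
      = Complex.exp (b * Complex.I) * (Complex.exp (Complex.I * ((a - b : ℝ) : ℂ)) - 1) := by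
    rw [mul_sub, mul_one, ← Complex.exp_add]
    congr 2
    push_cast; ring
  rw [this, norm_mul, Complex.norm_exp_ofReal_mul_I, one_mul]
  exact Real.norm_exp_I_mul_ofReal_sub_one_le

/-- The characteristic function of the values of a random càdlàg function of law `ν` at finitely
many points `s i`. -/
def fddChar {ι : Type} [Fintype ι] (ν : Measure CadlagFun) (s : ι → I) (t : ι → ℝ) : ℂ :=
  ∫ f, Complex.exp ((∑ i, t i * f (s i) : ℝ) * Complex.I) ∂ν

/-- A law on the space of càdlàg functions is determined by its finite-dimensional characteristic
functions. -/
theorem CadlagFun.measure_ext {μ ν : Measure CadlagFun} [IsProbabilityMeasure μ]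
    [IsProbabilityMeasure ν]
    (h : ∀ (J : Finset I) (t : J → ℝ),
      fddChar μ (fun i : J => (i : I)) t = fddChar ν (fun i : J => (i : I)) t) : μ = ν := by
  have hm : Measurable CadlagFun.toFun := comap_measurable _
  have key : μ.map CadlagFun.toFun = ν.map CadlagFun.toFun := by
    have : ∀ J : Finset I, IsProbabilityMeasure (((ν.map CadlagFun.toFun)).map J.restrict) := by
      intro J
      have := Measure.isProbabilityMeasure_map (μ := ν) hm.aemeasurable
      exact Measure.isProbabilityMeasure_map (J.measurable_restrict).aemeasurable
    refine IsProjectiveLimit.unique (P := fun J => (ν.map CadlagFun.toFun).map J.restrict)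
      (fun J => ?_) (fun J => rfl)
    have hr : Measurable (J.restrict (π := fun _ : I => ℝ)) := J.measurable_restrict
    have hc : Measurable fun f : CadlagFun => J.restrict f.toFun := hr.comp hm
    have : IsProbabilityMeasure ((μ.map CadlagFun.toFun).map J.restrict) := by
      have := Measure.isProbabilityMeasure_map (μ := μ) hm.aemeasurable
      exact Measure.isProbabilityMeasure_map hr.aemeasurable
    refine Measure.ext_of_charFunDual (funext fun L => ?_)
    have hL : ∀ v : J → ℝ, L v = ∑ i, L (Pi.single i 1) * v i := by
      intro v
      have hv : v = ∑ i, v i • (Pi.single i (1 : ℝ) : J → ℝ) := by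
        ext k
        simp [Finset.sum_apply, Pi.single_apply]
      conv_lhs => rw [hv, map_sum]
      exact Finset.sum_congr rfl fun i _ => by rw [map_smul, smul_eq_mul, mul_comm]
    have e : ∀ ρ : Measure CadlagFun, charFunDual ((ρ.map CadlagFun.toFun).map J.restrict) L
        = fddChar ρ (fun i : J => (i : I)) (fun i => L (Pi.single i 1)) := by
      intro ρ
      rw [charFunDual_apply, Measure.map_map hr hm, integral_map (hr.comp hm).aemeasurable]
      · simp only [fddChar]
        refine integral_congr_ae (Eventually.of_forall fun f => ?_)
        simp only [Function.comp]
        rw [hL]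
        rfl
      · exact (Measurable.cexp (by fun_prop)).aestronglyMeasurable
    rw [e, e, h]
  ext A hA
  obtain ⟨B, hB, rfl⟩ := hA
  rw [← Measure.map_apply hm hB, key, Measure.map_apply hm hB]

theorem measurable_fddExp {ι : Type} [Fintype ι] (s : ι → I) (t : ι → ℝ) :
    Measurable fun f : CadlagFun => Complex.exp ((∑ i, t i * f (s i) : ℝ) * Complex.I) := by
  have : Measurable fun f : CadlagFun => ∑ i, t i * f (s i) :=
    Finset.measurable_sum _ fun i _ => (CadlagFun.measurable_eval _).const_mul _
  fun_prop

/-! ### Uniqueness of the fixed point -/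

/-- The mean function `(s (1 - s))^{β/2}` of the limit process. -/
def qh (s : I) : ℝ := ((s : ℝ) * (1 - s)) ^ (qβ / 2)

/-- The moment condition under which fixed points are unique: the prescribed mean function and
uniformly bounded second moments of the one-dimensional marginals. -/
def HasWeakMoments (μ : Measure CadlagFun) : Prop :=
  (∀ s : I, ∫ f, f s ∂μ = qh s) ∧
    ∃ A : ℝ, ∀ s : I, MemLp (fun f : CadlagFun => f s) 2 μ ∧ ∫ f, f s ^ 2 ∂μ ≤ A

theorem HasLimitMoments.weak {μ : Measure CadlagFun} (h : HasLimitMoments μ) :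
    HasWeakMoments μ := by
  refine ⟨h.1, (∫⁻ f, f.supNorm ^ 2 ∂μ).toReal, fun s => ?_⟩
  have hm : Measurable fun f : CadlagFun => f s := CadlagFun.measurable_eval s
  have hle : ∫⁻ f, ‖f s ^ 2‖ₑ ∂μ ≤ ∫⁻ f, f.supNorm ^ 2 ∂μ := by
    refine lintegral_mono fun f => ?_
    rw [enorm_pow]
    gcongr
    exact le_iSup (fun s => ‖f s‖ₑ) s
  have hi : Integrable (fun f : CadlagFun => f s ^ 2) μ :=
    ⟨(hm.pow_const 2).aestronglyMeasurable, hle.trans_lt h.2⟩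
  refine ⟨(memLp_two_iff_integrable_sq hm.aestronglyMeasurable).2 hi, ?_⟩
  rw [integral_eq_lintegral_of_nonneg_ae (Eventually.of_forall fun f => sq_nonneg _)
    (hm.pow_const 2).aestronglyMeasurable]
  refine ENNReal.toReal_mono h.2.ne (le_trans (lintegral_mono fun f => ?_) hle)
  rw [← ofReal_norm]
  exact ENNReal.ofReal_le_ofReal (le_abs_self _)

/-- The coupled recursion: both components use the same splitting point. -/
def quadMapPair (p : (I × I) × (Fin 4 → CadlagFun × CadlagFun)) : CadlagFun × CadlagFun :=
  (quadMap p.1.1 p.1.2 fun j => (p.2 j).1, quadMap p.1.1 p.1.2 fun j => (p.2 j).2)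

theorem measurable_prod_pi_comp {α β : Type*} [MeasurableSpace α] [MeasurableSpace β] {g : α → β}
    (hg : Measurable g) :
    Measurable fun p : (I × I) × (Fin 4 → α) => (p.1, fun j => g (p.2 j)) :=
  measurable_fst.prodMk (measurable_pi_iff.2 fun j =>
    hg.comp ((measurable_pi_apply j).comp measurable_snd))

theorem measurable_quadMapPair : Measurable quadMapPair :=
  (measurable_quadMap.comp (measurable_prod_pi_comp measurable_fst)).prodMk
    (measurable_quadMap.comp (measurable_prod_pi_comp measurable_snd))

/-- Applying a map to each of the four independent inputs of the recursion. -/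
theorem map_prod_pi_comp {α β : Type*} [MeasurableSpace α] [MeasurableSpace β] {π : Measure α}
    [IsProbabilityMeasure π] {g : α → β} (hg : Measurable g) :
    ((volume : Measure (I × I)).prod (Measure.pi fun _ : Fin 4 => π)).map
        (fun p => (p.1, fun j => g (p.2 j)))
      = (volume : Measure (I × I)).prod (Measure.pi fun _ : Fin 4 => π.map g) := by
  have := Measure.isProbabilityMeasure_map (μ := π) hg.aemeasurable
  have h1 := Measure.pi_map_pi (μ := fun _ : Fin 4 => π) (f := fun _ => g)
    (fun _ => hg.aemeasurable)
  have hgm : Measurable fun (x : Fin 4 → α) (j : Fin 4) => g (x j) :=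
    measurable_pi_iff.2 fun j => hg.comp (measurable_pi_apply j)
  rw [← h1]
  have h2 := Measure.map_prod_map (volume : Measure (I × I)) (Measure.pi fun _ : Fin 4 => π)
    measurable_id hgm
  rw [Measure.map_id] at h2
  rw [h2]
  rfl

/-- Two fixed points with the right moments admit couplings whose pointwise `L²`-distances decay
geometrically. -/
theorem exists_coupling {μ ν : Measure CadlagFun} [IsProbabilityMeasure μ] [IsProbabilityMeasure ν]
    (hμ : IsFixedPointLaw μ) (hν : IsFixedPointLaw ν) (mμ : HasWeakMoments μ)
    (mν : HasWeakMoments ν) :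
    ∃ A : ℝ, ∀ n : ℕ, ∃ π : Measure (CadlagFun × CadlagFun), IsProbabilityMeasure π ∧
      π.map Prod.fst = μ ∧ π.map Prod.snd = ν ∧
      (∀ s, MemLp (fun p : CadlagFun × CadlagFun => p.1 s - p.2 s) 2 π) ∧
      (∀ s, ∫ p : CadlagFun × CadlagFun, p.1 s - p.2 s ∂π = 0) ∧
      ∀ s, ∫ p : CadlagFun × CadlagFun, (p.1 s - p.2 s) ^ 2 ∂π ≤ qθ ^ n * A := by
  obtain ⟨m1, A1, hA1⟩ := mμ
  obtain ⟨m2, A2, hA2⟩ := mν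
  have memfst : ∀ π : Measure (CadlagFun × CadlagFun), π.map Prod.fst = μ → ∀ s,
      MemLp (fun p : CadlagFun × CadlagFun => p.1 s) 2 π := fun π h s =>
    MemLp.comp_measurePreserving (hA1 s).1 ⟨measurable_fst, h⟩
  have memsnd : ∀ π : Measure (CadlagFun × CadlagFun), π.map Prod.snd = ν → ∀ s,
      MemLp (fun p : CadlagFun × CadlagFun => p.2 s) 2 π := fun π h s =>
    MemLp.comp_measurePreserving (hA2 s).1 ⟨measurable_snd, h⟩
  have ifst : ∀ π : Measure (CadlagFun × CadlagFun), π.map Prod.fst = μ → ∀ g : CadlagFun → ℝ,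
      Measurable g → ∫ p : CadlagFun × CadlagFun, g p.1 ∂π = ∫ f, g f ∂μ := by
    intro π h g hg
    rw [← h, integral_map measurable_fst.aemeasurable hg.aestronglyMeasurable]
  have isnd : ∀ π : Measure (CadlagFun × CadlagFun), π.map Prod.snd = ν → ∀ g : CadlagFun → ℝ,
      Measurable g → ∫ p : CadlagFun × CadlagFun, g p.2 ∂π = ∫ f, g f ∂ν := by
    intro π h g hg
    rw [← h, integral_map measurable_snd.aemeasurable hg.aestronglyMeasurable]
  have mean : ∀ π : Measure (CadlagFun × CadlagFun), IsProbabilityMeasure π →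
      π.map Prod.fst = μ → π.map Prod.snd = ν →
      ∀ s, ∫ p : CadlagFun × CadlagFun, p.1 s - p.2 s ∂π = 0 := by
    intro π _ h1 h2 s
    rw [integral_sub ((memfst π h1 s).integrable (by norm_num))
      ((memsnd π h2 s).integrable (by norm_num)),
      ifst π h1 (fun f => f s) (CadlagFun.measurable_eval s),
      isnd π h2 (fun f => f s) (CadlagFun.measurable_eval s), m1, m2, sub_self]
  refine ⟨2 * A1 + 2 * A2, fun n => ?_⟩
  induction n with
  | zero =>
    have h1 : (μ.prod ν).map Prod.fst = μ := Measure.fst_prod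
    have h2 : (μ.prod ν).map Prod.snd = ν := Measure.snd_prod
    refine ⟨μ.prod ν, inferInstance, h1, h2,
      fun s => (memfst _ h1 s).sub (memsnd _ h2 s), mean _ inferInstance h1 h2, fun s => ?_⟩
    have i1 := (memfst _ h1 s).integrable_sq
    have i2 := (memsnd _ h2 s).integrable_sq
    have : ∫ p : CadlagFun × CadlagFun, (p.1 s - p.2 s) ^ 2 ∂(μ.prod ν)
        ≤ ∫ p : CadlagFun × CadlagFun, 2 * p.1 s ^ 2 + 2 * p.2 s ^ 2 ∂(μ.prod ν) := by
      refine integral_mono (((memfst _ h1 s).sub (memsnd _ h2 s)).integrable_sq)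
        ((i1.const_mul 2).add (i2.const_mul 2)) fun p => ?_
      simp only
      nlinarith [sq_nonneg (p.1 s + p.2 s)]
    refine this.trans ?_
    rw [integral_add (i1.const_mul 2) (i2.const_mul 2), integral_const_mul, integral_const_mul,
      ifst _ h1 (fun f => f s ^ 2) ((CadlagFun.measurable_eval s).pow_const 2),
      isnd _ h2 (fun f => f s ^ 2) ((CadlagFun.measurable_eval s).pow_const 2)]
    have := (hA1 s).2
    have := (hA2 s).2
    linarith
  | succ n ih =>
    -- four independent coupled pairs are spliced at a common splitting point
    obtain ⟨π, hπ, h1, h2, h3, h4, h5⟩ := ih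
    let Y : CadlagFun × CadlagFun → I → ℝ := fun p s => p.1 s - p.2 s
    have hY : Measurable fun p : (CadlagFun × CadlagFun) × I => Y p.1 p.2 :=
      (CadlagFun.measurable_apply (measurable_fst.comp measurable_fst) measurable_snd).sub
        (CadlagFun.measurable_apply (measurable_snd.comp measurable_fst) measurable_snd)
    have hstep := spliceSum_second_moment hY h3 h4 h5
    have hdiff : ∀ p s, (quadMapPair p).1 s - (quadMapPair p).2 s = spliceSum Y p.1 p.2 s := by
      intro p s
      simp only [quadMapPair, spliceSum, Y]
      rw [quadMap_eq_sum, quadMap_eq_sum, ← Finset.sum_sub_distrib]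
      exact Finset.sum_congr rfl fun j _ => by ring
    set π' := ((volume : Measure (I × I)).prod (Measure.pi fun _ : Fin 4 => π)).map quadMapPair
      with hπ'
    have pπ' : IsProbabilityMeasure π' :=
      Measure.isProbabilityMeasure_map measurable_quadMapPair.aemeasurable
    have g1 : π'.map Prod.fst = μ := by
      rw [hπ', Measure.map_map measurable_fst measurable_quadMapPair]
      conv_rhs => rw [← hμ, ← h1, ← map_prod_pi_comp measurable_fst]
      rw [Measure.map_map measurable_quadMap (measurable_prod_pi_comp measurable_fst)]
      rfl
    have g2 : π'.map Prod.snd = ν := by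
      rw [hπ', Measure.map_map measurable_snd measurable_quadMapPair]
      conv_rhs => rw [← hν, ← h2, ← map_prod_pi_comp measurable_snd]
      rw [Measure.map_map measurable_quadMap (measurable_prod_pi_comp measurable_snd)]
      rfl
    refine ⟨π', pπ', g1, g2, fun s => (memfst _ g1 s).sub (memsnd _ g2 s), mean _ pπ' g1 g2,
      fun s => ?_⟩
    have hm : Measurable fun p : CadlagFun × CadlagFun => (p.1 s - p.2 s) ^ 2 :=
      (((CadlagFun.measurable_eval s).comp measurable_fst).sub
        ((CadlagFun.measurable_eval s).comp measurable_snd)).pow_const 2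
    rw [hπ', integral_map measurable_quadMapPair.aemeasurable hm.aestronglyMeasurable]
    simp only [hdiff]
    rw [pow_succ, mul_comm (qθ ^ n), mul_assoc]
    exact (hstep s).2

/-- Solutions with the prescribed mean function and bounded second moments coincide, since
their characteristic functions differ by at most the `L²`-distance of any coupling. -/
theorem fixedPointLaw_unique {μ ν : Measure CadlagFun} [IsProbabilityMeasure μ]
    [IsProbabilityMeasure ν] (hμ : IsFixedPointLaw μ) (hν : IsFixedPointLaw ν)
    (mμ : HasWeakMoments μ) (mν : HasWeakMoments ν) : μ = ν := by
  obtain ⟨A, hA⟩ := exists_coupling hμ hν mμ mν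
  refine CadlagFun.measure_ext fun J t => ?_
  rw [← sub_eq_zero, ← norm_le_zero_iff]
  have lim : Tendsto (fun n : ℕ => ∑ i : J, |t i| * √(qθ ^ n * A)) atTop (𝓝 0) := by
    have h0 : Tendsto (fun n : ℕ => qθ ^ n * A) atTop (𝓝 0) := by
      simpa using (tendsto_pow_atTop_nhds_zero_of_lt_one qθ_nonneg
        (qθ_lt.trans (by norm_num))).mul_const A
    have h1 := (Real.continuous_sqrt.tendsto 0).comp h0
    rw [Real.sqrt_zero] at h1
    have := tendsto_finsetSum (Finset.univ : Finset J) fun i _ => h1.const_mul |t i|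
    simpa using this
  refine ge_of_tendsto' lim fun n => ?_
  obtain ⟨π, hπ, h1, h2, h3, -, h5⟩ := hA n
  have me := measurable_fddExp (fun i : J => (i : I)) t
  have e1 : fddChar μ (fun i : J => (i : I)) t = ∫ p : CadlagFun × CadlagFun,
      Complex.exp ((∑ i : J, t i * p.1 i : ℝ) * Complex.I) ∂π := by
    rw [fddChar, ← h1, integral_map measurable_fst.aemeasurable me.aestronglyMeasurable]
  have e2 : fddChar ν (fun i : J => (i : I)) t = ∫ p : CadlagFun × CadlagFun,
      Complex.exp ((∑ i : J, t i * p.2 i : ℝ) * Complex.I) ∂π := by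
    rw [fddChar, ← h2, integral_map measurable_snd.aemeasurable me.aestronglyMeasurable]
  have b1 : Integrable (fun p : CadlagFun × CadlagFun =>
      Complex.exp ((∑ i : J, t i * p.1 i : ℝ) * Complex.I)) π :=
    Integrable.of_bound (me.comp measurable_fst).aestronglyMeasurable 1
      (Eventually.of_forall fun p => (Complex.norm_exp_ofReal_mul_I _).le)
  have b2 : Integrable (fun p : CadlagFun × CadlagFun =>
      Complex.exp ((∑ i : J, t i * p.2 i : ℝ) * Complex.I)) π :=
    Integrable.of_bound (me.comp measurable_snd).aestronglyMeasurable 1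
      (Eventually.of_forall fun p => (Complex.norm_exp_ofReal_mul_I _).le)
  have i1 : ∀ s, Integrable (fun p : CadlagFun × CadlagFun => |p.1 s - p.2 s|) π :=
    fun s => ((h3 s).integrable (by norm_num)).abs
  rw [e1, e2, ← integral_sub b1 b2]
  calc _ ≤ ∫ p : CadlagFun × CadlagFun, ∑ i : J, |t i| * |p.1 i - p.2 i| ∂π := by
        refine norm_integral_le_of_norm_le (integrable_finsetSum _ fun i _ => (i1 _).const_mul _)
          (Eventually.of_forall fun p => (norm_cexp_sub_cexp_le _ _).trans ?_)
        rw [← Finset.sum_sub_distrib]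
        refine (Finset.abs_sum_le_sum_abs _ _).trans (le_of_eq ?_)
        exact Finset.sum_congr rfl fun i _ => by rw [← mul_sub, abs_mul]
    _ = ∑ i : J, |t i| * ∫ p : CadlagFun × CadlagFun, |p.1 i - p.2 i| ∂π := by
        rw [integral_finsetSum _ fun i _ => (i1 _).const_mul _]
        simp only [integral_const_mul]
    _ ≤ _ := by
        refine Finset.sum_le_sum fun i _ => mul_le_mul_of_nonneg_left ?_ (abs_nonneg _)
        refine Real.le_sqrt_of_sq_le (le_trans ?_ (h5 i))
        -- Jensen's inequality, in the form of a nonnegative variance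
        have hv := variance_nonneg (fun p : CadlagFun × CadlagFun => |p.1 i - p.2 i|) π
        have hv2 := variance_eq_sub (h3 i).abs
        simp only [Pi.pow_apply, Pi.abs_apply, sq_abs] at hv2
        change Var[fun p : CadlagFun × CadlagFun => |p.1 i - p.2 i|; π] = _ at hv2
        rw [hv2] at hv
        linarith

/-! ### The mean function is invariant -/

theorem qh_nonneg (s : I) : 0 ≤ qh s :=
  Real.rpow_nonneg (mul_nonneg s.2.1 (sub_nonneg.2 s.2.2)) _

theorem qh_zero : qh 0 = 0 := by
  simp [qh, Real.zero_rpow (by linarith [qβ_pos] : qβ / 2 ≠ 0)]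

theorem qh_one : qh 1 = 0 := by
  simp [qh, Real.zero_rpow (by linarith [qβ_pos] : qβ / 2 ≠ 0)]

theorem continuous_qh : Continuous qh :=
  Continuous.rpow_const (by fun_prop) fun _ => Or.inr (by linarith [qβ_pos])

theorem qh_le_one (s : I) : qh s ≤ 1 :=
  Real.rpow_le_one (mul_nonneg s.2.1 (sub_nonneg.2 s.2.2))
    (mul_le_one₀ s.2.2 (sub_nonneg.2 s.2.2) (by linarith [s.2.1])) (by linarith [qβ_pos])

/-- The mean operator of the recursion, written as two integrals over the first coordinate of the
splitting point. -/
theorem integral_sum_qwt_mul (g : I → ℝ) (hg : Measurable g) {C : ℝ} (hC : ∀ t, |g t| ≤ C)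
    (s : I) :
    ∫ q : I × I, ∑ j, qwt q s j * g (qpos q s j) = 2 / (qβ + 1) *
      ((∫ x : I, (if s < x then g (leftPos x s) else 0) * (x : ℝ) ^ qβ) +
        ∫ x : I, (if s < x then 0 else g (rightPos x s)) * (1 - (x : ℝ)) ^ qβ) := by
  have hi : ∀ j, Integrable fun q : I × I => qwt q s j * g (qpos q s j) := by
    intro j
    have hm : Measurable fun q : I × I => (q, s) := measurable_id.prodMk measurable_const
    refine integrable_of_bdd (((measurable_qwt j).comp hm).mul
      (hg.comp ((measurable_qpos j).comp hm))) C fun q => ?_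
    rw [abs_mul, abs_of_nonneg (qwt_nonneg _ _ _)]
    exact (mul_le_of_le_one_left (abs_nonneg _) (qwt_le_one _ _ _)).trans (hC _)
  rw [integral_finsetSum _ fun j _ => hi j, Fin.sum_univ_four]
  have hl : ∀ j : Fin 4, j = 0 ∨ j = 1 → ∫ q : I × I, qwt q s j * g (qpos q s j)
      = (∫ x : I, (if s < x then g (leftPos x s) else 0) * (x : ℝ) ^ qβ) * (1 / (qβ + 1)) := by
    intro j hj
    have := integral_mul_qarea_rpow (fun x => if s < x then g (leftPos x s) else 0) qβ_pos.le j
    simp only [hj, if_true] at this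
    rw [← this]
    refine integral_congr_ae (Eventually.of_forall fun q => ?_)
    rcases hj with rfl | rfl <;> by_cases h : s < q.1 <;> simp [qwt, qhit, qpos, h, mul_comm]
  have hr : ∀ j : Fin 4, j = 2 ∨ j = 3 → ∫ q : I × I, qwt q s j * g (qpos q s j)
      = (∫ x : I, (if s < x then 0 else g (rightPos x s)) * (1 - (x : ℝ)) ^ qβ)
        * (1 / (qβ + 1)) := by
    intro j hj
    have := integral_mul_qarea_rpow (fun x => if s < x then 0 else g (rightPos x s)) qβ_pos.le j
    have hj' : ¬ (j = 0 ∨ j = 1) := by rcases hj with rfl | rfl <;> simp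
    simp only [hj', if_false] at this
    rw [← this]
    refine integral_congr_ae (Eventually.of_forall fun q => ?_)
    rcases hj with rfl | rfl <;> by_cases h : s < q.1 <;> simp [qwt, qhit, qpos, h, mul_comm]
  rw [hl 0 (by simp), hl 1 (by simp), hr 2 (by simp), hr 3 (by simp)]
  ring

theorem integral_posPart_rpow (s : I) {κ : ℝ} (hκ : 0 < κ) :
    ∫ x : I, (max ((x : ℝ) - s) 0) ^ κ = (1 - (s : ℝ)) ^ (κ + 1) / (κ + 1) := by
  rw [integral_unitInterval (fun x => (max (x - (s : ℝ)) 0) ^ κ)]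
  have hc : Continuous fun x : ℝ => (max (x - (s : ℝ)) 0) ^ κ :=
    Continuous.rpow_const (by fun_prop) fun _ => Or.inr hκ.le
  rw [← intervalIntegral.integral_add_adjacent_intervals (b := (s : ℝ))
    (hc.intervalIntegrable _ _) (hc.intervalIntegrable _ _)]
  have h1 : ∫ x in (0 : ℝ)..s, (max (x - (s : ℝ)) 0) ^ κ = 0 := by
    rw [intervalIntegral.integral_congr (g := fun _ => (0 : ℝ))]
    · simp
    · intro x hx
      rw [uIcc_of_le s.2.1] at hx
      show (max (x - (s : ℝ)) 0) ^ κ = 0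
      rw [max_eq_right (by linarith [hx.2]), Real.zero_rpow hκ.ne']
  have h2 : ∫ x in (s : ℝ)..1, (max (x - (s : ℝ)) 0) ^ κ = ∫ x in (s : ℝ)..1, (x - s) ^ κ := by
    refine intervalIntegral.integral_congr fun x hx => ?_
    rw [uIcc_of_le s.2.2] at hx
    rw [max_eq_left (by linarith [hx.1])]
  rw [h1, h2, zero_add, intervalIntegral.integral_comp_sub_right (fun x => x ^ κ),
    integral_rpow (Or.inl (by linarith))]
  simp [Real.zero_rpow (by linarith : κ + 1 ≠ 0)]

/-- The function `(s (1 - s))^{β/2}` is a fixed point of the mean operator. -/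
theorem integral_sum_qwt_mul_qh (s : I) :
    ∫ q : I × I, ∑ j, qwt q s j * qh (qpos q s j) = qh s := by
  rw [integral_sum_qwt_mul qh continuous_qh.measurable (C := 1)
    fun t => by rw [abs_of_nonneg (qh_nonneg t)]; exact qh_le_one t]
  have hβ := qβ_pos
  have hs0 : (0 : ℝ) ≤ s := s.2.1
  have hs1 : (0 : ℝ) ≤ 1 - s := sub_nonneg.2 s.2.2
  have hα : 0 < qβ / 2 := by linarith
  have e1 : ∀ x : I, (if s < x then qh (leftPos x s) else 0) * (x : ℝ) ^ qβ
      = (s : ℝ) ^ (qβ / 2) * (max ((x : ℝ) - s) 0) ^ (qβ / 2) := by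
    intro x
    by_cases h : s < x
    · have h' : (s : ℝ) < x := h
      have hx : (0 : ℝ) < x := hs0.trans_lt h'
      rw [if_pos h, qh, coe_leftPos h, max_eq_left (by linarith), ← Real.mul_rpow hs0 (by linarith),
        show (x : ℝ) ^ qβ = ((x : ℝ) ^ 2) ^ (qβ / 2) by
          rw [← Real.rpow_natCast, ← Real.rpow_mul hx.le]; congr 1; push_cast; ring,
        ← Real.mul_rpow _ (by positivity)]
      · congr 1; field_simp
      · exact mul_nonneg (by positivity) (sub_nonneg.2 ((div_le_one hx).2 h'.le))
    · have h' : (x : ℝ) ≤ s := not_lt.1 h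
      rw [if_neg h, max_eq_right (by linarith), Real.zero_rpow hα.ne']; simp
  have e2 : ∀ x : I, (if s < x then 0 else qh (rightPos x s)) * (1 - (x : ℝ)) ^ qβ
      = (1 - (s : ℝ)) ^ (qβ / 2) * (max ((s : ℝ) - x) 0) ^ (qβ / 2) := by
    intro x
    by_cases h : s < x
    · have h' : (s : ℝ) < x := h
      rw [if_pos h, max_eq_right (by linarith), Real.zero_rpow hα.ne']; simp
    · have h' : (x : ℝ) ≤ s := not_lt.1 h
      have hx : 0 ≤ 1 - (x : ℝ) := by linarith
      -- at `x = 1` the relative position is a quotient by zero, but its weight vanishes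
      rcases hx.eq_or_lt with hx0 | hx0
      · rw [← hx0, Real.zero_rpow hβ.ne', mul_zero, max_eq_left (by linarith),
          show (s : ℝ) - x = 0 by linarith, Real.zero_rpow hα.ne', mul_zero]
      rw [if_neg h, qh, coe_rightPos (not_lt.1 h), max_eq_left (by linarith),
        ← Real.mul_rpow hs1 (by linarith),
        show (1 - (x : ℝ)) ^ qβ = ((1 - (x : ℝ)) ^ 2) ^ (qβ / 2) by
          rw [← Real.rpow_natCast, ← Real.rpow_mul hx]; congr 1; push_cast; ring,
        ← Real.mul_rpow _ (by positivity)]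
      · congr 1; field_simp; ring
      · exact mul_nonneg (div_nonneg (by linarith) hx)
          (sub_nonneg.2 ((div_le_one hx0).2 (by linarith)))
  -- both integrands are pure powers of the distance to `s`, so that the integrals are elementary
  simp only [e1, e2, integral_const_mul]
  have e3 : ∫ x : I, (max ((s : ℝ) - x) 0) ^ (qβ / 2) = (s : ℝ) ^ (qβ / 2 + 1) / (qβ / 2 + 1) := by
    have := integral_posPart_rpow (unitInterval.symm s) hα
    rw [← integral_unitInterval_symm] at this
    simp only [unitInterval.coe_symm_eq, sub_sub_sub_cancel_left, sub_sub_cancel] at this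
    exact this
  rw [integral_posPart_rpow s hα, e3, Real.rpow_add_one' hs0 (by linarith),
    Real.rpow_add_one' hs1 (by linarith), qh, Real.mul_rpow hs0 hs1]
  have h4 := qβ_eq
  have : qβ + 1 ≠ 0 := by linarith
  have : qβ / 2 + 1 ≠ 0 := by linarith
  have : qβ + 2 ≠ 0 := by linarith
  field_simp
  linear_combination (-(s : ℝ) ^ (qβ / 2) * (1 - (s : ℝ)) ^ (qβ / 2)) * h4

/-! ### Hölder continuity under the recursion -/

/-- Functions on `[0,1]` that vanish at both endpoints and are Hölder continuous with exponent
`β / 2` and constant `H`. -/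
structure HolderBridge (H : ℝ) (f : I → ℝ) : Prop where
  zero : f 0 = 0
  one : f 1 = 0
  holder : ∀ s t : I, |f s - f t| ≤ H * |(s : ℝ) - t| ^ (qβ / 2)

theorem abs_rpow_sub_rpow_le {a b κ : ℝ} (ha : 0 ≤ a) (hb : 0 ≤ b) (h0 : 0 ≤ κ) (h1 : κ ≤ 1) :
    |a ^ κ - b ^ κ| ≤ |a - b| ^ κ := by
  wlog h : b ≤ a generalizing a b
  · rw [abs_sub_comm, abs_sub_comm a]
    exact this hb ha (le_of_not_ge h)
  rw [abs_of_nonneg (sub_nonneg.2 (Real.rpow_le_rpow hb h h0)), abs_of_nonneg (sub_nonneg.2 h)]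
  have := Real.rpow_add_le_add_rpow hb (sub_nonneg.2 h) h0 h1
  rw [add_sub_cancel] at this
  linarith

theorem holderBridge_qh : HolderBridge 1 qh where
  zero := qh_zero
  one := qh_one
  holder s t := by
    have hs0 : (0 : ℝ) ≤ s := s.2.1
    have hs1 : (0 : ℝ) ≤ 1 - s := sub_nonneg.2 s.2.2
    have ht0 : (0 : ℝ) ≤ t := t.2.1
    have ht1 : (0 : ℝ) ≤ 1 - t := sub_nonneg.2 t.2.2
    rw [one_mul]
    refine (abs_rpow_sub_rpow_le (mul_nonneg hs0 hs1) (mul_nonneg ht0 ht1)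
      (by linarith [qβ_pos]) (by linarith [qβ_lt])).trans ?_
    refine Real.rpow_le_rpow (abs_nonneg _) ?_ (by linarith [qβ_pos])
    rw [show (s : ℝ) * (1 - s) - t * (1 - t) = (s - t) * (1 - s - t) by ring, abs_mul]
    exact mul_le_of_le_one_right (abs_nonneg _) (abs_le.2 ⟨by linarith, by linarith⟩)

theorem HolderBridge.abs_le {H : ℝ} {f : I → ℝ} (hf : HolderBridge H f) (hH : 0 ≤ H) (s : I) :
    |f s| ≤ H := by
  have := hf.holder s 0
  rw [hf.zero, sub_zero] at this
  refine this.trans (mul_le_of_le_one_right hH (Real.rpow_le_one (abs_nonneg _) ?_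
    (by linarith [qβ_pos])))
  simpa [abs_of_nonneg s.2.1] using s.2.2

theorem HolderBridge.continuous {H : ℝ} {f : I → ℝ} (hf : HolderBridge H f) : Continuous f := by
  refine continuous_iff_continuousAt.2 fun t => tendsto_iff_norm_sub_tendsto_zero.2 ?_
  have hc : Continuous fun s : I => H * |(s : ℝ) - t| ^ (qβ / 2) :=
    continuous_const.mul (Continuous.rpow_const (by fun_prop)
      fun _ => Or.inr (by linarith [qβ_pos]))
  have := hc.tendsto t
  simp only [sub_self, abs_zero, Real.zero_rpow (by linarith [qβ_pos] : qβ / 2 ≠ 0),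
    mul_zero] at this
  exact squeeze_zero (fun _ => norm_nonneg _) (fun s => hf.holder s t) this

theorem abs_projIcc_sub_le (a b : ℝ) :
    |(projIcc (0 : ℝ) 1 zero_le_one a : ℝ) - projIcc (0 : ℝ) 1 zero_le_one b| ≤ |a - b| := by
  simpa [Subtype.dist_eq, Real.dist_eq] using
    (LipschitzWith.projIcc (zero_le_one (α := ℝ))).dist_le_mul a b

/-- A function vanishing at the endpoints may be extended by its end values, so that the side
indicator is superfluous. -/
theorem HolderBridge.qwt_mul {H : ℝ} {f : I → ℝ} (hf : HolderBridge H f) (q : I × I) (s : I)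
    (j : Fin 4) : qwt q s j * f (qpos q s j) = qarea q j ^ qβ * f (qpos q s j) := by
  have hl : q.1 ≤ s → q.1 ≠ 0 → f (leftPos q.1 s) = 0 := by
    intro h h0
    have h' : (q.1 : ℝ) ≤ s := h
    have : (0 : ℝ) < q.1 := lt_of_le_of_ne q.1.2.1 fun e => h0 (Subtype.ext e.symm)
    rw [leftPos, projIcc_of_right_le _ ((one_le_div this).2 h')]
    exact hf.one
  have hr : s < q.1 → f (rightPos q.1 s) = 0 := by
    intro h
    have h' : (s : ℝ) < q.1 := h
    rw [rightPos, projIcc_of_le_left _ (div_nonpos_of_nonpos_of_nonneg (by linarith)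
      (sub_nonneg.2 q.1.2.2))]
    exact hf.zero
  have hβ := qβ_pos.ne'
  by_cases h : s < q.1
  · fin_cases j <;> simp [qwt, qhit, qpos, h, hr h]
  · by_cases h0 : q.1 = 0
    · fin_cases j <;> simp [qwt, qhit, qarea, qpos, h0, Real.zero_rpow hβ]
    · fin_cases j <;> simp [qwt, qhit, qpos, h, hl (not_lt.1 h) h0]

/-- The area is at most the width, which is the factor by which positions are stretched. -/
theorem abs_qpos_sub_le (q : I × I) (s t : I) (j : Fin 4) :
    qarea q j * |(qpos q s j : ℝ) - qpos q t j| ≤ |(s : ℝ) - t| := by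
  have hx0 : (0 : ℝ) ≤ q.1 := q.1.2.1
  have hx1 : (0 : ℝ) ≤ 1 - q.1 := sub_nonneg.2 q.1.2.2
  have hy0 : (0 : ℝ) ≤ q.2 := q.2.2.1
  have hy1 : (0 : ℝ) ≤ 1 - q.2 := sub_nonneg.2 q.2.2.2
  have key : ∀ a y d : ℝ, 0 ≤ a → 0 ≤ y → y ≤ 1 → ∀ u v : ℝ, u - v = d →
      a * y * |(projIcc (0 : ℝ) 1 zero_le_one (u / a) : ℝ) - projIcc (0 : ℝ) 1 zero_le_one (v / a)|
        ≤ |d| := by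
    intro a y d ha hy hy1 u v hd
    rcases ha.eq_or_lt with rfl | ha
    · simp
    calc _ ≤ a * 1 * |u / a - v / a| := by
          exact mul_le_mul (mul_le_mul_of_nonneg_left hy1 ha.le) (abs_projIcc_sub_le _ _)
            (abs_nonneg _) (by linarith)
      _ = |d| := by
          rw [← sub_div, abs_div, abs_of_pos ha, hd]; field_simp
  fin_cases j
  · exact key _ _ _ hx0 hy0 (by linarith) _ _ rfl
  · exact key _ _ _ hx0 hy1 (by linarith) _ _ rfl
  · exact key _ _ _ hx1 hy0 (by linarith) _ _ (by ring)
  · exact key _ _ _ hx1 hy1 (by linarith) _ _ (by ring)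

theorem qpos_zero (q : I × I) (j : Fin 4) (h : qhit q 0 j ≠ 0) : qpos q 0 j = 0 := by
  have hl : leftPos q.1 0 = 0 := by
    simp [leftPos]
  have hr : ¬ (0 < q.1) → rightPos q.1 0 = 0 := by
    intro h
    rw [rightPos, projIcc_of_le_left _ (div_nonpos_of_nonpos_of_nonneg (by simpa using q.1.2.1)
      (sub_nonneg.2 q.1.2.2))]
    rfl
  by_cases h1 : 0 < q.1
  · fin_cases j <;> simp_all [qhit, qpos]
  · fin_cases j <;> simp_all [qhit, qpos]

/-- Splicing keeps functions Hölder continuous: the weight `area ^ β` more than makes up for the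
stretching, which costs a factor `area ^ (-β / 2)`. The functions match at the splitting point
because they vanish at the endpoints. -/
theorem HolderBridge.splice {H : ℝ} (hH : 0 ≤ H) {f : Fin 4 → I → ℝ}
    (hf : ∀ j, HolderBridge H (f j)) (q : I × I) :
    HolderBridge (4 * H) fun s => ∑ j, qwt q s j * f j (qpos q s j) where
  zero := by
    refine Finset.sum_eq_zero fun j _ => ?_
    by_cases h : qhit q 0 j = 0
    · simp [qwt, h]
    · rw [qpos_zero q j h, (hf j).zero, mul_zero]
  one := by
    refine Finset.sum_eq_zero fun j _ => ?_
    have h1 : ¬ (1 < q.1) := not_lt.2 unitInterval.le_one'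
    have hr : ∀ j, f j (rightPos q.1 1) = 0 := by
      intro j
      by_cases h : q.1 = 1
      · have : rightPos q.1 1 = 0 := by simp [rightPos, h]
        rw [this, (hf j).zero]
      · have : rightPos q.1 1 = 1 := by
          have : (1 : ℝ) - q.1 ≠ 0 := fun e => h (Subtype.ext (by push_cast; linarith))
          simp [rightPos, div_self this]
        rw [this, (hf j).one]
    fin_cases j <;> simp [qwt, qhit, qpos, h1, hr]
  holder s t := by
    have hα : 0 < qβ / 2 := by linarith [qβ_pos]
    simp only [(hf _).qwt_mul]
    rw [← Finset.sum_sub_distrib]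
    refine (Finset.abs_sum_le_sum_abs _ _).trans ?_
    have : ∀ j ∈ Finset.univ, |qarea q j ^ qβ * f j (qpos q s j) - qarea q j ^ qβ * f j (qpos q t j)|
        ≤ H * |(s : ℝ) - t| ^ (qβ / 2) := by
      intro j _
      have ha := qarea_nonneg q j
      rw [← mul_sub, abs_mul, abs_of_nonneg (Real.rpow_nonneg ha _)]
      calc _ ≤ qarea q j ^ (qβ / 2) * (H * |(qpos q s j : ℝ) - qpos q t j| ^ (qβ / 2)) := by
            refine mul_le_mul ?_ ((hf j).holder _ _) (abs_nonneg _) (Real.rpow_nonneg ha _)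
            rcases ha.eq_or_lt with h0 | h0
            · rw [← h0, Real.zero_rpow hα.ne', Real.zero_rpow qβ_pos.ne']
            · exact Real.rpow_le_rpow_of_exponent_ge h0 (qarea_le_one _ _) (by linarith)
        _ = H * (qarea q j * |(qpos q s j : ℝ) - qpos q t j|) ^ (qβ / 2) := by
            rw [Real.mul_rpow ha (abs_nonneg _)]; ring
        _ ≤ _ := by
            gcongr
            exact abs_qpos_sub_le q s t j
    refine (Finset.sum_le_sum this).trans (le_of_eq ?_)
    simp; ring

/-! ### Even moments of a sum of two centred terms -/

/-- In an even power of a sum, all terms but the extreme ones are controlled by the terms that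
contain a square. -/
theorem add_pow_le_of_even (x y : ℝ) (k : ℕ) (hk : Even k) :
    (x + y) ^ (k + 4) ≤ x ^ (k + 4) + y ^ (k + 4) + (k + 4) * (x ^ (k + 3) * y)
      + (k + 4) * (x * y ^ (k + 3)) + 2 ^ (k + 4) * (x ^ 2 * y ^ (k + 2) + x ^ (k + 2) * y ^ 2) := by
  have hmid : ∀ j ∈ Finset.range (k + 1),
      x ^ (j + 2) * y ^ (k + 4 - (j + 2)) * ((k + 4).choose (j + 2) : ℝ)
        ≤ (x ^ 2 * y ^ (k + 2) + x ^ (k + 2) * y ^ 2) * ((k + 4).choose (j + 2) : ℝ) := by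
    intro j hj
    refine mul_le_mul_of_nonneg_right ?_ (Nat.cast_nonneg _)
    obtain ⟨i, rfl⟩ : ∃ i, k = j + i := ⟨k - j, by have := Finset.mem_range.1 hj; omega⟩
    rw [show j + i + 4 - (j + 2) = i + 2 by omega]
    refine (le_abs_self _).trans ?_
    have e : ∀ z : ℝ, z ^ (j + i + 2) = |z| ^ (j + i + 2) := fun z => by
      rw [Even.pow_abs]; exact hk.add (by decide)
    rw [e x, e y, abs_mul, abs_pow, abs_pow, ← sq_abs x, ← sq_abs y]
    have hx := abs_nonneg x
    have hy := abs_nonneg y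
    rcases le_total |x| |y| with h | h
    · calc |x| ^ (j + 2) * |y| ^ (i + 2) = |x| ^ 2 * (|x| ^ j * |y| ^ (i + 2)) := by ring
        _ ≤ |x| ^ 2 * (|y| ^ j * |y| ^ (i + 2)) := by gcongr
        _ = |x| ^ 2 * |y| ^ (j + i + 2) := by ring
        _ ≤ _ := le_add_of_nonneg_right (by positivity)
    · calc |x| ^ (j + 2) * |y| ^ (i + 2) = |x| ^ (j + 2) * |y| ^ i * |y| ^ 2 := by ring
        _ ≤ |x| ^ (j + 2) * |x| ^ i * |y| ^ 2 := by gcongr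
        _ = |x| ^ (j + i + 2) * |y| ^ 2 := by ring
        _ ≤ _ := le_add_of_nonneg_left (by positivity)
  have hsum : ∑ j ∈ Finset.range (k + 1), ((k + 4).choose (j + 2) : ℝ) ≤ 2 ^ (k + 4) := by
    have h := Nat.sum_range_choose (k + 4)
    rw [Finset.sum_range_succ, Finset.sum_range_succ, Finset.sum_range_succ', Finset.sum_range_succ']
      at h
    have h' : (∑ j ∈ Finset.range (k + 1), (k + 4).choose (j + 2)) ≤ 2 ^ (k + 4) := by
      have e : ∑ j ∈ Finset.range (k + 1), (k + 4).choose (j + 1 + 1)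
          = ∑ j ∈ Finset.range (k + 1), (k + 4).choose (j + 2) := rfl
      rw [e] at h
      omega
    exact_mod_cast h'
  have hnn : 0 ≤ x ^ 2 * y ^ (k + 2) + x ^ (k + 2) * y ^ 2 := by
    have h2 : Even (k + 2) := hk.add (by decide)
    have := h2.pow_nonneg x
    have := h2.pow_nonneg y
    positivity
  rw [add_pow, Finset.sum_range_succ, Finset.sum_range_succ, Finset.sum_range_succ',
    Finset.sum_range_succ']
  have := (Finset.sum_le_sum hmid).trans (le_of_eq (Finset.mul_sum _ _ _).symm)
  have h3 : ∑ j ∈ Finset.range (k + 1),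
      x ^ (j + 1 + 1) * y ^ (k + 4 - (j + 1 + 1)) * ((k + 4).choose (j + 1 + 1) : ℝ)
        ≤ (x ^ 2 * y ^ (k + 2) + x ^ (k + 2) * y ^ 2) * 2 ^ (k + 4) :=
    this.trans (mul_le_mul_of_nonneg_left hsum hnn)
  have c1 : (k + 4).choose (k + 3) = k + 4 := by
    rw [show k + 4 = (k + 3) + 1 by ring, Nat.choose_succ_self_right]
  simp only [Nat.choose_zero_right, Nat.choose_self, zero_add, c1, Nat.choose_one_right, pow_zero,
    Nat.sub_zero, Nat.sub_self, pow_one, Nat.cast_one, mul_one, one_mul]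
  rw [show k + 4 - (k + 3) = 1 by omega, show k + 4 - 1 = k + 3 by omega]
  have hc : ((k + 4 : ℕ) : ℝ) = k + 4 := by push_cast; ring
  rw [hc]
  linarith

section HighMoments

variable {Θ : Type*} [MeasurableSpace Θ] {π : Measure Θ} [IsProbabilityMeasure π]

theorem integral_mul_eval {g h : Θ → ℝ} (hg : Measurable g) (hh : Measurable h) {i j : Fin 4}
    (hij : i ≠ j) :
    ∫ F : Fin 4 → Θ, g (F i) * h (F j) ∂Measure.pi (fun _ => π)
      = (∫ θ, g θ ∂π) * ∫ θ, h θ ∂π := by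
  have hind : iIndepFun (fun (i : Fin 4) (F : Fin 4 → Θ) => F i) (Measure.pi fun _ : Fin 4 => π) :=
    iIndepFun_pi (X := fun _ θ => θ) fun _ => aemeasurable_id
  have h2 := ((hind.indepFun hij).comp hg hh).integral_fun_mul_eq_mul_integral
    (hg.comp (measurable_pi_apply i)).aestronglyMeasurable
    (hh.comp (measurable_pi_apply j)).aestronglyMeasurable
  simp only [Function.comp] at h2
  rw [h2, integral_comp_eval (μ := fun _ : Fin 4 => π) hg.aestronglyMeasurable,
    integral_comp_eval (μ := fun _ : Fin 4 => π) hh.aestronglyMeasurable]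

/-- In the expectation of an even power of the sum of two independent centred variables, the
terms that are linear in one of them vanish. -/
theorem integral_pow_add_eval_le {X X' : Θ → ℝ} (hX : Measurable X) (hX' : Measurable X') {B : ℝ}
    (bX : ∀ θ, |X θ| ≤ B) (bX' : ∀ θ, |X' θ| ≤ B) (h0 : ∫ θ, X θ ∂π = 0) (h0' : ∫ θ, X' θ ∂π = 0)
    {k : ℕ} (hk : Even k) {i j : Fin 4} (hij : i ≠ j) :
    ∫ F : Fin 4 → Θ, (X (F i) + X' (F j)) ^ (k + 4) ∂Measure.pi (fun _ => π)
      ≤ ∫ θ, X θ ^ (k + 4) ∂π + ∫ θ, X' θ ^ (k + 4) ∂π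
        + 2 ^ (k + 4) * ((∫ θ, X θ ^ 2 ∂π) * (∫ θ, X' θ ^ (k + 2) ∂π)
          + (∫ θ, X θ ^ (k + 2) ∂π) * ∫ θ, X' θ ^ 2 ∂π) := by
  have hB : 0 ≤ B := by
    obtain ⟨θ⟩ : Nonempty Θ := nonempty_of_isProbabilityMeasure π
    exact (abs_nonneg _).trans (bX θ)
  have mi : Measurable fun F : Fin 4 → Θ => X (F i) := hX.comp (measurable_pi_apply i)
  have mj : Measurable fun F : Fin 4 → Θ => X' (F j) := hX'.comp (measurable_pi_apply j)
  have int : ∀ a b : ℕ, Integrable (fun F : Fin 4 → Θ => X (F i) ^ a * X' (F j) ^ b)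
      (Measure.pi fun _ => π) := by
    intro a b
    refine integrable_of_bdd ((mi.pow_const a).mul (mj.pow_const b)) (B ^ a * B ^ b) fun F => ?_
    rw [abs_mul, abs_pow, abs_pow]
    have := bX (F i)
    have := bX' (F j)
    gcongr
  have ival : ∀ a b : ℕ, ∫ F : Fin 4 → Θ, X (F i) ^ a * X' (F j) ^ b ∂Measure.pi (fun _ => π)
      = (∫ θ, X θ ^ a ∂π) * ∫ θ, X' θ ^ b ∂π := fun a b =>
    integral_mul_eval (hX.pow_const a) (hX'.pow_const b) hij
  have key : ∀ F : Fin 4 → Θ, (X (F i) + X' (F j)) ^ (k + 4) ≤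
      X (F i) ^ (k + 4) * X' (F j) ^ 0 + X (F i) ^ 0 * X' (F j) ^ (k + 4)
      + (k + 4) * (X (F i) ^ (k + 3) * X' (F j) ^ 1)
      + (k + 4) * (X (F i) ^ 1 * X' (F j) ^ (k + 3))
      + 2 ^ (k + 4) * (X (F i) ^ 2 * X' (F j) ^ (k + 2) + X (F i) ^ (k + 2) * X' (F j) ^ 2) := by
    intro F
    simpa using add_pow_le_of_even (X (F i)) (X' (F j)) k hk
  refine (integral_mono ?_ (((((int _ _).add (int _ _)).add ((int _ _).const_mul _)).add
    ((int _ _).const_mul _)).add (((int _ _).add (int _ _)).const_mul _)) key).trans ?_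
  · refine integrable_of_bdd ((mi.add mj).pow_const _) ((B + B) ^ (k + 4)) fun F => ?_
    rw [abs_pow]
    exact pow_le_pow_left₀ (abs_nonneg _)
      ((abs_add_le _ _).trans (add_le_add (bX (F i)) (bX' (F j)))) _
  · refine le_of_eq ?_
    simp only [Pi.add_apply]
    rw [integral_add, integral_add, integral_add, integral_add, integral_const_mul,
      integral_const_mul, integral_const_mul, integral_add]
    · simp only [ival]
      simp [h0, h0']
    all_goals
      repeat first
        | exact int _ _
        | refine Integrable.fun_add ?_ ?_
        | refine Integrable.const_mul ?_ _

/-- One step of the recursion on the even moments of a bounded centred random function. -/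
theorem spliceSum_high_moment {Y : Θ → I → ℝ} (hY : Measurable fun p : Θ × I => Y p.1 p.2)
    {B : ℝ} (hB : ∀ θ t, |Y θ t| ≤ B) (h0 : ∀ t, ∫ θ, Y θ t ∂π = 0) {k : ℕ} (hk : Even k)
    {A₂ A' A : ℝ} (h2 : ∀ t, ∫ θ, Y θ t ^ 2 ∂π ≤ A₂) (h' : ∀ t, ∫ θ, Y θ t ^ (k + 2) ∂π ≤ A')
    (hA : ∀ t, ∫ θ, Y θ t ^ (k + 4) ∂π ≤ A) (s : I) :
    ∫ p : (I × I) × (Fin 4 → Θ), spliceSum Y p.1 p.2 s ^ (k + 4)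
        ∂((volume : Measure (I × I)).prod (Measure.pi fun _ => π))
      ≤ 4 / ((k + 4) * qβ + 1) ^ 2 * A + 2 ^ (k + 4) * (2 * (A₂ * A')) := by
  have hm := measurable_spliceSum hY s
  have hYt : ∀ t, Measurable fun θ => Y θ t := fun t => hY.comp (measurable_id.prodMk measurable_const)
  have hk2 : Even (k + 2) := hk.add (by decide)
  have hk4 : Even (k + 4) := hk.add (by decide)
  have hA0 : 0 ≤ A := (integral_nonneg fun θ => hk4.pow_nonneg _).trans (hA s)
  have hA'0 : 0 ≤ A' := (integral_nonneg fun θ => hk2.pow_nonneg _).trans (h' s)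
  have hA20 : 0 ≤ A₂ := (integral_nonneg fun θ => sq_nonneg _).trans (h2 s)
  have hB0 : 0 ≤ B := by
    obtain ⟨θ⟩ : Nonempty Θ := nonempty_of_isProbabilityMeasure π
    exact (abs_nonneg _).trans (hB θ s)
  have bnd : ∀ q F, |spliceSum Y q F s| ≤ 4 * B := by
    intro q F
    refine (Finset.abs_sum_le_sum_abs _ _).trans ?_
    refine (Finset.sum_le_sum (g := fun _ => B) fun j _ => ?_).trans (by simp)
    rw [abs_mul, abs_of_nonneg (qwt_nonneg _ _ _)]
    exact (mul_le_of_le_one_left (abs_nonneg _) (qwt_le_one _ _ _)).trans (hB _ _)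
  have two : ∀ (c d : ℝ) (t : I) (i j : Fin 4), 0 ≤ c → c ≤ 1 → 0 ≤ d → d ≤ 1 → i ≠ j →
      ∫ F : Fin 4 → Θ, (c * Y (F i) t + d * Y (F j) t) ^ (k + 4) ∂Measure.pi (fun _ => π)
        ≤ c ^ (k + 4) * A + d ^ (k + 4) * A + 2 ^ (k + 4) * (2 * (A₂ * A')) := by
    intro c d t i j hc hc1 hd hd1 hij
    have hb : ∀ c : ℝ, 0 ≤ c → c ≤ 1 → ∀ θ, |c * Y θ t| ≤ B := by
      intro c hc hc1 θ
      rw [abs_mul, abs_of_nonneg hc]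
      exact (mul_le_of_le_one_left (abs_nonneg _) hc1).trans (hB _ _)
    have hz : ∀ c : ℝ, ∫ θ, c * Y θ t ∂π = 0 := fun c => by rw [integral_const_mul, h0, mul_zero]
    refine (integral_pow_add_eval_le ((hYt t).const_mul c) ((hYt t).const_mul d) (hb c hc hc1)
      (hb d hd hd1) (hz c) (hz d) hk hij).trans ?_
    simp only [mul_pow, integral_const_mul]
    have hle : ∀ c : ℝ, 0 ≤ c → c ≤ 1 → ∀ (l : ℕ) (D : ℝ), Even l → ∫ θ, Y θ t ^ l ∂π ≤ D →
        0 ≤ c ^ l * ∫ θ, Y θ t ^ l ∂π ∧ c ^ l * ∫ θ, Y θ t ^ l ∂π ≤ D := by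
      intro c hc hc1 l D hl hD
      have hnn : 0 ≤ ∫ θ, Y θ t ^ l ∂π := integral_nonneg fun θ => hl.pow_nonneg _
      exact ⟨mul_nonneg (pow_nonneg hc _) hnn,
        (mul_le_of_le_one_left hnn (pow_le_one₀ hc hc1)).trans hD⟩
    have c2 := hle c hc hc1 2 A₂ (by decide) (h2 t)
    have d2 := hle d hd hd1 2 A₂ (by decide) (h2 t)
    have c' := hle c hc hc1 (k + 2) A' hk2 (h' t)
    have d' := hle d hd hd1 (k + 2) A' hk2 (h' t)
    have m1 := mul_le_mul c2.2 d'.2 d'.1 hA20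
    have m2 := mul_le_mul c'.2 d2.2 d2.1 hA'0
    refine add_le_add (add_le_add (mul_le_mul_of_nonneg_left (hA t) (pow_nonneg hc _))
      (mul_le_mul_of_nonneg_left (hA t) (pow_nonneg hd _))) ?_
    refine mul_le_mul_of_nonneg_left ?_ (by positivity)
    linarith
  -- only the two functions on the side of `s` contribute
  have inner : ∀ q : I × I, ∫ F : Fin 4 → Θ, spliceSum Y q F s ^ (k + 4) ∂Measure.pi (fun _ => π)
      ≤ (∑ j, qhit q s j * qarea q j ^ ((k + 4) * qβ)) * A + 2 ^ (k + 4) * (2 * (A₂ * A')) := by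
    intro q
    have hw : ∀ j, qhit q s j * qarea q j ^ ((k + 4) * qβ) = qwt q s j ^ (k + 4) := by
      intro j
      rw [qwt_pow q s j (by omega)]
      push_cast
      rfl
    simp only [hw]
    by_cases h : s < q.1
    · have e : ∀ F : Fin 4 → Θ, spliceSum Y q F s
          = qwt q s 0 * Y (F 0) (leftPos q.1 s) + qwt q s 1 * Y (F 1) (leftPos q.1 s) := by
        intro F
        simp [spliceSum, Fin.sum_univ_four, qwt, qhit, qpos, h]
      have e2 : ∑ j, qwt q s j ^ (k + 4) = qwt q s 0 ^ (k + 4) + qwt q s 1 ^ (k + 4) := by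
        simp [Fin.sum_univ_four, qwt, qhit, h]
      simp only [e]
      rw [e2, add_mul]
      exact two _ _ _ _ _ (qwt_nonneg _ _ _) (qwt_le_one _ _ _) (qwt_nonneg _ _ _)
        (qwt_le_one _ _ _) (by decide)
    · have e : ∀ F : Fin 4 → Θ, spliceSum Y q F s
          = qwt q s 2 * Y (F 2) (rightPos q.1 s) + qwt q s 3 * Y (F 3) (rightPos q.1 s) := by
        intro F
        simp [spliceSum, Fin.sum_univ_four, qwt, qhit, qpos, h]
      have e2 : ∑ j, qwt q s j ^ (k + 4) = qwt q s 2 ^ (k + 4) + qwt q s 3 ^ (k + 4) := by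
        simp [Fin.sum_univ_four, qwt, qhit, h]
      simp only [e]
      rw [e2, add_mul]
      exact two _ _ _ _ _ (qwt_nonneg _ _ _) (qwt_le_one _ _ _) (qwt_nonneg _ _ _)
        (qwt_le_one _ _ _) (by decide)
  have hκ : 0 ≤ ((k : ℝ) + 4) * qβ := by have := qβ_pos; positivity
  have hI : Integrable fun q : I × I => ∑ j, qhit q s j * qarea q j ^ ((k + 4) * qβ) :=
    integrable_finsetSum _ fun j _ => integrable_qhit_mul_qarea s j hκ
  rw [integral_prod]
  · refine (integral_mono_of_nonneg (Eventually.of_forall fun q =>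
      integral_nonneg fun F => hk4.pow_nonneg _) ((hI.mul_const A).add (integrable_const _))
      (Eventually.of_forall inner)).trans ?_
    simp only [Pi.add_apply]
    rw [integral_add (hI.mul_const A) (integrable_const _), integral_mul_const,
      integral_finsetSum _ fun j _ => integrable_qhit_mul_qarea s j hκ]
    simp only [integral_const, probReal_univ, one_smul]
    gcongr
    exact sum_integral_qhit_mul_qarea_le s hκ
  · refine integrable_of_bdd (hm.pow_const _) ((4 * B) ^ (k + 4)) fun p => ?_
    rw [abs_pow]
    exact pow_le_pow_left₀ (abs_nonneg _) (bnd _ _) _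

end HighMoments

/-! ### Independent splitting points on the infinite quaternary tree -/

/-- A splitting point for every node of the infinite quaternary tree; a node is given by the list
of quadrants that leads to it from the root. -/
abbrev SplitTree : Type := List (Fin 4) → I × I

/-- The law of a tree of independent uniform splitting points. -/
def treeLaw : Measure SplitTree := Measure.infinitePi fun _ => (volume : Measure (I × I))

instance : IsProbabilityMeasure treeLaw := by unfold treeLaw; infer_instance

/-- The splitting points of the subtree rooted at the `j`-th child of the root. -/
def subTree (ω : SplitTree) (j : Fin 4) : SplitTree := fun w => ω (j :: w)

/-- The root and the four subtrees. -/
def splitRoot (ω : SplitTree) : (I × I) × (Fin 4 → SplitTree) := (ω [], subTree ω)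

/-- The tree with the given root and subtrees. -/
def joinRoot (p : (I × I) × (Fin 4 → SplitTree)) : SplitTree
  | [] => p.1
  | j :: w => p.2 j w

theorem measurable_joinRoot : Measurable joinRoot := by
  refine measurable_pi_iff.2 fun w => ?_
  cases w with
  | nil => exact measurable_fst
  | cons j w =>
    exact (measurable_pi_apply w).comp ((measurable_pi_apply j).comp measurable_snd)

theorem measurable_subTree (j : Fin 4) : Measurable fun ω => subTree ω j :=
  measurable_pi_iff.2 fun _ => measurable_pi_apply _

theorem measurable_splitRoot : Measurable splitRoot :=
  (measurable_pi_apply _).prodMk (measurable_pi_iff.2 measurable_subTree)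

/-- A product over a finite set of nodes, split into the root and the four subtrees. -/
theorem prod_finset_list {M : Type*} [CommMonoid M] (s : Finset (List (Fin 4)))
    (f : List (Fin 4) → M) :
    ∏ w ∈ s, f w = (if [] ∈ s then f [] else 1) *
      ∏ j : Fin 4, ∏ w ∈ s.preimage (List.cons j) List.cons_injective.injOn, f (j :: w) := by
  classical
  have h : s = s.filter (· = []) ∪ Finset.univ.biUnion fun j : Fin 4 =>
      (s.preimage (List.cons j) List.cons_injective.injOn).map
        ⟨List.cons j, List.cons_injective⟩ := by
    ext w
    cases w <;> simp
  conv_lhs => rw [h]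
  rw [Finset.prod_union, Finset.prod_biUnion]
  · congr 1
    · rw [Finset.prod_filter, Finset.prod_ite_eq']
    · simp
  · intro i _ j _ hij
    rw [Function.onFun, Finset.disjoint_left]
    intro w hw hw'
    simp only [Finset.mem_map, Function.Embedding.coeFn_mk] at hw hw'
    obtain ⟨a, -, rfl⟩ := hw
    obtain ⟨b, -, hb⟩ := hw'
    exact hij (List.cons.inj hb).1.symm
  · rw [Finset.disjoint_left]
    intro w hw hw'
    simp only [Finset.mem_filter] at hw
    simp [hw.2] at hw'

/-- The root and the four subtrees of a tree of independent uniform splitting points are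
independent, and the subtrees have the law of the whole tree. -/
theorem map_splitRoot :
    treeLaw.map splitRoot = (volume : Measure (I × I)).prod (Measure.pi fun _ => treeLaw) := by
  classical
  have h : ((volume : Measure (I × I)).prod (Measure.pi fun _ => treeLaw)).map joinRoot
      = treeLaw := by
    refine Measure.eq_infinitePi _ fun s t ht => ?_
    rw [Measure.map_apply measurable_joinRoot (MeasurableSet.pi s.countable_toSet fun i _ => ht i)]
    have e : joinRoot ⁻¹' (Set.pi s t) = (if [] ∈ s then t [] else univ) ×ˢ
        Set.pi univ fun j : Fin 4 =>
          Set.pi (s.preimage (List.cons j) List.cons_injective.injOn : Finset (List (Fin 4)))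
            fun w => t (j :: w) := by
      ext p
      simp only [mem_preimage, Set.mem_pi, mem_prod, mem_univ, forall_const, Finset.mem_coe,
        Finset.mem_preimage]
      constructor
      · intro hp
        refine ⟨?_, fun j w hw => hp (j :: w) hw⟩
        split_ifs with h0
        · exact hp [] h0
        · exact mem_univ _
      · rintro ⟨h1, h2⟩ w hw
        cases w with
        | nil => rwa [if_pos hw] at h1
        | cons j w => exact h2 j w hw
    rw [e, Measure.prod_prod, Measure.pi_pi, prod_finset_list]
    congr 1
    · split_ifs <;> simp
    · refine Finset.prod_congr rfl fun j _ => ?_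
      exact Measure.infinitePi_pi _ fun w _ => ht _
  conv_lhs => rw [← h]
  rw [Measure.map_map measurable_splitRoot measurable_joinRoot]
  exact Measure.map_id

/-! ### The approximating processes -/

/-- The approximations of the limit process: the recursion is started with the mean function at
all nodes of depth `n`. -/
def approx : ℕ → SplitTree → CadlagFun
  | 0, _ => ⟨qh, fun t => ⟨continuous_qh.continuousWithinAt, qh t,
      (continuous_qh.tendsto t).mono_left nhdsWithin_le_nhds⟩⟩
  | n + 1, ω => quadMap (ω []).1 (ω []).2 fun j => approx n (subTree ω j)

theorem approx_succ (n : ℕ) (ω : SplitTree) (s : I) :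
    approx (n + 1) ω s
      = ∑ j, qwt (ω []) s j * approx n (subTree ω j) (qpos (ω []) s j) :=
  quadMap_eq_sum (ω []) _ s

theorem measurable_approx (n : ℕ) : Measurable (approx n) := by
  induction n with
  | zero => exact measurable_const
  | succ n ih =>
    exact (measurable_quadMap.comp (measurable_prod_pi_comp ih)).comp measurable_splitRoot

theorem holderBridge_approx (n : ℕ) (ω : SplitTree) : HolderBridge (4 ^ n) (approx n ω) := by
  induction n generalizing ω with
  | zero =>
    rw [pow_zero]
    exact holderBridge_qh
  | succ n ih =>
    have := HolderBridge.splice (by positivity) (fun j => ih (subTree ω j)) (ω [])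
    rw [pow_succ, mul_comm]
    convert this using 1
    exact funext fun s => approx_succ n ω s

/-- The increments of the approximations. -/
def incr (n : ℕ) (ω : SplitTree) (s : I) : ℝ := approx (n + 1) ω s - approx n ω s

theorem measurable_incr (n : ℕ) : Measurable fun p : SplitTree × I => incr n p.1 p.2 :=
  (CadlagFun.measurable_apply ((measurable_approx _).comp measurable_fst) measurable_snd).sub
    (CadlagFun.measurable_apply ((measurable_approx _).comp measurable_fst) measurable_snd)

theorem measurable_incr_left (n : ℕ) (s : I) : Measurable fun ω => incr n ω s :=
  (measurable_incr n).comp (measurable_id.prodMk measurable_const)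

theorem incr_succ (n : ℕ) (ω : SplitTree) (s : I) :
    incr (n + 1) ω s = spliceSum (incr n) (splitRoot ω).1 (splitRoot ω).2 s := by
  rw [incr, approx_succ (n + 1), approx_succ n, ← Finset.sum_sub_distrib]
  exact Finset.sum_congr rfl fun j _ => by rw [← mul_sub]; rfl

theorem abs_incr_sub_le (n : ℕ) (ω : SplitTree) (s t : I) :
    |incr n ω s - incr n ω t| ≤ 5 * 4 ^ n * |(s : ℝ) - t| ^ (qβ / 2) := by
  have h1 := (holderBridge_approx (n + 1) ω).holder s t
  have h2 := (holderBridge_approx n ω).holder s t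
  rw [incr, incr, show approx (n + 1) ω s - approx n ω s - (approx (n + 1) ω t - approx n ω t)
    = (approx (n + 1) ω s - approx (n + 1) ω t) - (approx n ω s - approx n ω t) by ring]
  refine (abs_sub _ _).trans ((add_le_add h1 h2).trans (le_of_eq ?_))
  ring

theorem abs_incr_le (n : ℕ) (ω : SplitTree) (s : I) : |incr n ω s| ≤ 5 * 4 ^ n := by
  have h1 := (holderBridge_approx (n + 1) ω).abs_le (by positivity) s
  have h2 := (holderBridge_approx n ω).abs_le (by positivity) s
  refine (abs_sub _ _).trans ((add_le_add h1 h2).trans (le_of_eq ?_))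
  ring

theorem integrable_approx (n : ℕ) (s : I) : Integrable (fun ω => approx n ω s) treeLaw :=
  integrable_of_bdd ((CadlagFun.measurable_eval s).comp (measurable_approx n)) (4 ^ n)
    fun ω => (holderBridge_approx n ω).abs_le (by positivity) s

theorem integral_comp_splitRoot {g : (I × I) × (Fin 4 → SplitTree) → ℝ} (hg : Measurable g) :
    ∫ ω, g (splitRoot ω) ∂treeLaw
      = ∫ p, g p ∂((volume : Measure (I × I)).prod (Measure.pi fun _ => treeLaw)) := by
  rw [← map_splitRoot, integral_map measurable_splitRoot.aemeasurable hg.aestronglyMeasurable]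

/-- All approximations have the mean function of the limit, as it is invariant under the
recursion. -/
theorem integral_approx (n : ℕ) (s : I) : ∫ ω, approx n ω s ∂treeLaw = qh s := by
  induction n generalizing s with
  | zero => simp [approx]
  | succ n ih =>
    have hY : Measurable fun p : SplitTree × I => approx n p.1 p.2 :=
      CadlagFun.measurable_apply ((measurable_approx _).comp measurable_fst) measurable_snd
    have e : ∀ ω, approx (n + 1) ω s
        = spliceSum (fun ω t => approx n ω t) (splitRoot ω).1 (splitRoot ω).2 s :=
      fun ω => approx_succ n ω s
    simp only [e]
    rw [integral_comp_splitRoot (measurable_spliceSum hY s), integral_spliceSum]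
    · simp only [ih]
      exact integral_sum_qwt_mul_qh s
    · exact integrable_approx n
    · refine integrable_of_bdd (measurable_spliceSum hY s) (4 * 4 ^ n) fun p => ?_
      have := (HolderBridge.splice (by positivity) (fun j => holderBridge_approx n (p.2 j))
        p.1).abs_le (by positivity) s
      exact this

theorem integral_incr (n : ℕ) (s : I) : ∫ ω, incr n ω s ∂treeLaw = 0 := by
  simp only [incr]
  rw [integral_sub (integrable_approx _ _) (integrable_approx _ _), integral_approx,
    integral_approx, sub_self]

/-- All even moments of the increments decay geometrically, uniformly in the position, with rates
that become arbitrarily small for high moments. -/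
theorem exists_integral_incr_pow_le (m : ℕ) :
    ∃ K : ℝ, 0 ≤ K ∧ ∀ n s, ∫ ω, incr n ω s ^ (2 * m + 2) ∂treeLaw
      ≤ K * (9 / ((m : ℝ) + 10)) ^ n := by
  have base : ∀ (l : ℕ) s, Even l → ∫ ω, incr 0 ω s ^ l ∂treeLaw ≤ 5 ^ l := by
    intro l s hl
    refine (integral_mono (g := fun _ => (5 : ℝ) ^ l) ?_ (integrable_const _) fun ω => ?_).trans
      (by simp)
    · refine integrable_of_bdd ((measurable_incr_left 0 s).pow_const l) (5 ^ l) fun ω => ?_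
      rw [abs_pow]
      exact pow_le_pow_left₀ (abs_nonneg _) (by simpa using abs_incr_le 0 ω s) _
    · simp only
      rw [← hl.pow_abs]
      exact pow_le_pow_left₀ (abs_nonneg _) (by simpa using abs_incr_le 0 ω s) _
  have second : ∀ n s, ∫ ω, incr n ω s ^ 2 ∂treeLaw ≤ 25 * (9 / 10) ^ n := by
    intro n
    induction n with
    | zero => intro s; exact (base 2 s (by decide)).trans (by norm_num)
    | succ n ih =>
      intro s
      simp only [incr_succ]
      rw [integral_comp_splitRoot (g := fun p => spliceSum (incr n) p.1 p.2 s ^ 2)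
        ((measurable_spliceSum (measurable_incr n) s).pow_const 2)]
      refine (spliceSum_second_moment (measurable_incr n) (fun t => ?_) (integral_incr n) ih
        s).2.trans ?_
      · exact MemLp.of_bound (measurable_incr_left n t).aestronglyMeasurable _
          (Eventually.of_forall fun ω => abs_incr_le n ω t)
      · have := qθ_lt
        have h : (0 : ℝ) ≤ 25 * (9 / 10) ^ n := by positivity
        calc qθ * (25 * (9 / 10) ^ n) ≤ (9 / 10) * (25 * (9 / 10) ^ n) := by
              gcongr; linarith
          _ = _ := by ring
  -- the moment of order `2m + 4` contracts, up to a product of moments of lower orders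
  induction m with
  | zero => exact ⟨25, by norm_num, fun n s => by simpa using second n s⟩
  | succ m ih =>
    obtain ⟨K', hK', hm⟩ := ih
    have hβ := qβ_gt
    set k := 2 * m with hk
    set c : ℝ := 9 / ((m + 1 : ℕ) + 10) with hc
    set γ : ℝ := 4 / ((k + 4) * qβ + 1) ^ 2 with hγ
    have hm0 : (0 : ℝ) ≤ m := Nat.cast_nonneg m
    have hc0 : 0 < c := by rw [hc]; positivity
    have hkm : (k : ℝ) = 2 * m := by rw [hk]; push_cast; ring
    -- the contraction factor is at most `4 / (m + 3)²`
    have hγc : γ < c := by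
      rw [hγ, hc, div_lt_div_iff₀ (by have := qβ_pos; positivity) (by positivity), hkm]
      push_cast
      have h1 : (m : ℝ) + 3 ≤ (2 * m + 4) * qβ + 1 := by nlinarith
      have h2 : ((m : ℝ) + 3) ^ 2 ≤ ((2 * m + 4) * qβ + 1) ^ 2 := by gcongr
      nlinarith
    have hcc : (9 / 10 : ℝ) * (9 / ((m : ℝ) + 10)) ≤ c := by
      rw [hc, div_mul_div_comm, div_le_div_iff₀ (by positivity) (by positivity)]
      push_cast
      nlinarith
    set D : ℝ := 2 ^ (k + 4) * (2 * (25 * K')) with hD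
    have hD0 : 0 ≤ D := by rw [hD]; positivity
    set K := max (5 ^ (k + 4)) (D / (c - γ)) with hK
    have hK0 : 0 ≤ K := le_max_of_le_left (by positivity)
    refine ⟨K, hK0, fun n => ?_⟩
    rw [show 2 * (m + 1) + 2 = k + 4 by omega]
    induction n with
    | zero =>
      intro s
      refine (base (k + 4) s ⟨m + 2, by omega⟩).trans ?_
      rw [pow_zero, mul_one]
      exact le_max_left _ _
    | succ n ihn =>
      intro s
      simp only [incr_succ]
      rw [integral_comp_splitRoot (g := fun p => spliceSum (incr n) p.1 p.2 s ^ (k + 4))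
        ((measurable_spliceSum (measurable_incr n) s).pow_const _)]
      refine (spliceSum_high_moment (measurable_incr n) (abs_incr_le n) (integral_incr n)
        (k := k) ⟨m, by omega⟩ (second n) (hm n) ihn s).trans ?_
      rw [← hγ]
      have h1 : (9 / 10 : ℝ) ^ n * (9 / ((m : ℝ) + 10)) ^ n ≤ c ^ n := by
        rw [← mul_pow]
        exact pow_le_pow_left₀ (by positivity) hcc n
      have h2 : 2 ^ (k + 4) * (2 * (25 * (9 / 10) ^ n * (K' * (9 / ((m : ℝ) + 10)) ^ n)))
          ≤ D * c ^ n := by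
        rw [hD]
        calc _ = 2 ^ (k + 4) * (2 * (25 * K')) * ((9 / 10 : ℝ) ^ n * (9 / ((m : ℝ) + 10)) ^ n) := by
              ring
          _ ≤ _ := by gcongr
      have h3 : D ≤ K * (c - γ) := by
        rw [← div_le_iff₀ (sub_pos.2 hγc)]
        exact le_max_right _ _
      calc _ ≤ γ * (K * c ^ n) + D * c ^ n := by linarith
        _ ≤ γ * (K * c ^ n) + K * (c - γ) * c ^ n := by gcongr
        _ = K * c ^ (n + 1) := by ring

/-! ### Uniform convergence of the approximations -/

/-- The grid points `k / N` of the unit interval. -/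
def gridPoint (N k : ℕ) : I := projIcc 0 1 zero_le_one ((k : ℝ) / N)

theorem exists_gridPoint_near {N : ℕ} (hN : 0 < N) (s : I) :
    ∃ k ∈ Finset.range (N + 1), |(s : ℝ) - gridPoint N k| ≤ 1 / N := by
  have hN' : (0 : ℝ) < N := Nat.cast_pos.2 hN
  have h0 : 0 ≤ (s : ℝ) * N := mul_nonneg s.2.1 hN'.le
  have h1 := Nat.floor_le h0
  have h2 := Nat.lt_floor_add_one ((s : ℝ) * N)
  refine ⟨⌊(s : ℝ) * N⌋₊, ?_, ?_⟩
  · rw [Finset.mem_range, Nat.lt_succ_iff]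
    exact Nat.floor_le_of_le (mul_le_of_le_one_left hN'.le s.2.2)
  · have h3 : (⌊(s : ℝ) * N⌋₊ : ℝ) / N ≤ s := by rwa [div_le_iff₀ hN']
    have hmem : (⌊(s : ℝ) * N⌋₊ : ℝ) / N ∈ Icc (0 : ℝ) 1 := ⟨by positivity, h3.trans s.2.2⟩
    rw [gridPoint, projIcc_of_mem _ hmem, abs_of_nonneg (sub_nonneg.2 h3), sub_le_iff_le_add,
      ← add_div, le_div_iff₀ hN']
    linarith

/-- The increments are bounded by a geometric sequence times a square-integrable random variable:
the moments of high order control the increments on a fine grid, and Hölder continuity controls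
them between grid points. -/
theorem exists_incr_le : ∃ (G : SplitTree → ℝ≥0∞) (r : ℝ), Measurable G ∧
    ∫⁻ ω, G ω ∂treeLaw < ∞ ∧ 0 < r ∧ r < 1 ∧
    ∀ ω, G ω < ∞ → ∀ n s, |incr n ω s| ≤ 6 * √(1 + (G ω).toReal) * r ^ n := by
  have hα : 0 < qβ / 2 := by linarith [qβ_pos]
  -- the grid of `R ^ n` points is fine enough for increments of Hölder constant `5 * 4 ^ n`
  obtain ⟨R, hR0, hR⟩ : ∃ R : ℕ, 0 < R ∧ (1 / (R : ℝ)) ^ (qβ / 2) ≤ 1 / 8 := by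
    have h := (tendsto_one_div_atTop_nhds_zero_nat (𝕜 := ℝ)).rpow_const
      (p := qβ / 2) (Or.inr hα.le)
    rw [Real.zero_rpow hα.ne'] at h
    have h2 := (h.eventually (ge_mem_nhds (by norm_num : (0 : ℝ) < 1 / 8))).and
      (eventually_gt_atTop 0)
    obtain ⟨R, h3, h4⟩ := h2.exists
    exact ⟨R, h4, h3⟩
  -- the order of the moments makes up for the number of grid points
  set m := 36 * R with hm
  obtain ⟨K, hK0, hK⟩ := exists_integral_incr_pow_le m
  set c : ℝ := 9 / ((m : ℝ) + 10) with hc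
  have hRpos : (0 : ℝ) < R := Nat.cast_pos.2 hR0
  have hc0 : 0 ≤ c := by rw [hc]; positivity
  have hcR : c * R ≤ 1 / 4 := by
    rw [hc, hm, div_mul_eq_mul_div, div_le_iff₀ (by positivity)]
    push_cast
    linarith
  set p := 2 * m + 2 with hp
  have hpe : Even p := ⟨m + 1, by omega⟩
  have hp0 : p ≠ 0 := by omega
  set r : ℝ := (1 / 2 : ℝ) ^ (1 / (p : ℝ)) with hr
  have hpp : (0 : ℝ) < p := by positivity
  have hr0 : 0 < r := by rw [hr]; positivity
  have hr1 : r < 1 := Real.rpow_lt_one (by norm_num) (by norm_num) (by positivity)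
  have hrp : r ^ p = 1 / 2 := by
    rw [hr, ← Real.rpow_natCast, ← Real.rpow_mul (by norm_num), one_div_mul_cancel hpp.ne',
      Real.rpow_one]
  have hr2 : 1 / 2 ≤ r := by
    rw [← hrp]
    exact pow_le_of_le_one hr0.le hr1.le hp0
  -- weighted by `2 ^ n`, the sums of the moments over the grids are still summable
  let G : SplitTree → ℝ≥0∞ := fun ω => ∑' n : ℕ, ∑ k ∈ Finset.range (R ^ n + 1),
    ENNReal.ofReal (2 ^ n * incr n ω (gridPoint (R ^ n) k) ^ p)
  have hmeas : ∀ n k, Measurable fun ω =>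
      ENNReal.ofReal (2 ^ n * incr n ω (gridPoint (R ^ n) k) ^ p) := fun n k =>
    (((measurable_incr_left n _).pow_const p).const_mul _).ennreal_ofReal
  have hnn : ∀ n k ω, 0 ≤ 2 ^ n * incr n ω (gridPoint (R ^ n) k) ^ p := fun n k ω =>
    mul_nonneg (by positivity) (hpe.pow_nonneg _)
  refine ⟨G, r, Measurable.tsum fun n => Finset.measurable_sum _ fun k _ => hmeas n k, ?_,
    hr0, hr1, ?_⟩
  · have hsum : Summable fun n : ℕ => 2 * K * (1 / 2 : ℝ) ^ n :=
      (summable_geometric_of_lt_one (by norm_num) (by norm_num)).mul_left _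
    have key : ∀ n : ℕ, ∫⁻ ω, ∑ k ∈ Finset.range (R ^ n + 1),
        ENNReal.ofReal (2 ^ n * incr n ω (gridPoint (R ^ n) k) ^ p) ∂treeLaw
          ≤ ENNReal.ofReal (2 * K * (1 / 2 : ℝ) ^ n) := by
      intro n
      rw [lintegral_finsetSum _ fun k _ => hmeas n k]
      have one : ∀ k ∈ Finset.range (R ^ n + 1),
          ∫⁻ ω, ENNReal.ofReal (2 ^ n * incr n ω (gridPoint (R ^ n) k) ^ p) ∂treeLaw
            ≤ ENNReal.ofReal (2 ^ n * (K * c ^ n)) := by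
        intro k _
        rw [← ofReal_integral_eq_lintegral_ofReal _ (Eventually.of_forall fun ω => hnn n k ω)]
        · rw [integral_const_mul]
          exact ENNReal.ofReal_le_ofReal (mul_le_mul_of_nonneg_left (hK n _) (by positivity))
        · refine (integrable_of_bdd ((measurable_incr_left n _).pow_const p)
            ((5 * 4 ^ n) ^ p) fun ω => ?_).const_mul _
          rw [abs_pow]
          exact pow_le_pow_left₀ (abs_nonneg _) (abs_incr_le n ω _) _
      refine (Finset.sum_le_sum one).trans ?_
      rw [Finset.sum_const, Finset.card_range, nsmul_eq_mul, ← ENNReal.ofReal_natCast,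
        ← ENNReal.ofReal_mul (Nat.cast_nonneg _)]
      refine ENNReal.ofReal_le_ofReal ?_
      have h1 : ((R ^ n + 1 : ℕ) : ℝ) ≤ 2 * R ^ n := by
        push_cast
        have : (1 : ℝ) ≤ (R : ℝ) ^ n := one_le_pow₀ (by exact_mod_cast hR0)
        linarith
      calc ((R ^ n + 1 : ℕ) : ℝ) * (2 ^ n * (K * c ^ n)) ≤ 2 * R ^ n * (2 ^ n * (K * c ^ n)) := by
            gcongr
        _ = 2 * K * (2 * (c * R)) ^ n := by rw [mul_pow, mul_pow]; ring
        _ ≤ 2 * K * (1 / 2) ^ n := by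
            gcongr
            linarith
    rw [lintegral_tsum fun n => (Finset.measurable_sum _ fun k _ => hmeas n k).aemeasurable]
    refine (ENNReal.tsum_le_tsum key).trans_lt ?_
    rw [← ENNReal.ofReal_tsum_of_nonneg (fun n => by positivity) hsum]
    exact ENNReal.ofReal_lt_top
  · intro ω hω n s
    set g := (G ω).toReal with hg
    have hg0 : 0 ≤ g := ENNReal.toReal_nonneg
    have hs1 : 1 ≤ √(1 + g) := Real.one_le_sqrt.2 (by linarith)
    have grid : ∀ k ∈ Finset.range (R ^ n + 1),
        |incr n ω (gridPoint (R ^ n) k)| ≤ √(1 + g) * r ^ n := by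
      intro k hk
      have h1 : 2 ^ n * incr n ω (gridPoint (R ^ n) k) ^ p ≤ g := by
        have hle : ENNReal.ofReal (2 ^ n * incr n ω (gridPoint (R ^ n) k) ^ p) ≤ G ω :=
          (Finset.single_le_sum (f := fun k =>
            ENNReal.ofReal (2 ^ n * incr n ω (gridPoint (R ^ n) k) ^ p))
            (fun _ _ => zero_le) hk).trans (ENNReal.le_tsum n)
        have := ENNReal.toReal_mono hω.ne hle
        rwa [ENNReal.toReal_ofReal (hnn n k ω)] at this
      have h2 : g ≤ √(1 + g) ^ p := by
        rw [hp, show 2 * m + 2 = 2 * (m + 1) by ring, pow_mul, Real.sq_sqrt (by linarith)]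
        exact (by linarith : g ≤ 1 + g).trans (le_self_pow₀ (by linarith) (by omega))
      have h3 : |incr n ω (gridPoint (R ^ n) k)| ^ p ≤ (√(1 + g) * r ^ n) ^ p := by
        rw [hpe.pow_abs, mul_pow, ← pow_mul, mul_comm n p, pow_mul, hrp, one_div, inv_pow,
          ← div_eq_mul_inv, le_div_iff₀ (by positivity), mul_comm]
        exact h1.trans h2
      exact (pow_le_pow_iff_left₀ (abs_nonneg _) (by positivity) hp0).1 h3
    obtain ⟨k, hk, hks⟩ := exists_gridPoint_near (N := R ^ n) (pow_pos hR0 n) s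
    have h1 := grid k hk
    have h2 := abs_incr_sub_le n ω s (gridPoint (R ^ n) k)
    have h3 : |(s : ℝ) - gridPoint (R ^ n) k| ^ (qβ / 2) ≤ (1 / 8) ^ n := by
      calc _ ≤ (1 / ((R ^ n : ℕ) : ℝ)) ^ (qβ / 2) :=
            Real.rpow_le_rpow (abs_nonneg _) hks hα.le
        _ = ((1 / (R : ℝ)) ^ (qβ / 2)) ^ n := by
            rw [← Real.rpow_natCast, ← Real.rpow_mul (by positivity), mul_comm,
              Real.rpow_mul (by positivity), Real.rpow_natCast]
            push_cast
            rw [one_div, one_div, inv_pow]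
        _ ≤ _ := pow_le_pow_left₀ (by positivity) hR n
    have h4 : 5 * 4 ^ n * |(s : ℝ) - gridPoint (R ^ n) k| ^ (qβ / 2) ≤ 5 * (√(1 + g) * r ^ n) := by
      calc _ ≤ 5 * 4 ^ n * (1 / 8 : ℝ) ^ n := by gcongr
        _ = 5 * (1 * (1 / 2 : ℝ) ^ n) := by rw [mul_assoc, ← mul_pow, one_mul]; norm_num
        _ ≤ _ := by gcongr
    have h5 := abs_sub_abs_le_abs_sub (incr n ω s) (incr n ω (gridPoint (R ^ n) k))
    linarith

/-! ### Existence of the limit law -/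

namespace CadlagFun

/-- The continuous functions are a measurable subset of the space of càdlàg functions: continuity
is uniform continuity on a countable set of points that approximate every point from the right. -/
theorem exists_measurableSet_continuous :
    ∃ A : Set CadlagFun, MeasurableSet A ∧ ∀ f : CadlagFun, f ∈ A ↔ Continuous f.toFun := by
  refine ⟨{f | ∀ k : ℕ, ∃ m : ℕ, ∀ a b : ℕ × ℕ,
    dist (gridRight a.1 a.2) (gridRight b.1 b.2) < 1 / ((m : ℝ) + 1) →
      |f (gridRight a.1 a.2) - f (gridRight b.1 b.2)| ≤ 1 / ((k : ℝ) + 1)}, ?_, fun f => ⟨?_, ?_⟩⟩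
  · simp only [ofPred_forall, ofPred_exists]
    refine MeasurableSet.iInter fun k => MeasurableSet.iUnion fun m => MeasurableSet.iInter fun a =>
      MeasurableSet.iInter fun b => MeasurableSet.iInter fun _ => ?_
    exact measurableSet_le (((measurable_eval _).sub (measurable_eval _)).norm) measurable_const
  · intro hf
    refine UniformContinuous.continuous (Metric.uniformContinuous_iff.2 fun ε hε => ?_)
    obtain ⟨k, hk⟩ := exists_nat_one_div_lt hε
    obtain ⟨m, hm⟩ := hf k
    refine ⟨1 / ((m : ℝ) + 1), Nat.one_div_pos_of_nat, fun {s t} hst => ?_⟩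
    have hs := tendsto_gridRight s
    have ht := tendsto_gridRight t
    have h1 := ((hs.mono_right nhdsWithin_le_nhds).dist
      (ht.mono_right nhdsWithin_le_nhds)).eventually (gt_mem_nhds hst)
    have h2 := (((f.isCadlag s).1.tendsto.comp hs).sub ((f.isCadlag t).1.tendsto.comp ht)).abs
    rw [Real.dist_eq]
    refine lt_of_le_of_lt (le_of_tendsto h2 ?_) hk
    filter_upwards [h1] with j hj
    exact hm (j, _) (j, _) hj
  · intro hf k
    have hu := CompactSpace.uniformContinuous_of_continuous hf
    obtain ⟨δ, hδ, h⟩ := Metric.uniformContinuous_iff.1 hu (1 / ((k : ℝ) + 1))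
      Nat.one_div_pos_of_nat
    obtain ⟨m, hm⟩ := exists_nat_one_div_lt hδ
    exact ⟨m, fun a b hab => (h (hab.trans hm)).le⟩

end CadlagFun

theorem isCadlag_of_continuous {f : I → ℝ} (hf : Continuous f) : IsCadlag f :=
  fun t => ⟨hf.continuousWithinAt, f t, (hf.tendsto t).mono_left nhdsWithin_le_nhds⟩

theorem measurePreserving_subTree (j : Fin 4) :
    MeasurePreserving (fun ω => subTree ω j) treeLaw treeLaw :=
  (measurePreserving_eval (fun _ : Fin 4 => treeLaw) j).comp
    ((measurePreserving_snd (μ := (volume : Measure (I × I)))).comp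
      ⟨measurable_splitRoot, map_splitRoot⟩)

theorem approx_eq_sum (n : ℕ) (ω : SplitTree) (s : I) :
    approx n ω s = qh s + ∑ k ∈ Finset.range n, incr k ω s := by
  have := Finset.sum_range_sub (fun k => approx k ω s) n
  simp only [incr]
  rw [this]
  simp [approx]

/-- The limit of the approximations is a continuous solution with the required moments. On the
null set where the dominating random variable is infinite it is replaced by zero. -/
theorem exists_limitLaw : ∃ μ : Measure CadlagFun, IsProbabilityMeasure μ ∧
    (∀ᵐ f ∂μ, Continuous f.toFun) ∧ IsFixedPointLaw μ ∧ HasLimitMoments μ := by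
  classical
  obtain ⟨G, r, hG, hGi, hr0, hr1, hb⟩ := exists_incr_le
  have hsr : Summable fun n : ℕ => r ^ n := summable_geometric_of_lt_one hr0.le hr1
  let lim : SplitTree → I → ℝ := fun ω s => qh s + ∑' n, incr n ω s
  have hcont : ∀ ω, G ω < ∞ → Continuous (lim ω) := fun ω hω =>
    continuous_qh.add (continuous_tsum
      (fun n => (holderBridge_approx (n + 1) ω).continuous.sub (holderBridge_approx n ω).continuous)
      (hsr.mul_left _) (hb ω hω))
  have htend : ∀ ω, G ω < ∞ → ∀ s, Tendsto (fun n => approx n ω s) atTop (𝓝 (lim ω s)) := by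
    intro ω hω s
    simp only [approx_eq_sum]
    exact tendsto_const_nhds.add
      ((Summable.of_norm_bounded (hsr.mul_left _) fun n => hb ω hω n s).hasSum.tendsto_sum_nat)
  set D : ℝ := 1 + 6 * (1 - r)⁻¹ with hD
  have hD0 : 0 ≤ D := by have : 0 < 1 - r := sub_pos.2 hr1; positivity
  have hbd : ∀ ω, G ω < ∞ → ∀ n s, |approx n ω s| ≤ D * √(1 + (G ω).toReal) := by
    intro ω hω n s
    have hs1 : 1 ≤ √(1 + (G ω).toReal) :=
      Real.one_le_sqrt.2 (by linarith [ENNReal.toReal_nonneg (a := G ω)])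
    rw [approx_eq_sum]
    refine (abs_add_le _ _).trans ?_
    rw [abs_of_nonneg (qh_nonneg s)]
    have h1 : |∑ k ∈ Finset.range n, incr k ω s|
        ≤ 6 * √(1 + (G ω).toReal) * (1 - r)⁻¹ := by
      refine (Finset.abs_sum_le_sum_abs _ _).trans ((Finset.sum_le_sum fun k _ =>
        hb ω hω k s).trans ?_)
      rw [← Finset.mul_sum, ← tsum_geometric_of_lt_one hr0.le hr1]
      exact mul_le_mul_of_nonneg_left (hsr.sum_le_tsum _ fun _ _ => by positivity) (by positivity)
    have h2 := qh_le_one s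
    calc qh s + |∑ k ∈ Finset.range n, incr k ω s|
        ≤ √(1 + (G ω).toReal) + 6 * √(1 + (G ω).toReal) * (1 - r)⁻¹ := by linarith
      _ = D * √(1 + (G ω).toReal) := by rw [hD]; ring
  let zero : CadlagFun := ⟨fun _ => 0, IsCadlag.const 0⟩
  let Z : SplitTree → CadlagFun := fun ω =>
    if h : G ω < ∞ then ⟨lim ω, isCadlag_of_continuous (hcont ω h)⟩ else zero
  have hZ : ∀ ω, G ω < ∞ → ∀ s, Z ω s = lim ω s := fun ω h s => by simp only [Z, dif_pos h]
  have hZ0 : ∀ ω, ¬ G ω < ∞ → ∀ s, Z ω s = 0 := fun ω h s => by simp only [Z, dif_neg h, zero]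
  have hGm : MeasurableSet {ω | G ω < ∞} := measurableSet_lt hG measurable_const
  have hZm : Measurable Z := by
    refine CadlagFun.measurable_iff.2 fun s => ?_
    refine measurable_of_tendsto_metrizable
      (f := fun n ω => if G ω < ∞ then approx n ω s else 0) (fun n => ?_) ?_
    · exact Measurable.ite hGm ((CadlagFun.measurable_eval s).comp (measurable_approx n))
        measurable_const
    · rw [tendsto_pi_nhds]
      intro ω
      by_cases h : G ω < ∞
      · simpa only [if_pos h, hZ ω h s] using htend ω h s
      · simpa only [if_neg h, hZ0 ω h s] using tendsto_const_nhds
  have hae : ∀ᵐ ω ∂treeLaw, G ω < ∞ := ae_lt_top hG hGi.ne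
  have hZbd : ∀ ω s, |Z ω s| ≤ D * √(1 + (G ω).toReal) := by
    intro ω s
    by_cases h : G ω < ∞
    · rw [hZ ω h s]
      exact le_of_tendsto (htend ω h s).abs (Eventually.of_forall fun n => hbd ω h n s)
    · rw [hZ0 ω h s, abs_zero]; positivity
  have hgi : Integrable (fun ω => 1 + (G ω).toReal) treeLaw :=
    (integrable_const _).add (integrable_toReal_of_lintegral_ne_top hG.aemeasurable hGi.ne)
  refine ⟨treeLaw.map Z, Measure.isProbabilityMeasure_map hZm.aemeasurable, ?_, ?_, ?_, ?_⟩
  · obtain ⟨A, hA, hAc⟩ := CadlagFun.exists_measurableSet_continuous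
    have : ∀ᵐ f ∂treeLaw.map Z, f ∈ A := by
      refine (ae_map_iff (p := fun f => f ∈ A) hZm.aemeasurable (by simpa using hA)).2 ?_
      filter_upwards [hae] with ω hω
      rw [hAc]
      exact (hcont ω hω).congr fun s => (hZ ω hω s).symm
    filter_upwards [this] with f hf
    exact (hAc f).1 hf
  · unfold IsFixedPointLaw
    rw [← map_prod_pi_comp hZm, Measure.map_map measurable_quadMap (measurable_prod_pi_comp hZm),
      ← map_splitRoot, Measure.map_map
        (measurable_quadMap.comp (measurable_prod_pi_comp hZm)) measurable_splitRoot]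
    refine Measure.map_congr ?_
    have hsub : ∀ᵐ ω ∂treeLaw, ∀ j, G (subTree ω j) < ∞ :=
      ae_all_iff.2 fun j => (measurePreserving_subTree j).quasiMeasurePreserving.ae hae
    filter_upwards [hae, hsub] with ω h0 hj
    have hext : ∀ f g : CadlagFun, (∀ s, f s = g s) → f = g := by
      rintro ⟨f, _⟩ ⟨g, _⟩ h
      congr
      exact funext h
    refine hext _ _ fun s => ?_
    simp only [Function.comp]
    rw [hZ ω h0]
    refine tendsto_nhds_unique ?_ ((tendsto_add_atTop_iff_nat 1).2 (htend ω h0 s))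
    simp only [approx_succ]
    rw [quadMap_eq_sum]
    refine tendsto_finsetSum _ fun j _ => Tendsto.const_mul _ ?_
    have := htend _ (hj j) (qpos (ω []) s j)
    rw [← hZ _ (hj j)] at this
    exact this
  · intro s
    rw [integral_map hZm.aemeasurable (CadlagFun.measurable_eval s).aestronglyMeasurable]
    have h : Tendsto (fun n => ∫ ω, approx n ω s ∂treeLaw) atTop (𝓝 (∫ ω, Z ω s ∂treeLaw)) := by
      refine tendsto_integral_of_dominated_convergence (fun ω => D * (1 + (G ω).toReal))
        (fun n => (integrable_approx n s).aestronglyMeasurable) (hgi.const_mul D) (fun n => ?_) ?_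
      · filter_upwards [hae] with ω hω
        refine (hbd ω hω n s).trans (mul_le_mul_of_nonneg_left ?_ hD0)
        have h0 := ENNReal.toReal_nonneg (a := G ω)
        exact Real.sqrt_le_iff.2 ⟨by linarith, by nlinarith⟩
      · filter_upwards [hae] with ω hω
        rw [hZ ω hω]
        exact htend ω hω s
    simp only [integral_approx] at h
    exact tendsto_nhds_unique h tendsto_const_nhds
  · refine (lintegral_map_le _ _).trans_lt ?_
    have hle : ∀ ω, (Z ω).supNorm ^ 2 ≤ ENNReal.ofReal (D ^ 2 * (1 + (G ω).toReal)) := by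
      intro ω
      have h0 := ENNReal.toReal_nonneg (a := G ω)
      have h1 : (Z ω).supNorm ≤ ENNReal.ofReal (D * √(1 + (G ω).toReal)) := by
        refine iSup_le fun s => ?_
        rw [← ofReal_norm]
        exact ENNReal.ofReal_le_ofReal (hZbd ω s)
      calc (Z ω).supNorm ^ 2 ≤ ENNReal.ofReal (D * √(1 + (G ω).toReal)) ^ 2 := by gcongr
        _ = _ := by
          rw [← ENNReal.ofReal_pow (by positivity), mul_pow, Real.sq_sqrt (by linarith)]
    refine (lintegral_mono hle).trans_lt ?_
    rw [← ofReal_integral_eq_lintegral_ofReal (hgi.const_mul _)]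
    · exact ENNReal.ofReal_lt_top
    · exact Eventually.of_forall fun ω => mul_nonneg (sq_nonneg _)
        (by linarith [ENNReal.toReal_nonneg (a := G ω)])

/-! ### The cost of a partial match query as a function of the list of points -/

namespace QuadTree

/-- The quadtree obtained by inserting the points of a list from left to right. -/
def ofList (l : List (I × I)) : QuadTree := l.foldl (fun t q => insert q t) nil

theorem build_eq_ofList (p : ℕ → I × I) (n : ℕ) :
    build p n = ofList (List.ofFn fun i : Fin n => p i) := by
  induction n with
  | zero => rfl
  | succ n ih =>
    rw [build, ih, List.ofFn_succ_last, ofList, ofList, List.foldl_append]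
    rfl

/-- The points of a list that lie in the `j`-th quadrant cut at `q`. -/
def inQuad (q : I × I) (j : Fin 4) (l : List (I × I)) : List (I × I) :=
  l.filter fun p => quad q p = j

/-- The quadrants of the first point receive the remaining points in their original order. -/
theorem ofList_cons (q : I × I) (l : List (I × I)) :
    ofList (q :: l) = node q (ofList (inQuad q 0 l)) (ofList (inQuad q 1 l))
      (ofList (inQuad q 2 l)) (ofList (inQuad q 3 l)) := by
  have key : ∀ a b c d, l.foldl (fun t q => insert q t) (node q a b c d)
      = node q ((inQuad q 0 l).foldl (fun t q => insert q t) a)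
        ((inQuad q 1 l).foldl (fun t q => insert q t) b)
        ((inQuad q 2 l).foldl (fun t q => insert q t) c)
        ((inQuad q 3 l).foldl (fun t q => insert q t) d) := by
    induction l with
    | nil => intros; rfl
    | cons p l ih =>
      intro a b c d
      rw [List.foldl_cons]
      by_cases h1 : p.1 < q.1 <;> by_cases h2 : p.2 < q.2 <;>
        simp [insert, h1, h2, ih, inQuad, quad]
  exact key nil nil nil nil

theorem cost_insert_ge (q : I × I) (t : QuadTree) (s : I) : t.cost s ≤ (insert q t).cost s := by
  induction t with
  | nil => simp [cost]
  | node p a b c d ha hb hc hd =>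
    unfold insert
    split_ifs <;> simp only [cost] <;> split_ifs <;> omega

end QuadTree

open QuadTree (inQuad)

/-- The cost of the partial match query at `s` in the quadtree of a list of points. -/
def listCost (l : List (I × I)) (s : I) : ℝ := (QuadTree.ofList l).cost s

theorem listCost_nil (s : I) : listCost [] s = 0 := by
  simp [listCost, QuadTree.ofList, QuadTree.cost]

theorem listCost_nonneg (l : List (I × I)) (s : I) : 0 ≤ listCost l s := Nat.cast_nonneg _

theorem listCost_cons (q : I × I) (l : List (I × I)) (s : I) :
    listCost (q :: l) s = 1 + ∑ j, qhit q s j * listCost (inQuad q j l) s := by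
  rw [listCost, QuadTree.ofList_cons, QuadTree.cost, Fin.sum_univ_four]
  by_cases h : s < q.1 <;> simp [qhit, h, listCost]

theorem length_inQuad (q : I × I) (l : List (I × I)) :
    ∑ j, (inQuad q j l).length = l.length := by
  induction l with
  | nil => simp [inQuad]
  | cons p l ih =>
    have : ∀ j, (inQuad q j (p :: l)).length
        = (inQuad q j l).length + if quad q p = j then 1 else 0 := by
      intro j
      by_cases h : quad q p = j <;> simp [inQuad, h]
    simp only [this, Finset.sum_add_distrib, ih, List.length_cons]
    simp

theorem length_inQuad_le (q : I × I) (j : Fin 4) (l : List (I × I)) :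
    (inQuad q j l).length ≤ l.length := List.length_filter_le _ _

theorem listCost_le_length (l : List (I × I)) (s : I) : listCost l s ≤ l.length := by
  induction h : l.length using Nat.strong_induction_on generalizing l with
  | _ n ih =>
    cases l with
    | nil => simp [listCost_nil, ← h]
    | cons q l =>
      rw [listCost_cons, ← h]
      have hlen : ((∑ j, (inQuad q j l).length : ℕ) : ℝ) = l.length := by rw [length_inQuad]
      push_cast at hlen
      have : ∑ j, qhit q s j * listCost (inQuad q j l) s ≤ ∑ j, ((inQuad q j l).length : ℝ) := by
        refine Finset.sum_le_sum fun j _ => ?_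
        refine (mul_le_of_le_one_left (listCost_nonneg _ _) (qhit_le_one _ _ _)).trans ?_
        refine ih _ ?_ _ rfl
        rw [← h, List.length_cons]
        exact Nat.lt_succ_of_le (length_inQuad_le q j l)
      rw [List.length_cons]
      push_cast
      linarith

/-- The cost depends only on the order relations between the coordinates. -/
theorem listCost_map (l : List (I × I)) (f : I × I → I × I) (s s' : I)
    (h1 : ∀ p ∈ l, ∀ p' ∈ l, (f p).1 < (f p').1 ↔ p.1 < p'.1)
    (h2 : ∀ p ∈ l, ∀ p' ∈ l, (f p).2 < (f p').2 ↔ p.2 < p'.2)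
    (hs : ∀ p ∈ l, s' < (f p).1 ↔ s < p.1) : listCost (l.map f) s' = listCost l s := by
  induction h : l.length using Nat.strong_induction_on generalizing l with
  | _ n ih =>
    cases l with
    | nil => simp [listCost_nil]
    | cons q l =>
      rw [List.map_cons, listCost_cons, listCost_cons]
      congr 1
      refine Finset.sum_congr rfl fun j _ => ?_
      have hq : q ∈ q :: l := List.mem_cons_self
      have e : inQuad (f q) j (l.map f) = (inQuad q j l).map f := by
        rw [inQuad, inQuad, List.filter_map]
        congr 1
        refine List.filter_congr fun p hp => ?_
        have hp' : p ∈ q :: l := List.mem_cons_of_mem _ hp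
        have : quad (f q) (f p) = quad q p := by
          simp only [quad, h1 p hp' q hq, h2 p hp' q hq]
        simp only [Function.comp, this]
      have hsub : ∀ p ∈ inQuad q j l, p ∈ q :: l := fun p hp =>
        List.mem_cons_of_mem _ (List.mem_of_mem_filter hp)
      rw [e, ih _ _ (inQuad q j l) (fun p hp p' hp' => h1 p (hsub p hp) p' (hsub p' hp'))
        (fun p hp p' hp' => h2 p (hsub p hp) p' (hsub p' hp')) (fun p hp => hs p (hsub p hp)) rfl]
      · simp only [qhit, hs q hq]
      · rw [← h, List.length_cons]
        exact Nat.lt_succ_of_le (length_inQuad_le q j l)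

/-- The points of a list in the `j`-th quadrant, rescaled to the unit square. -/
def subList (q : I × I) (j : Fin 4) (l : List (I × I)) : List (I × I) :=
  (inQuad q j l).map (qscale q j)

/-- A splitting point in the interior of the unit square, so that all quadrants are proper. -/
def Interior (q : I × I) : Prop := (0 < q.1 ∧ q.1 < 1) ∧ (0 < q.2 ∧ q.2 < 1)

theorem leftPos_lt_iff {x u v : I} (hu : u < x) (hv : v < x) :
    leftPos x u < leftPos x v ↔ u < v := by
  have hx : (0 : ℝ) < x := lt_of_le_of_lt u.2.1 (show (u : ℝ) < x from hu)
  rw [← Subtype.coe_lt_coe, coe_leftPos hu, coe_leftPos hv, div_lt_div_iff_of_pos_right hx,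
    Subtype.coe_lt_coe]

theorem rightPos_lt_iff {x u v : I} (hx : x < 1) (hu : x ≤ u) (hv : x ≤ v) :
    rightPos x u < rightPos x v ↔ u < v := by
  have hx' : (0 : ℝ) < 1 - x := sub_pos.2 (show (x : ℝ) < 1 from hx)
  rw [← Subtype.coe_lt_coe, coe_rightPos hu, coe_rightPos hv, div_lt_div_iff_of_pos_right hx',
    sub_lt_sub_iff_right, Subtype.coe_lt_coe]

/-- In a quadrant that is met by the line at `s`, the points and the line may be rescaled to the
unit square, since this preserves the order of all coordinates. -/
theorem qhit_mul_listCost {q : I × I} (hq : Interior q) (s : I) (j : Fin 4) (l : List (I × I)) :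
    qhit q s j * listCost (inQuad q j l) s
      = qhit q s j * listCost (subList q j l) (qpos q s j) := by
  obtain ⟨⟨-, hx⟩, ⟨-, hy⟩⟩ := hq
  have mem : ∀ p ∈ inQuad q j l, quad q p = j := fun p hp => by
    simpa using (List.mem_filter.1 hp).2
  by_cases h0 : qhit q s j = 0
  · simp [h0]
  congr 1
  symm
  have key : ∀ p, quad q p = j → (p.1 < q.1 ∧ s < q.1 ∧ (j = 0 ∨ j = 1) ∨
      q.1 ≤ p.1 ∧ q.1 ≤ s ∧ (j = 2 ∨ j = 3)) ∧
      (p.2 < q.2 ∧ (j = 0 ∨ j = 2) ∨ q.2 ≤ p.2 ∧ (j = 1 ∨ j = 3)) := by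
    intro p hp
    have hh : s < q.1 ↔ j = 0 ∨ j = 1 := by
      by_cases h : s < q.1 <;> fin_cases j <;> simp_all [qhit]
    by_cases h1 : p.1 < q.1 <;> by_cases h2 : p.2 < q.2 <;>
      simp [quad, h1, h2] at hp <;> subst hp <;> simp_all [le_of_not_gt]
  have side : ∀ p ∈ inQuad q j l, ∀ u v : I, (u = p.1 ∨ u = s) → ∀ p' ∈ inQuad q j l,
      (v = p'.1 ∨ v = s) → (qpos q u j < qpos q v j ↔ u < v) := by
    intro p hp u v hu p' hp' hv
    rcases (key p (mem p hp)).1 with ⟨a1, a2, a3⟩ | ⟨a1, a2, a3⟩ <;>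
      rcases (key p' (mem p' hp')).1 with ⟨b1, b2, b3⟩ | ⟨b1, b2, b3⟩
    · have hu' : u < q.1 := by rcases hu with rfl | rfl <;> assumption
      have hv' : v < q.1 := by rcases hv with rfl | rfl <;> assumption
      rcases a3 with rfl | rfl <;> exact leftPos_lt_iff hu' hv'
    · exact absurd a2 (not_lt.2 b2)
    · exact absurd b2 (not_lt.2 a2)
    · have hu' : q.1 ≤ u := by rcases hu with rfl | rfl <;> assumption
      have hv' : q.1 ≤ v := by rcases hv with rfl | rfl <;> assumption
      rcases a3 with rfl | rfl <;> exact rightPos_lt_iff hx hu' hv'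
  have fst : ∀ p, (qscale q j p).1 = qpos q p.1 j := fun p => rfl
  refine listCost_map _ _ _ _ (fun p hp p' hp' => ?_) (fun p hp p' hp' => ?_) (fun p hp => ?_)
  · rw [fst, fst]
    exact side p hp _ _ (Or.inl rfl) p' hp' (Or.inl rfl)
  · rcases (key p (mem p hp)).2 with ⟨a1, a3⟩ | ⟨a1, a3⟩ <;>
      rcases (key p' (mem p' hp')).2 with ⟨b1, b3⟩ | ⟨b1, b3⟩
    · rcases a3 with rfl | rfl <;> exact leftPos_lt_iff a1 b1
    · rcases a3 with rfl | rfl <;> simp at b3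
    · rcases a3 with rfl | rfl <;> simp at b3
    · rcases a3 with rfl | rfl <;> exact rightPos_lt_iff hy a1 b1
  · rw [fst]
    exact side p hp _ _ (Or.inr rfl) p hp (Or.inl rfl)

theorem listCost_cons_of_interior {q : I × I} (hq : Interior q) (l : List (I × I)) (s : I) :
    listCost (q :: l) s = 1 + ∑ j, qhit q s j * listCost (subList q j l) (qpos q s j) := by
  rw [listCost_cons]
  congr 1
  exact Finset.sum_congr rfl fun j _ => qhit_mul_listCost hq s j l

theorem ae_interior : ∀ᵐ q : I × I, Interior q := by
  have h : ∀ᵐ x : I, 0 < x ∧ x < 1 := by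
    have h0 : ∀ᵐ x : I, x ≠ 0 := by simp [ae_iff]
    have h1 : ∀ᵐ x : I, x ≠ 1 := by simp [ae_iff]
    filter_upwards [h0, h1] with x hx0 hx1
    exact ⟨unitInterval.pos_iff_ne_zero.2 hx0, unitInterval.lt_one_iff_ne_one.2 hx1⟩
  have h1 : ∀ᵐ q : I × I, 0 < q.1 ∧ q.1 < 1 :=
    (Measure.quasiMeasurePreserving_fst (μ := (volume : Measure I))
      (ν := (volume : Measure I))).ae h
  have h2 : ∀ᵐ q : I × I, 0 < q.2 ∧ q.2 < 1 :=
    (Measure.quasiMeasurePreserving_snd (μ := (volume : Measure I))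
      (ν := (volume : Measure I))).ae h
  filter_upwards [h1, h2] with q a b using ⟨a, b⟩

/-! ### Measurability of functionals of lists of points -/

/-- A list functional with a parameter is jointly measurable on lists of length at most `n`. -/
def MeasUpTo {T E : Type} [MeasurableSpace T] [MeasurableSpace E] (n : ℕ)
    (H : T → List (I × I) → E) : Prop :=
  ∀ k ≤ n, Measurable fun p : T × (Fin k → I × I) => H p.1 (List.ofFn p.2)

/-- Filtering and mapping a list preserve measurability. The induction keeps the points already
selected in the parameter. -/
theorem measurable_filter_map {E : Type} [MeasurableSpace E] (n : ℕ) {T : Type}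
    [MeasurableSpace T] (c : T → I × I → Fin 4) (j : Fin 4)
    (hc : Measurable fun p : T × (I × I) => c p.1 p.2) (f : T → I × I → I × I)
    (hf : Measurable fun p : T × (I × I) => f p.1 p.2) (H : T → List (I × I) → E)
    (hH : MeasUpTo n H) :
    Measurable fun p : T × (Fin n → I × I) =>
      H p.1 (((List.ofFn p.2).filter fun x => c p.1 x = j).map (f p.1)) := by
  induction n generalizing T with
  | zero => simpa using hH 0 le_rfl
  | succ n ih =>
    have htail : Measurable fun p : T × (Fin (n + 1) → I × I) => (p.1, fun i : Fin n => p.2 i.succ) :=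
      measurable_fst.prodMk (measurable_pi_iff.2 fun i =>
        (measurable_pi_apply _).comp measurable_snd)
    have hhead : Measurable fun p : T × (Fin (n + 1) → I × I) => (p.1, p.2 0) :=
      measurable_fst.prodMk ((measurable_pi_apply _).comp measurable_snd)
    have h1 : Measurable fun p : T × (Fin (n + 1) → I × I) =>
        H p.1 (((List.ofFn fun i : Fin n => p.2 i.succ).filter fun x => c p.1 x = j).map (f p.1)) :=
      (ih c hc f hf H fun k hk => hH k (hk.trans n.le_succ)).comp htail
    have h2 := ih (T := T × (I × I)) (fun t => c t.1)
      (hc.comp ((measurable_fst.comp measurable_fst).prodMk measurable_snd)) (fun t => f t.1)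
      (hf.comp ((measurable_fst.comp measurable_fst).prodMk measurable_snd))
      (fun t l => H t.1 (f t.1 t.2 :: l)) fun k hk => by
        have hcons : Measurable fun p : (T × (I × I)) × (Fin k → I × I) =>
            (p.1.1, (Fin.cons (f p.1.1 p.1.2) p.2 : Fin (k + 1) → I × I)) := by
          refine (measurable_fst.comp measurable_fst).prodMk (measurable_pi_iff.2 fun i => ?_)
          refine Fin.cases ?_ (fun i => ?_) i
          · simpa [Function.comp_def] using hf.comp measurable_fst
          · simp only [Fin.cons_succ]
            exact (measurable_pi_apply i).comp measurable_snd
        have := (hH (k + 1) (Nat.succ_le_succ hk)).comp hcons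
        simpa [Function.comp_def, List.ofFn_cons] using this
    have h2' := h2.comp (f := fun p : T × (Fin (n + 1) → I × I) =>
      ((p.1, p.2 0), fun i : Fin n => p.2 i.succ))
      (hhead.prodMk (measurable_pi_iff.2 fun i => (measurable_pi_apply _).comp measurable_snd))
    have hset : MeasurableSet {p : T × (Fin (n + 1) → I × I) | c p.1 (p.2 0) = j} :=
      (hc.comp hhead) (measurableSet_singleton j)
    have h3 : Measurable fun p : T × (Fin (n + 1) → I × I) =>
        if c p.1 (p.2 0) = j then
          H p.1 (f p.1 (p.2 0) ::
            ((List.ofFn fun i : Fin n => p.2 i.succ).filter fun x => c p.1 x = j).map (f p.1))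
        else H p.1
          (((List.ofFn fun i : Fin n => p.2 i.succ).filter fun x => c p.1 x = j).map (f p.1)) :=
      Measurable.ite hset h2' h1
    convert h3 using 2 with p
    rw [List.ofFn_succ]
    by_cases h : c p.1 (p.2 0) = j <;> simp [h]

theorem measurable_subList {E T : Type} [MeasurableSpace E] [MeasurableSpace T] {n : ℕ}
    {q : T → I × I} (hq : Measurable q) (j : Fin 4) {H : T → List (I × I) → E}
    (hH : MeasUpTo n H) :
    Measurable fun p : T × (Fin n → I × I) => H p.1 (subList (q p.1) j (List.ofFn p.2)) :=
  measurable_filter_map n (fun t => quad (q t)) j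
    (measurable_quad.comp ((hq.comp measurable_fst).prodMk measurable_snd))
    (fun t => qscale (q t) j)
    ((measurable_qscale j).comp ((hq.comp measurable_fst).prodMk measurable_snd)) H hH

theorem measurable_listCost (n : ℕ) :
    Measurable fun p : I × (Fin n → I × I) => listCost (List.ofFn p.2) p.1 := by
  induction n using Nat.strong_induction_on with
  | _ n ih =>
    cases n with
    | zero => simp [listCost_nil]
    | succ n =>
      simp only [List.ofFn_succ, listCost_cons]
      refine measurable_const.add (Finset.measurable_sum _ fun j _ => Measurable.mul ?_ ?_)
      · have h0 : Measurable fun p : I × (Fin (n + 1) → I × I) => (p.2 0, p.1) :=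
          ((measurable_pi_apply _).comp measurable_snd).prodMk measurable_fst
        exact (measurable_qhit j).comp h0
      · have h := measurable_filter_map n (T := I × (I × I)) (fun t => quad t.2) j
          (measurable_quad.comp ((measurable_snd.comp measurable_fst).prodMk measurable_snd))
          (fun _ => id) measurable_snd (fun t l => listCost l t.1) fun k hk =>
            (ih k (Nat.lt_succ_of_le hk)).comp
              ((measurable_fst.comp measurable_fst).prodMk measurable_snd)
        have h2 := h.comp (f := fun p : I × (Fin (n + 1) → I × I) =>
          ((p.1, p.2 0), fun i : Fin n => p.2 i.succ))
          ((measurable_fst.prodMk ((measurable_pi_apply _).comp measurable_snd)).prodMk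
            (measurable_pi_iff.2 fun i => (measurable_pi_apply _).comp measurable_snd))
        simpa [Function.comp_def, inQuad] using h2

/-! ### Averages over independent uniform points -/

/-- The expectation of `G` evaluated at a list of `n` independent uniform points. -/
def EE {𝕜 : Type} [RCLike 𝕜] (n : ℕ) (G : List (I × I) → 𝕜) : 𝕜 :=
  ∫ v : Fin n → I × I, G (List.ofFn v)

/-- A family of functionals of lists of points that is jointly measurable and, on lists of
bounded length, uniformly bounded. -/
structure GoodFam {𝕜 T : Type} [RCLike 𝕜] [MeasurableSpace T] (H : T → List (I × I) → 𝕜) :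
    Prop where
  meas : ∀ n, Measurable fun p : T × (Fin n → I × I) => H p.1 (List.ofFn p.2)
  bdd : ∀ n, ∃ C, ∀ t l, l.length ≤ n → ‖H t l‖ ≤ C

/-- A single functional of lists of points that is measurable and bounded on lists of bounded
length. -/
def GoodFun {𝕜 : Type} [RCLike 𝕜] (G : List (I × I) → 𝕜) : Prop := GoodFam fun _ : Unit => G

section Good

variable {𝕜 T S : Type} [RCLike 𝕜] [MeasurableSpace T] [MeasurableSpace S]

theorem GoodFam.comp {H : T → List (I × I) → 𝕜} (hH : GoodFam H) {f : S → T}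
    (hf : Measurable f) : GoodFam fun s => H (f s) where
  meas n := (hH.meas n).comp ((hf.comp measurable_fst).prodMk measurable_snd)
  bdd n := (hH.bdd n).imp fun _ h s => h (f s)

theorem GoodFam.apply {H : T → List (I × I) → 𝕜} (hH : GoodFam H) (t : T) : GoodFun (H t) :=
  hH.comp (f := fun _ => t) measurable_const

theorem GoodFun.fam {G : List (I × I) → 𝕜} (hG : GoodFun G) : GoodFam fun _ : T => G :=
  GoodFam.comp hG (f := fun _ => ()) measurable_const

theorem GoodFun.meas {G : List (I × I) → 𝕜} (hG : GoodFun G) (n : ℕ) :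
    Measurable fun v : Fin n → I × I => G (List.ofFn v) :=
  (GoodFam.meas hG n).comp (measurable_const (a := ()).prodMk measurable_id)

theorem GoodFam.cons {H : T → List (I × I) → 𝕜} (hH : GoodFam H) :
    GoodFam fun (p : T × (I × I)) l => H p.1 (p.2 :: l) where
  meas n := by
    have hcons : Measurable fun p : (T × (I × I)) × (Fin n → I × I) =>
        (p.1.1, (Fin.cons p.1.2 p.2 : Fin (n + 1) → I × I)) := by
      refine (measurable_fst.comp measurable_fst).prodMk (measurable_pi_iff.2 fun i => ?_)
      refine Fin.cases ?_ (fun i => ?_) i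
      · simpa [Function.comp_def] using measurable_snd.comp measurable_fst
      · simp only [Fin.cons_succ]
        exact (measurable_pi_apply i).comp measurable_snd
    simpa [Function.comp_def, List.ofFn_cons] using (hH.meas (n + 1)).comp hcons
  bdd n := (hH.bdd (n + 1)).imp fun C h p l hl => h p.1 _ (by simpa using hl)

theorem GoodFun.cons {G : List (I × I) → 𝕜} (hG : GoodFun G) :
    GoodFam fun (p : I × I) l => G (p :: l) :=
  (GoodFam.cons hG).comp (f := fun p => ((), p)) (measurable_const.prodMk measurable_id)

theorem GoodFam.mul {H K : T → List (I × I) → 𝕜} (hH : GoodFam H) (hK : GoodFam K) :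
    GoodFam fun t l => H t l * K t l where
  meas n := (hH.meas n).mul (hK.meas n)
  bdd n := by
    obtain ⟨C, hC⟩ := hH.bdd n
    obtain ⟨D, hD⟩ := hK.bdd n
    refine ⟨C * D, fun t l hl => ?_⟩
    rw [norm_mul]
    exact mul_le_mul (hC t l hl) (hD t l hl) (norm_nonneg _) ((norm_nonneg _).trans (hC t l hl))

theorem GoodFam.prod {ι : Type} [Fintype ι] {H : ι → T → List (I × I) → 𝕜}
    (hH : ∀ i, GoodFam (H i)) : GoodFam fun t l => ∏ i, H i t l where
  meas n := Finset.measurable_prod _ fun i _ => (hH i).meas n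
  bdd n := by
    choose C hC using fun i => (hH i).bdd n
    refine ⟨∏ i, C i, fun t l hl => ?_⟩
    rw [norm_prod]
    exact Finset.prod_le_prod (fun _ _ => norm_nonneg _) fun i _ => hC i t l hl

theorem GoodFam.add {H K : T → List (I × I) → 𝕜} (hH : GoodFam H) (hK : GoodFam K) :
    GoodFam fun t l => H t l + K t l where
  meas n := (hH.meas n).add (hK.meas n)
  bdd n := by
    obtain ⟨C, hC⟩ := hH.bdd n
    obtain ⟨D, hD⟩ := hK.bdd n
    exact ⟨C + D, fun t l hl => (norm_add_le _ _).trans (add_le_add (hC t l hl) (hD t l hl))⟩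

theorem GoodFam.sum {ι : Type} [Fintype ι] {H : ι → T → List (I × I) → 𝕜}
    (hH : ∀ i, GoodFam (H i)) : GoodFam fun t l => ∑ i, H i t l where
  meas n := Finset.measurable_sum _ fun i _ => (hH i).meas n
  bdd n := by
    choose C hC using fun i => (hH i).bdd n
    exact ⟨∑ i, C i, fun t l hl => (norm_sum_le _ _).trans
      (Finset.sum_le_sum fun i _ => hC i t l hl)⟩

theorem GoodFam.subList {H : T → List (I × I) → 𝕜} (hH : GoodFam H) {q : T → I × I}
    (hq : Measurable q) (j : Fin 4) : GoodFam fun t l => H t (subList (q t) j l) where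
  meas n := measurable_subList hq j fun k _ => hH.meas k
  bdd n := (hH.bdd n).imp fun C h t l hl => h t _ <| by
    rw [_root_.subList, List.length_map]
    exact (length_inQuad_le _ _ _).trans hl

theorem GoodFam.of_param {g : T → 𝕜} (hg : Measurable g) {C : ℝ} (hC : ∀ t, ‖g t‖ ≤ C) :
    GoodFam fun t (_ : List (I × I)) => g t where
  meas _ := hg.comp measurable_fst
  bdd _ := ⟨C, fun t _ _ => hC t⟩

theorem GoodFun.of_length (g : ℕ → 𝕜) : GoodFun fun l : List (I × I) => g l.length where
  meas n := by simp
  bdd n := ⟨∑ k ∈ Finset.range (n + 1), ‖g k‖, fun _ l hl =>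
    Finset.single_le_sum (f := fun k => ‖g k‖) (fun _ _ => norm_nonneg _)
      (Finset.mem_range.2 (Nat.lt_succ_of_le hl))⟩

theorem goodFam_listCost : GoodFam fun (s : I) l => listCost l s where
  meas n := measurable_listCost n
  bdd n := ⟨n, fun s l hl => by
    rw [Real.norm_of_nonneg (listCost_nonneg _ _)]
    exact (listCost_le_length l s).trans (by exact_mod_cast hl)⟩

theorem GoodFun.integrable {G : List (I × I) → 𝕜} (hG : GoodFun G) (n : ℕ) :
    Integrable fun v : Fin n → I × I => G (List.ofFn v) := by
  obtain ⟨C, hC⟩ := GoodFam.bdd hG n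
  exact Integrable.of_bound (hG.meas n).aestronglyMeasurable C
    (ae_of_all _ fun v => hC () _ (by simp))

theorem GoodFam.integrable {H : T → List (I × I) → 𝕜} (hH : GoodFam H) (n : ℕ) (m : Measure T)
    [IsFiniteMeasure m] :
    Integrable (fun p : T × (Fin n → I × I) => H p.1 (List.ofFn p.2)) (m.prod volume) := by
  obtain ⟨C, hC⟩ := hH.bdd n
  exact Integrable.of_bound (hH.meas n).aestronglyMeasurable C
    (ae_of_all _ fun v => hC _ _ (by simp))

theorem GoodFam.measurable_EE {H : T → List (I × I) → 𝕜} (hH : GoodFam H) (n : ℕ) :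
    Measurable fun t => EE n (H t) :=
  (StronglyMeasurable.integral_prod_right (hH.meas n).stronglyMeasurable).measurable

theorem EE_congr {n : ℕ} {G G' : List (I × I) → 𝕜} (h : ∀ l, l.length = n → G l = G' l) :
    EE n G = EE n G' :=
  integral_congr_ae (ae_of_all _ fun _ => h _ (by simp))

theorem EE_const (n : ℕ) (c : 𝕜) : EE n (fun _ => c) = c := by simp [EE]

theorem EE_zero (G : List (I × I) → 𝕜) : EE 0 G = G [] := by simp [EE, measureReal_def]

theorem norm_EE_le {n : ℕ} {G : List (I × I) → 𝕜} {C : ℝ}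
    (h : ∀ l, l.length = n → ‖G l‖ ≤ C) : ‖EE n G‖ ≤ C := by
  have := norm_integral_le_of_norm_le_const (μ := (volume : Measure (Fin n → I × I)))
    (f := fun v => G (List.ofFn v)) (C := C) (ae_of_all _ fun v => h _ (by simp))
  simpa [EE] using this

theorem GoodFam.EE_length {H : T → List (I × I) → 𝕜} (hH : GoodFam H) :
    GoodFam fun t l => EE l.length (H t) where
  meas n := by
    simp only [List.length_ofFn]
    exact (hH.measurable_EE n).comp measurable_fst
  bdd n := (hH.bdd n).imp fun C h t l hl => norm_EE_le fun l' hl' => h t l' (hl'.trans_le hl)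

/-- Fubini's theorem for the averages `EE`. -/
theorem integral_EE_swap {H : T → List (I × I) → 𝕜} (hH : GoodFam H) (n : ℕ) (m : Measure T)
    [IsFiniteMeasure m] : ∫ t, EE n (H t) ∂m = EE n fun l => ∫ t, H t l ∂m :=
  integral_integral_swap (hH.integrable n m)

theorem EE_succ {G : List (I × I) → 𝕜} (hG : GoodFun G) (n : ℕ) :
    EE (n + 1) G = ∫ p, EE n fun l => G (p :: l) := by
  have mp := (volume_preserving_piFinSuccAbove (fun _ : Fin (n + 1) => I × I) 0).symm
  have h := mp.integral_comp (MeasurableEquiv.measurableEmbedding _)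
    fun v : Fin (n + 1) → I × I => G (List.ofFn v)
  rw [EE, ← h]
  have e : ∀ p : (I × I) × (Fin n → I × I),
      List.ofFn ((MeasurableEquiv.piFinSuccAbove (fun _ : Fin (n + 1) => I × I) 0).symm p)
        = p.1 :: List.ofFn p.2 := by
    intro p
    rw [List.ofFn_succ]
    rfl
  simp only [e]
  exact integral_prod _ (hG.cons.integrable n volume)

end Good

theorem GoodFun.mul {𝕜 : Type} [RCLike 𝕜] {G K : List (I × I) → 𝕜} (hG : GoodFun G)
    (hK : GoodFun K) : GoodFun fun l => G l * K l := GoodFam.mul hG hK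

theorem GoodFun.prod {𝕜 : Type} [RCLike 𝕜] {ι : Type} [Fintype ι]
    {G : ι → List (I × I) → 𝕜} (hG : ∀ i, GoodFun (G i)) : GoodFun fun l => ∏ i, G i l :=
  GoodFam.prod hG

theorem GoodFun.subList {𝕜 : Type} [RCLike 𝕜] {G : List (I × I) → 𝕜} (hG : GoodFun G)
    (q : I × I) (j : Fin 4) : GoodFun fun l => G (subList q j l) :=
  GoodFam.subList hG (q := fun _ => q) measurable_const j

theorem subList_cons (q p : I × I) (j : Fin 4) (l : List (I × I)) :
    subList q j (p :: l)
      = if quad q p = j then qscale q j p :: subList q j l else subList q j l := by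
  by_cases h : quad q p = j <;> simp [subList, inQuad, h]

theorem integral_eq_sum_quad {𝕜 : Type} [RCLike 𝕜] (q : I × I) {f : I × I → 𝕜}
    (hf : Integrable f) : ∫ p, f p = ∑ i, ∫ p in quad q ⁻¹' {i}, f p := by
  have hm : Measurable (quad q) := measurable_quad.comp (measurable_const.prodMk measurable_id)
  rw [← integral_iUnion_fintype (fun i => hm (measurableSet_singleton i))
    (fun i j hij => Disjoint.preimage _ (by simpa using hij)) fun i => hf.integrableOn]
  rw [show (⋃ i, quad q ⁻¹' {i}) = univ by ext; simp, setIntegral_univ]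

theorem integral_quad_qscale {𝕜 : Type} [RCLike 𝕜] (q : I × I) (i : Fin 4) {f : I × I → 𝕜}
    (hf : Measurable f) :
    ∫ p in quad q ⁻¹' {i}, f (qscale q i p) = (qarea q i : 𝕜) * ∫ p, f p := by
  have hm : Measurable (qscale q i) :=
    (measurable_qscale i).comp (measurable_const.prodMk measurable_id)
  rw [← integral_map (f := f) hm.aemeasurable hf.aestronglyMeasurable, map_qscale_restrict,
    integral_smul_measure, ENNReal.toReal_ofReal (qarea_nonneg _ _), RCLike.real_smul_eq_coe_mul]

/-- Given the numbers of points in the four quadrants cut at `q`, the rescaled sublists are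
independent lists of independent uniform points. -/
theorem EE_prod_subList {𝕜 : Type} [RCLike 𝕜] (q : I × I) (n : ℕ) {G : Fin 4 → List (I × I) → 𝕜}
    (hG : ∀ j, GoodFun (G j)) :
    EE n (fun l => ∏ j, G j (subList q j l))
      = EE n (fun l => ∏ j, EE (subList q j l).length (G j)) := by
  induction n generalizing G with
  | zero =>
    rw [EE_zero, EE_zero]
    exact Finset.prod_congr rfl fun j _ => (EE_zero (G j)).symm
  | succ n ih =>
    have g1 : GoodFun fun l => ∏ j, G j (subList q j l) := GoodFun.prod fun j => (hG j).subList q j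
    have g2 : ∀ {G : Fin 4 → List (I × I) → 𝕜}, (∀ j, GoodFun (G j)) →
        GoodFun fun l => ∏ j, EE (subList q j l).length (G j) := fun {G} hG =>
      GoodFun.prod fun j => GoodFun.subList (GoodFam.EE_length (hG j)) q j
    rw [EE_succ g1, EE_succ (g2 hG), integral_eq_sum_quad q, integral_eq_sum_quad q]
    rotate_left
    · exact (g2 hG).cons.integrable n volume |>.integral_prod_left
    · exact g1.cons.integrable n volume |>.integral_prod_left
    refine Finset.sum_congr rfl fun i _ => ?_
    have hset : MeasurableSet (quad q ⁻¹' {i}) :=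
      (measurable_quad.comp (measurable_const.prodMk measurable_id)) (measurableSet_singleton i)
    -- the first point lies in the `i`-th quadrant; the other three factors do not see it
    set R : List (I × I) → 𝕜 := fun l => ∏ j ∈ Finset.univ.erase i, EE (subList q j l).length (G j)
      with hR
    have hRg : GoodFun R := by
      have : R = fun l => ∏ j : {j // j ≠ i}, EE (subList q j l).length (G j) := by
        funext l
        rw [hR, ← Finset.prod_subtype (Finset.univ.erase i) (by simp)
          (fun j => EE (subList q j l).length (G j))]
      rw [this]
      exact GoodFun.prod fun j => GoodFun.subList (GoodFam.EE_length (hG j)) q j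
    have hGi : GoodFam fun p l => G i (p :: l) := (hG i).cons
    have hqs : Measurable (qscale q i) :=
      (measurable_qscale i).comp (measurable_const.prodMk measurable_id)
    have left : ∀ p ∈ quad q ⁻¹' {i}, EE n (fun l => ∏ j, G j (subList q j (p :: l)))
        = EE n fun l => R l * EE (subList q i l).length fun l' => G i (qscale q i p :: l') := by
      intro p hp
      rw [mem_preimage, mem_singleton_iff] at hp
      have e : ∀ l, ∏ j, G j (subList q j (p :: l)) = ∏ j, (Function.update G i
          (fun l' => G i (qscale q i p :: l'))) j (subList q j l) := by
        intro l
        refine Finset.prod_congr rfl fun j _ => ?_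
        rw [subList_cons]
        by_cases hj : i = j
        · subst hj; simp [hp]
        · simp [hp, hj, Function.update_of_ne (Ne.symm hj)]
      simp only [e]
      rw [ih]
      · refine EE_congr fun l _ => ?_
        rw [← Finset.prod_erase_mul _ _ (Finset.mem_univ i), Function.update_self]
        congr 1
        exact Finset.prod_congr rfl fun j hj => by
          rw [Function.update_of_ne (Finset.ne_of_mem_erase hj)]
      · intro j
        by_cases hj : j = i
        · subst hj; simpa using hGi.apply _
        · simpa [Function.update_of_ne hj] using hG j
    have right : ∀ p ∈ quad q ⁻¹' {i},
        EE n (fun l => ∏ j, EE (subList q j (p :: l)).length (G j))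
        = EE n fun l => R l * EE ((subList q i l).length + 1) (G i) := by
      intro p hp
      rw [mem_preimage, mem_singleton_iff] at hp
      refine EE_congr fun l _ => ?_
      rw [← Finset.prod_erase_mul _ _ (Finset.mem_univ i), subList_cons, if_pos hp,
        List.length_cons]
      congr 1
      exact Finset.prod_congr rfl fun j hj => by
        rw [subList_cons, if_neg (by rw [hp]; exact (Finset.ne_of_mem_erase hj).symm)]
    rw [setIntegral_congr_fun hset left, setIntegral_congr_fun hset right]
    have gl : GoodFam fun p l =>
        R l * EE (subList q i l).length fun l' => G i (qscale q i p :: l') :=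
      hRg.fam.mul (GoodFam.subList (q := fun _ => q) (hGi.comp hqs).EE_length measurable_const i)
    have gr : GoodFam fun (_ : I × I) l => R l * EE ((subList q i l).length + 1) (G i) :=
      GoodFun.fam (hRg.mul (GoodFun.subList (GoodFun.of_length fun k => EE (k + 1) (G i)) q i))
    rw [integral_EE_swap gl, integral_EE_swap gr]
    refine EE_congr fun l _ => ?_
    rw [integral_const_mul, integral_quad_qscale q i (f := fun p =>
      EE (subList q i l).length fun l' => G i (p :: l')) (hGi.measurable_EE _), ← EE_succ (hG i)]
    have := integral_quad_qscale q i (f := fun _ : I × I =>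
      R l * EE ((subList q i l).length + 1) (G i)) measurable_const
    rw [this]
    simp only [integral_const, probReal_univ, one_smul]
    ring

/-- Independent uniform points on a probability space realise the averages `EE`. -/
theorem integral_ofFn_eq_EE {𝕜 : Type} [RCLike 𝕜] {Ω : Type*} [MeasurableSpace Ω]
    {P : Measure Ω} [IsProbabilityMeasure P] {p : ℕ → Ω → I × I} (hmeas : ∀ i, Measurable (p i))
    (hindep : iIndepFun p P) (hunif : ∀ i, P.map (p i) = volume) (n : ℕ)
    {G : List (I × I) → 𝕜} (hG : GoodFun G) :
    ∫ ω, G (List.ofFn fun i : Fin n => p i ω) ∂P = EE n G := by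
  have h1 : iIndepFun (fun i : Fin n => p i) P := hindep.precomp Fin.val_injective
  have h2 := (iIndepFun_iff_map_fun_eq_pi_map fun i => (hmeas _).aemeasurable).1 h1
  simp only [hunif] at h2
  rw [EE, volume_pi, ← h2, integral_map (measurable_pi_iff.2 fun i => hmeas _).aemeasurable
    (hG.meas n).aestronglyMeasurable]

/-! ### A second order recurrence and its asymptotics -/

section Asymptotics

open PowerSeries

/-- The terms of the Gauss hypergeometric series `₂F₁(-β, -1-β; c; 1)`. -/
def hypTerm (c : ℝ) : ℕ → ℝ
  | 0 => 1
  | j + 1 => hypTerm c j * ((j - qβ) * (j - 1 - qβ) / ((j + 1) * (j + c)))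

/-- The Taylor coefficients of `(1 - z) ^ (-1-β)`. -/
def binTerm : ℕ → ℝ
  | 0 => 1
  | m + 1 => binTerm m * ((m + 1 + qβ) / (m + 1))

theorem hypTerm_succ_mul {c : ℝ} (hc : 0 < c) (j : ℕ) :
    ((j + 1) * (j + c)) * hypTerm c (j + 1) = (j - qβ) * (j - 1 - qβ) * hypTerm c j := by
  rw [hypTerm]
  have : (j : ℝ) + c ≠ 0 := by positivity
  field_simp

theorem binTerm_succ_mul (m : ℕ) : (m + 1) * binTerm (m + 1) = (m + 1 + qβ) * binTerm m := by
  rw [binTerm]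
  field_simp

theorem hypergeometric_ode : X * d⁄dX ℝ (d⁄dX ℝ (mk (hypTerm 2)))
    - X * (X * d⁄dX ℝ (d⁄dX ℝ (mk (hypTerm 2)))) + C 2 * d⁄dX ℝ (mk (hypTerm 2))
    + C (2 * qβ) * (X * d⁄dX ℝ (mk (hypTerm 2))) - C (qβ * (qβ + 1)) * mk (hypTerm 2) = 0 := by
  ext n
  have h := hypTerm_succ_mul (c := 2) two_pos n
  rcases n with _ | _ | n <;>
    simp only [map_sub, map_add, coeff_C_mul, coeff_zero_X_mul, coeff_succ_X_mul,
      coeff_derivative, coeff_mk, map_zero] <;> push_cast at h ⊢ <;> linear_combination h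

theorem binomial_ode : d⁄dX ℝ (mk binTerm) - X * d⁄dX ℝ (mk binTerm)
    - C (1 + qβ) * mk binTerm = 0 := by
  ext n
  have h := binTerm_succ_mul n
  rcases n with _ | n <;>
    simp only [map_sub, coeff_C_mul, coeff_zero_X_mul, coeff_succ_X_mul, coeff_derivative,
      coeff_mk, map_zero] <;> push_cast at h ⊢ <;> linear_combination h

/-- The product of the two series solves the differential equation `(1 - z)² (z f)'' = 4 f`. -/
theorem product_ode (f : ℝ⟦X⟧) (hf : f = mk binTerm * mk (hypTerm 2)) :
    (1 - X) ^ 2 * (C 2 * d⁄dX ℝ f + X * d⁄dX ℝ (d⁄dX ℝ f)) = C 4 * f := by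
  have hW := binomial_ode
  have hD := hypergeometric_ode
  set W : ℝ⟦X⟧ := mk binTerm
  set D : ℝ⟦X⟧ := mk (hypTerm 2)
  have hW' := congrArg (d⁄dX ℝ) hW
  have e1 : d⁄dX ℝ f = d⁄dX ℝ W * D + W * d⁄dX ℝ D := by
    rw [hf, Derivation.leibniz]; simp only [smul_eq_mul]; ring
  have e2 : d⁄dX ℝ (d⁄dX ℝ f) = d⁄dX ℝ (d⁄dX ℝ W) * D + 2 * (d⁄dX ℝ W * d⁄dX ℝ D)
      + W * d⁄dX ℝ (d⁄dX ℝ D) := by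
    rw [e1, map_add, Derivation.leibniz, Derivation.leibniz]; simp only [smul_eq_mul]; ring
  simp only [map_sub, Derivation.leibniz, smul_eq_mul, derivative_C, derivative_X, map_zero,
    mul_zero, add_zero] at hW'
  set W1 := d⁄dX ℝ W
  set W2 := d⁄dX ℝ W1
  set D1 := d⁄dX ℝ D
  set D2 := d⁄dX ℝ D1
  have hq : (C qβ + 1) * (C qβ + 2) = (4 : ℝ⟦X⟧) := by
    have := congrArg (C (R := ℝ)) qβ_eq
    simpa only [map_mul, map_add, map_one, map_ofNat] using this
  rw [e2, e1, hf]
  simp only [map_add, map_mul, map_one, map_ofNat] at hW hW' hD ⊢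
  set b : ℝ⟦X⟧ := C qβ
  linear_combination (1 - X) * W * hD + (2 * (1 - X) * D + 2 * X * (1 - X) * D1 + X * (b + 2) * D) * hW
    + X * (1 - X) * D * hW' + W * D * hq

/-- The convolution of the two coefficient sequences. -/
def convSeq (n : ℕ) : ℝ := ∑ j ∈ Finset.range (n + 1), hypTerm 2 j * binTerm (n - j)

theorem convSeq_zero : convSeq 0 = 1 := by simp [convSeq, hypTerm, binTerm]

theorem coeff_product (n : ℕ) :
    coeff n (mk binTerm * mk (hypTerm 2) : ℝ⟦X⟧) = convSeq n := by
  rw [mul_comm, coeff_mul, convSeq, Finset.Nat.sum_antidiagonal_eq_sum_range_succ_mk]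
  simp

/-- The differential equation for the generating function, read off coefficient by coefficient. -/
theorem convSeq_rec (n : ℕ) : ((n : ℝ) + 3) * (n + 4) * convSeq (n + 3)
    - 2 * ((n + 2) * (n + 3)) * convSeq (n + 2) + (n + 1) * (n + 2) * convSeq (n + 1)
      = 4 * convSeq (n + 2) := by
  have h := congrArg (coeff (n + 2)) (product_ode _ rfl)
  set f : ℝ⟦X⟧ := mk binTerm * mk (hypTerm 2) with hf
  set g := C 2 * d⁄dX ℝ f + X * d⁄dX ℝ (d⁄dX ℝ f) with hg
  have hc : ∀ k, coeff k g = (k + 2) * (k + 1) * convSeq (k + 1) := by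
    intro k
    rcases k with _ | k
    · simp only [hg, map_add, coeff_C_mul, coeff_zero_X_mul, coeff_derivative, hf, coeff_product]
      push_cast; ring
    · simp only [hg, map_add, coeff_C_mul, coeff_succ_X_mul, coeff_derivative, hf, coeff_product]
      push_cast; ring
  have e : (1 - X) ^ 2 * g = g - C 2 * (X * g) + X * (X * g) := by
    simp only [map_ofNat]; ring
  rw [e] at h
  simp only [map_add, map_sub, coeff_C_mul, coeff_succ_X_mul, hc] at h
  rw [hf, coeff_product] at h
  push_cast at h
  linarith

theorem convSeq_one : convSeq 1 = 2 := by
  have h := qβ_eq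
  simp [convSeq, hypTerm, binTerm, Finset.sum_range_succ]
  linarith

theorem convSeq_two : convSeq 2 = 8 / 3 := by
  have h := qβ_eq
  have h1 := congrArg (coeff 1) (product_ode _ rfl)
  set f : ℝ⟦X⟧ := mk binTerm * mk (hypTerm 2) with hf
  have e : (1 - X) ^ 2 * (C 2 * d⁄dX ℝ f + X * d⁄dX ℝ (d⁄dX ℝ f))
      = (C 2 * d⁄dX ℝ f + X * d⁄dX ℝ (d⁄dX ℝ f)) - C 2 * (X * (C 2 * d⁄dX ℝ f + X * d⁄dX ℝ (d⁄dX ℝ f)))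
        + X * (X * (C 2 * d⁄dX ℝ f + X * d⁄dX ℝ (d⁄dX ℝ f))) := by
    simp only [map_ofNat]; ring
  rw [e] at h1
  have h0 : ∀ φ : ℝ⟦X⟧, coeff 1 (X * φ) = coeff 0 φ := fun φ => coeff_succ_X_mul 0 φ
  simp only [map_add, map_sub, coeff_C_mul, h0, coeff_zero_X_mul, coeff_derivative] at h1
  simp only [hf, coeff_product, convSeq_one] at h1
  norm_num at h1
  rw [convSeq_one] at h1
  linarith

/-! ### Gauss's summation of the hypergeometric series -/

theorem abs_hypTerm_le {c : ℝ} (hc : 2 ≤ c) (j : ℕ) : |hypTerm c j| ≤ |hypTerm 2 j| := by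
  induction j with
  | zero => simp [hypTerm]
  | succ j ih =>
    rw [hypTerm, hypTerm, abs_mul, abs_mul]
    refine mul_le_mul ih ?_ (abs_nonneg _) (abs_nonneg _)
    rw [abs_div, abs_div, abs_of_pos (by positivity : (0 : ℝ) < (j + 1) * (j + c)),
      abs_of_pos (by positivity : (0 : ℝ) < ((j : ℝ) + 1) * (j + 2))]
    gcongr

/-- From the third term on, the terms of the series decay like `1 / j²`. -/
theorem abs_hypTerm_le_inv (j : ℕ) :
    |hypTerm 2 (j + 2)| * (((j : ℝ) + 2) * (j + 3)) ≤ 6 * |hypTerm 2 2| := by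
  induction j with
  | zero => norm_num; linarith
  | succ j ih =>
    refine le_trans ?_ ih
    have h := hypTerm_succ_mul (c := 2) two_pos (j + 2)
    have h2 := congrArg abs h
    have hb := qβ_lt
    have hb' := qβ_pos
    have hj : (0 : ℝ) ≤ j := Nat.cast_nonneg j
    push_cast at h2
    rw [abs_mul, abs_mul (_ * _) (hypTerm 2 (j + 2)),
      abs_of_pos (by positivity : (0 : ℝ) < ((j : ℝ) + 2 + 1) * (j + 2 + 2)),
      abs_of_pos (mul_pos (by linarith) (by linarith) :
        (0 : ℝ) < ((j : ℝ) + 2 - qβ) * (j + 2 - 1 - qβ))] at h2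
    have h3 : ((j : ℝ) + 2 - qβ) * (j + 2 - 1 - qβ) ≤ (j + 2) * (j + 3) :=
      mul_le_mul (by linarith) (by linarith) (by linarith) (by linarith)
    have e : |hypTerm 2 (j + 1 + 2)| * ((((j + 1 : ℕ) : ℝ) + 2) * (((j + 1 : ℕ) : ℝ) + 3))
        = ((j : ℝ) + 2 + 1) * (j + 2 + 2) * |hypTerm 2 (j + 2 + 1)| := by
      rw [show j + 1 + 2 = j + 2 + 1 by ring]
      push_cast; ring
    rw [e, h2, mul_comm |hypTerm 2 (j + 2)|]
    exact mul_le_mul_of_nonneg_right h3 (abs_nonneg _)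

theorem summable_abs_hypTerm : Summable fun j => |hypTerm 2 j| := by
  rw [← summable_nat_add_iff 2]
  refine Summable.of_nonneg_of_le (fun _ => abs_nonneg _) (fun j => ?_)
    (((summable_nat_add_iff 2).2 (Real.summable_one_div_nat_pow.2 one_lt_two)).mul_left
      (6 * |hypTerm 2 2|))
  have h := abs_hypTerm_le_inv j
  rw [mul_one_div, le_div_iff₀ (by positivity)]
  refine le_trans (mul_le_mul_of_nonneg_left ?_ (abs_nonneg _)) h
  push_cast
  nlinarith [(Nat.cast_nonneg j : (0 : ℝ) ≤ j)]

theorem summable_hypTerm {c : ℝ} (hc : 2 ≤ c) : Summable (hypTerm c) :=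
  Summable.of_norm_bounded summable_abs_hypTerm fun j => abs_hypTerm_le hc j

theorem tendsto_mul_hypTerm {c : ℝ} (hc : 2 ≤ c) :
    Tendsto (fun j : ℕ => (j : ℝ) * hypTerm c j) atTop (𝓝 0) := by
  rw [← tendsto_add_atTop_iff_nat 2]
  have hlim : Tendsto (fun j : ℕ => 6 * |hypTerm 2 2| * (1 / ((j : ℝ) + 1))) atTop (𝓝 0) := by
    simpa using tendsto_one_div_add_atTop_nhds_zero_nat.const_mul (6 * |hypTerm 2 2|)
  refine squeeze_zero_norm (fun j => ?_) hlim
  rw [norm_mul, Real.norm_eq_abs, Real.norm_eq_abs, Nat.abs_cast, mul_one_div,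
    le_div_iff₀ (by positivity)]
  refine le_trans ?_ (abs_hypTerm_le_inv j)
  have := abs_hypTerm_le hc (j + 2)
  calc ((j + 2 : ℕ) : ℝ) * |hypTerm c (j + 2)| * (j + 1)
      ≤ ((j + 2 : ℕ) : ℝ) * |hypTerm 2 (j + 2)| * (j + 3) := by gcongr; linarith
    _ = _ := by push_cast; ring

/-- The contiguity relation behind Gauss's summation theorem. -/
theorem tsum_hypTerm_contiguous {c : ℝ} (hc : 2 ≤ c) :
    c * (c + 1 + 2 * qβ) * ∑' j, hypTerm c j
      = (c + qβ) * (c + 1 + qβ) * ∑' j, hypTerm (c + 1) j := by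
  have hc0 : 0 < c := by linarith
  have hshift : ∀ j : ℕ, (c + j) * hypTerm (c + 1) j = c * hypTerm c j := by
    intro j
    induction j with
    | zero => simp [hypTerm]
    | succ j ih =>
      have h1 := hypTerm_succ_mul hc0 j
      have h2 := hypTerm_succ_mul (by linarith : 0 < c + 1) j
      have hj : (0 : ℝ) < (j + 1) * (j + c) := by positivity
      refine mul_left_cancel₀ hj.ne' ?_
      push_cast
      linear_combination (↑j + c) * h2 - c * h1 + (↑j - qβ) * (↑j - 1 - qβ) * ih
  -- the telescoping certificate
  have hG : ∀ j : ℕ, c * (c + 1 + 2 * qβ) * hypTerm c j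
      - (c + qβ) * (c + 1 + qβ) * hypTerm (c + 1) j
      = c * (j * hypTerm c j) - c * ((j + 1 : ℕ) * hypTerm c (j + 1)) := by
    intro j
    have h1 := hypTerm_succ_mul hc0 j
    have hj : (0 : ℝ) < j + c := by positivity
    refine mul_left_cancel₀ hj.ne' ?_
    push_cast
    linear_combination (-(c + qβ) * (c + 1 + qβ)) * hshift j + c * h1
  have s1 := (summable_hypTerm hc).hasSum
  have s2 := (summable_hypTerm (by linarith : 2 ≤ c + 1)).hasSum
  have s3 := ((s1.mul_left (c * (c + 1 + 2 * qβ))).sub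
    (s2.mul_left ((c + qβ) * (c + 1 + qβ)))).tendsto_sum_nat
  simp only [hG] at s3
  have e : ∀ n : ℕ, ∑ j ∈ Finset.range n,
      (c * (j * hypTerm c j) - c * ((j + 1 : ℕ) * hypTerm c (j + 1)))
      = 0 - c * (n * hypTerm c n) := by
    intro n
    rw [Finset.sum_range_sub' fun j : ℕ => c * (j * hypTerm c j)]
    simp
  simp only [e] at s3
  have s4 : Tendsto (fun n : ℕ => 0 - c * (n * hypTerm c n)) atTop (𝓝 0) := by
    simpa using ((tendsto_mul_hypTerm hc).const_mul c).const_sub 0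
  exact sub_eq_zero.1 (tendsto_nhds_unique s3 s4)

theorem tendsto_tsum_hypTerm : Tendsto (fun n : ℕ => ∑' j, hypTerm (2 + n) j) atTop (𝓝 1) := by
  have hj : ∀ j, Tendsto (fun n : ℕ => hypTerm (2 + n) j) atTop (𝓝 (if j = 0 then 1 else 0)) := by
    intro j
    rcases j with _ | j
    · simp [hypTerm]
    · have hlim : Tendsto (fun n : ℕ => |hypTerm 2 j| * |((j : ℝ) - qβ) * (j - 1 - qβ)|
          * (1 / ((n : ℝ) + 1))) atTop (𝓝 0) := by
        simpa using tendsto_one_div_add_atTop_nhds_zero_nat.const_mul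
          (|hypTerm 2 j| * |((j : ℝ) - qβ) * (j - 1 - qβ)|)
      simp only [Nat.succ_ne_zero, if_false]
      refine squeeze_zero_norm (fun n => ?_) hlim
      rw [hypTerm, norm_mul, norm_div, Real.norm_eq_abs, Real.norm_eq_abs, Real.norm_eq_abs,
        mul_assoc, ← div_eq_mul_one_div]
      refine mul_le_mul (abs_hypTerm_le (by simp) j) ?_ (by positivity) (abs_nonneg _)
      rw [abs_of_pos (by positivity : (0 : ℝ) < ((j : ℝ) + 1) * (j + (2 + n)))]
      refine div_le_div_of_nonneg_left (abs_nonneg _) (by positivity) ?_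
      nlinarith [(Nat.cast_nonneg j : (0 : ℝ) ≤ j), (Nat.cast_nonneg n : (0 : ℝ) ≤ n)]
  have := tendsto_tsum_of_dominated_convergence summable_abs_hypTerm hj
    (Eventually.of_forall fun n j => abs_hypTerm_le (by simp) j)
  simpa using this

/-- Gauss's summation theorem for the series at hand. -/
theorem tsum_hypTerm : ∑' j, hypTerm 2 j
    = Real.Gamma (3 + 2 * qβ) / (Real.Gamma (2 + qβ) * Real.Gamma (3 + qβ)) := by
  have hb := qβ_pos
  have step : ∀ n : ℕ, (∏ i ∈ Finset.range n, ((2 : ℝ) + i)) * (∏ i ∈ Finset.range n, (3 + 2 * qβ + i))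
      * ∑' j, hypTerm 2 j = (∏ i ∈ Finset.range n, (2 + qβ + i))
        * (∏ i ∈ Finset.range n, (3 + qβ + i)) * ∑' j, hypTerm (2 + n) j := by
    intro n
    induction n with
    | zero => simp
    | succ n ih =>
      have h := tsum_hypTerm_contiguous (c := 2 + n) (by simp)
      simp only [Finset.prod_range_succ]
      push_cast
      rw [← add_assoc]
      linear_combination (2 + (n : ℝ)) * (3 + 2 * qβ + n) * ih
        + (∏ i ∈ Finset.range n, (2 + qβ + i)) * (∏ i ∈ Finset.range n, (3 + qβ + i)) * h
  -- in terms of Euler's sequences for the Gamma function the powers of `n` cancel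
  have key : ∀ n : ℕ, n ≠ 0 → Real.GammaSeq (2 + qβ) n * Real.GammaSeq (3 + qβ) n
      * ∑' j, hypTerm 2 j = Real.GammaSeq 2 n * Real.GammaSeq (3 + 2 * qβ) n
        * ∑' j, hypTerm (2 + (n + 1 : ℕ)) j := by
    intro n hn
    have hn' : (0 : ℝ) < n := by positivity
    have hpow : (n : ℝ) ^ (2 + qβ) * (n : ℝ) ^ (3 + qβ)
        = (n : ℝ) ^ (2 : ℝ) * (n : ℝ) ^ (3 + 2 * qβ) := by
      rw [← Real.rpow_add hn', ← Real.rpow_add hn']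
      congr 1; ring
    have hs := step (n + 1)
    have p1 : ∏ i ∈ Finset.range (n + 1), ((2 : ℝ) + i) ≠ 0 :=
      Finset.prod_ne_zero_iff.2 fun i _ => by positivity
    have p2 : ∏ i ∈ Finset.range (n + 1), (3 + 2 * qβ + i) ≠ 0 :=
      Finset.prod_ne_zero_iff.2 fun i _ => by positivity
    have p3 : ∏ i ∈ Finset.range (n + 1), (2 + qβ + i) ≠ 0 :=
      Finset.prod_ne_zero_iff.2 fun i _ => by positivity
    have p4 : ∏ i ∈ Finset.range (n + 1), (3 + qβ + i) ≠ 0 :=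
      Finset.prod_ne_zero_iff.2 fun i _ => by positivity
    simp only [Real.GammaSeq]
    rw [div_mul_div_comm, div_mul_div_comm, div_mul_eq_mul_div, div_mul_eq_mul_div,
      div_eq_div_iff (mul_ne_zero p3 p4) (mul_ne_zero p1 p2)]
    linear_combination (n.factorial : ℝ) ^ 2 * (n : ℝ) ^ (2 + qβ) * (n : ℝ) ^ (3 + qβ) * hs
      + (n.factorial : ℝ) ^ 2 * (∏ i ∈ Finset.range (n + 1), (2 + qβ + i))
        * (∏ i ∈ Finset.range (n + 1), (3 + qβ + i)) * (∑' j, hypTerm (2 + (n + 1 : ℕ)) j) * hpow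
  have l1 := (((Real.GammaSeq_tendsto_Gamma (2 + qβ)).mul
    (Real.GammaSeq_tendsto_Gamma (3 + qβ))).mul_const (∑' j, hypTerm 2 j))
  have l2 := ((Real.GammaSeq_tendsto_Gamma 2).mul (Real.GammaSeq_tendsto_Gamma (3 + 2 * qβ))).mul
    ((tendsto_add_atTop_iff_nat 1).2 tendsto_tsum_hypTerm)
  have e := tendsto_nhds_unique (l1.congr' ((eventually_ne_atTop 0).mono key)) l2
  rw [Real.Gamma_two, one_mul, mul_one] at e
  have g1 := (Real.Gamma_pos_of_pos (by linarith : 0 < 2 + qβ)).ne'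
  have g2 := (Real.Gamma_pos_of_pos (by linarith : 0 < 3 + qβ)).ne'
  rw [eq_div_iff (mul_ne_zero g1 g2), ← e]
  ring

/-! ### Asymptotics of the convolution -/

theorem binTerm_pos (m : ℕ) : 0 < binTerm m := by
  have := qβ_pos
  induction m with
  | zero => simp [binTerm]
  | succ m ih => rw [binTerm]; positivity

theorem binTerm_mono : Monotone binTerm := by
  refine monotone_nat_of_le_succ fun m => ?_
  rw [binTerm]
  refine le_mul_of_one_le_right (binTerm_pos m).le ?_
  rw [one_le_div (by positivity)]
  linarith [qβ_pos]

/-- The growth of the binomial coefficients, from Euler's limit for the Gamma function. -/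
theorem tendsto_binTerm :
    Tendsto (fun n : ℕ => binTerm n / (n : ℝ) ^ qβ) atTop (𝓝 (Real.Gamma (1 + qβ))⁻¹) := by
  have hb := qβ_pos
  have hprod : ∀ n : ℕ, (∏ i ∈ Finset.range n, (1 + qβ + i)) = n.factorial * binTerm n := by
    intro n
    induction n with
    | zero => simp [binTerm]
    | succ n ih =>
      have := binTerm_succ_mul n
      rw [Finset.prod_range_succ, ih, Nat.factorial_succ]
      push_cast
      linear_combination -(n.factorial : ℝ) * this
  have key : ∀ n : ℕ, n ≠ 0 → (n : ℝ) / (n + (1 + qβ)) * (Real.GammaSeq (1 + qβ) n)⁻¹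
      = binTerm n / (n : ℝ) ^ qβ := by
    intro n hn
    have hn' : (0 : ℝ) < n := by positivity
    rw [Real.GammaSeq, Finset.prod_range_succ, hprod, Real.rpow_add hn', Real.rpow_one]
    have h1 := (binTerm_pos n).ne'
    have h2 : (n.factorial : ℝ) ≠ 0 := by positivity
    have h3 : (n : ℝ) ^ qβ ≠ 0 := by positivity
    have h4 : 1 + qβ + (n : ℝ) ≠ 0 := by positivity
    have h5 : (n : ℝ) + (1 + qβ) ≠ 0 := by positivity
    field_simp
    ring
  have g1 := (Real.Gamma_pos_of_pos (by linarith : 0 < 1 + qβ)).ne'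
  have l1 := (tendsto_natCast_div_add_atTop (1 + qβ)).mul
    ((Real.GammaSeq_tendsto_Gamma (1 + qβ)).inv₀ g1)
  rw [one_mul] at l1
  exact l1.congr' ((eventually_ne_atTop 0).mono key)

theorem tendsto_binTerm_sub (j : ℕ) :
    Tendsto (fun n : ℕ => binTerm (n - j) / binTerm n) atTop (𝓝 1) := by
  have hb := qβ_pos
  have h1 : Tendsto (fun n : ℕ => binTerm n / binTerm (n + 1)) atTop (𝓝 1) := by
    have e : ∀ n : ℕ, binTerm n / binTerm (n + 1) = ((n + 1 : ℕ) : ℝ) / ((n + 1 : ℕ) + qβ) := by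
      intro n
      have h1 := (binTerm_pos n).ne'
      rw [binTerm]
      push_cast
      have h2 : (n : ℝ) + 1 + qβ ≠ 0 := by positivity
      field_simp
    simp only [e]
    exact (tendsto_add_atTop_iff_nat 1).2 (tendsto_natCast_div_add_atTop qβ)
  induction j with
  | zero =>
    simp only [Nat.sub_zero]
    exact tendsto_const_nhds.congr fun n => (div_self (binTerm_pos n).ne').symm
  | succ j ih =>
    have h2 := ((tendsto_sub_atTop_nat (j + 1)).eventually_ge_atTop 0)
    have h3 := (h1.comp (tendsto_sub_atTop_nat (j + 1))).mul ih
    rw [one_mul] at h3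
    refine h3.congr' ?_
    filter_upwards [eventually_ge_atTop (j + 1)] with n hn
    have : n - (j + 1) + 1 = n - j := by omega
    simp only [Function.comp, this]
    rw [div_mul_div_cancel₀ (binTerm_pos _).ne']

/-- The hypergeometric series converges absolutely at `1`, so the convolution behaves like the
binomial coefficients times its sum. -/
theorem tendsto_convSeq : Tendsto (fun n : ℕ => convSeq n / (n : ℝ) ^ qβ) atTop
    (𝓝 (Real.Gamma (2 * qβ + 2) / (2 * Real.Gamma (qβ + 1) ^ 3))) := by
  have hb := qβ_pos
  have h1 : Tendsto (fun n : ℕ => convSeq n / binTerm n) atTop (𝓝 (∑' j, hypTerm 2 j)) := by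
    have e : ∀ n : ℕ, convSeq n / binTerm n
        = ∑' j, if j ≤ n then hypTerm 2 j * (binTerm (n - j) / binTerm n) else 0 := by
      intro n
      rw [tsum_eq_sum (s := Finset.range (n + 1)), convSeq, Finset.sum_div]
      · refine Finset.sum_congr rfl fun j hj => ?_
        rw [if_pos (by simpa [Nat.lt_succ_iff] using hj), mul_div_assoc]
      · intro j hj
        rw [if_neg (by simpa [Nat.lt_succ_iff] using hj)]
    simp only [e]
    refine tendsto_tsum_of_dominated_convergence summable_abs_hypTerm (fun j => ?_)
      (Eventually.of_forall fun n j => ?_)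
    · have := (tendsto_binTerm_sub j).const_mul (hypTerm 2 j)
      rw [mul_one] at this
      refine this.congr' ?_
      filter_upwards [eventually_ge_atTop j] with n hn
      rw [if_pos hn]
    · split_ifs with h
      · rw [norm_mul, Real.norm_eq_abs, Real.norm_eq_abs]
        refine mul_le_of_le_one_right (abs_nonneg _) ?_
        rw [abs_of_nonneg (div_nonneg (binTerm_pos _).le (binTerm_pos _).le)]
        exact div_le_one_of_le₀ (binTerm_mono (Nat.sub_le _ _)) (binTerm_pos _).le
      · simp
  have h2 := h1.mul tendsto_binTerm
  rw [tsum_hypTerm] at h2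
  have e3 : Real.Gamma (3 + 2 * qβ) = (2 * qβ + 2) * Real.Gamma (2 * qβ + 2) := by
    rw [← Real.Gamma_add_one (by linarith)]; congr 1; ring
  have e2 : Real.Gamma (2 + qβ) = (qβ + 1) * Real.Gamma (qβ + 1) := by
    rw [← Real.Gamma_add_one (by linarith)]; congr 1; ring
  have e4 : Real.Gamma (3 + qβ) = (qβ + 2) * ((qβ + 1) * Real.Gamma (qβ + 1)) := by
    rw [← e2, add_comm 2 qβ, ← Real.Gamma_add_one (by linarith)]; congr 1; ring
  have g1 := (Real.Gamma_pos_of_pos (by linarith : 0 < qβ + 1)).ne'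
  have hlim : Real.Gamma (3 + 2 * qβ) / (Real.Gamma (2 + qβ) * Real.Gamma (3 + qβ))
      * (Real.Gamma (1 + qβ))⁻¹ = Real.Gamma (2 * qβ + 2) / (2 * Real.Gamma (qβ + 1) ^ 3) := by
    rw [e3, e2, e4, add_comm 1 qβ]
    have h5 : qβ + 1 ≠ 0 := by positivity
    have h6 : qβ + 2 ≠ 0 := by positivity
    have h7 := qβ_eq
    rw [← div_eq_mul_inv, div_div, div_eq_div_iff (by positivity) (by positivity)]
    linear_combination (-(Real.Gamma (2 * qβ + 2) * Real.Gamma (qβ + 1) ^ 3 * (qβ + 1))) * h7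
  rw [hlim] at h2
  refine h2.congr fun n => ?_
  rw [div_mul_div_cancel₀ (binTerm_pos n).ne']

/-- The recurrence for the mean cost of a query at a uniform random location determines its
growth. -/
theorem tendsto_of_recurrence {a : ℕ → ℝ} (h0 : a 0 = 0) (h1 : a 1 = 1) (h2 : a 2 = 5 / 3)
    (hrec : ∀ n : ℕ, ((n : ℝ) + 3) * (n + 4) * (a (n + 3) - 1)
      - 2 * ((n + 2) * (n + 3)) * (a (n + 2) - 1) + (n + 1) * (n + 2) * (a (n + 1) - 1)
        = 4 * a (n + 2)) :
    Tendsto (fun n : ℕ => a n / (n : ℝ) ^ qβ) atTop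
      (𝓝 (Real.Gamma (2 * qβ + 2) / (2 * Real.Gamma (qβ + 1) ^ 3))) := by
  have e : ∀ n, a n + 1 = convSeq n := by
    intro n
    induction n using Nat.strong_induction_on with
    | _ n ih =>
      rcases n with _ | _ | _ | n
      · rw [h0, convSeq_zero]; norm_num
      · rw [h1, convSeq_one]; norm_num
      · rw [h2, convSeq_two]; norm_num
      · have i1 := ih (n + 1) (by omega)
        have i2 := ih (n + 2) (by omega)
        have r1 := hrec n
        have r2 := convSeq_rec n
        have hn : ((n : ℝ) + 3) * (n + 4) ≠ 0 := by positivity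
        refine mul_left_cancel₀ hn ?_
        rw [← i1, ← i2] at r2
        linear_combination r1 - r2
  have hz : Tendsto (fun n : ℕ => 1 / (n : ℝ) ^ qβ) atTop (𝓝 0) := by
    simpa [Function.comp_def, Pi.inv_def] using
      ((tendsto_rpow_atTop qβ_pos).comp tendsto_natCast_atTop_atTop).inv_tendsto_atTop
  have := tendsto_convSeq.sub hz
  rw [sub_zero] at this
  refine this.congr fun n => ?_
  rw [← e]
  ring

end Asymptotics

/-! ### The mean cost -/

theorem EE_subList {𝕜 : Type} [RCLike 𝕜] (q : I × I) (j : Fin 4) (n : ℕ) {G : List (I × I) → 𝕜}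
    (hG : GoodFun G) :
    EE n (fun l => G (subList q j l)) = EE n (fun l => EE (subList q j l).length G) := by
  have h := EE_prod_subList q n (G := fun i l => if i = j then G l else 1) fun i => by
    by_cases hi : i = j
    · simpa [hi] using hG
    · simpa [hi] using GoodFun.of_length (𝕜 := 𝕜) fun _ => 1
  have e : ∀ i k, EE k (fun l => if i = j then G l else 1) = if i = j then EE k G else 1 := by
    intro i k
    by_cases hi : i = j
    · simp [hi]
    · simp [hi, EE_const]
  simpa [e] using h

theorem EE_add {𝕜 : Type} [RCLike 𝕜] {n : ℕ} {G K : List (I × I) → 𝕜} (hG : GoodFun G)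
    (hK : GoodFun K) : EE n (fun l => G l + K l) = EE n G + EE n K :=
  integral_add (hG.integrable n) (hK.integrable n)

theorem EE_sum {𝕜 : Type} [RCLike 𝕜] {ι : Type} (s : Finset ι) {n : ℕ}
    {G : ι → List (I × I) → 𝕜} (hG : ∀ i ∈ s, GoodFun (G i)) :
    EE n (fun l => ∑ i ∈ s, G i l) = ∑ i ∈ s, EE n (G i) :=
  integral_finsetSum _ fun i hi => (hG i hi).integrable n

theorem EE_const_mul {𝕜 : Type} [RCLike 𝕜] {n : ℕ} (c : 𝕜) (G : List (I × I) → 𝕜) :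
    EE n (fun l => c * G l) = c * EE n G := integral_const_mul _ _

theorem EE_mono {n : ℕ} {G K : List (I × I) → ℝ} (hG : GoodFun G) (hK : GoodFun K)
    (h : ∀ l, l.length = n → G l ≤ K l) : EE n G ≤ EE n K :=
  integral_mono (hG.integrable n) (hK.integrable n) fun _ => h _ (by simp)

theorem abs_EE_le {n : ℕ} {G : List (I × I) → ℝ} {C : ℝ} (h : ∀ l, l.length = n → |G l| ≤ C) :
    |EE n G| ≤ C := by
  rw [← Real.norm_eq_abs]
  exact norm_EE_le h

theorem EE_nonneg {n : ℕ} {G : List (I × I) → ℝ} (h : ∀ l, 0 ≤ G l) : 0 ≤ EE n G :=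
  integral_nonneg fun _ => h _

theorem GoodFun.const_mul {𝕜 : Type} [RCLike 𝕜] {G : List (I × I) → 𝕜} (hG : GoodFun G) (c : 𝕜) :
    GoodFun fun l => c * G l := (GoodFun.of_length fun _ => c).mul hG

theorem GoodFun.pow {G : List (I × I) → ℝ} (hG : GoodFun G) (m : ℕ) : GoodFun fun l => G l ^ m := by
  have : (fun l => G l ^ m) = fun l => ∏ _i : Fin m, G l := by
    funext l; simp
  rw [this]
  exact GoodFun.prod fun _ => hG

/-- The expected cost of the query at `s` in a tree of `n` uniform points. -/
def meanCost (n : ℕ) (s : I) : ℝ := EE n fun l => listCost l s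

theorem goodFun_listCost (s : I) : GoodFun fun l => listCost l s := goodFam_listCost.apply s

theorem measurable_meanCost (n : ℕ) : Measurable (meanCost n) := goodFam_listCost.measurable_EE n

theorem meanCost_nonneg (n : ℕ) (s : I) : 0 ≤ meanCost n s :=
  EE_nonneg fun l => listCost_nonneg l s

theorem meanCost_le (n : ℕ) (s : I) : meanCost n s ≤ n := by
  refine (le_abs_self _).trans (abs_EE_le fun l hl => ?_)
  rw [abs_of_nonneg (listCost_nonneg l s), ← hl]
  exact listCost_le_length l s

theorem abs_meanCost_le (n : ℕ) (s : I) : |meanCost n s| ≤ n := by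
  rw [abs_of_nonneg (meanCost_nonneg n s)]; exact meanCost_le n s

theorem meanCost_zero (s : I) : meanCost 0 s = 0 := by
  rw [meanCost, EE_zero, listCost_nil]

theorem goodFam_meanCost (j : Fin 4) : GoodFam fun (p : (I × I) × I) (l : List (I × I)) =>
    meanCost (subList p.1 j l).length (qpos p.1 p.2 j) := by
  have h := GoodFam.subList (T := (I × I) × I) (q := Prod.fst)
    (goodFam_listCost.comp (measurable_qpos j)).EE_length measurable_fst j
  exact h

/-- The recursion for the mean cost, obtained by conditioning on the first point. -/
theorem meanCost_succ (n : ℕ) (s : I) : meanCost (n + 1) s = 1 + ∫ q : I × I, ∑ j, qhit q s j *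
    EE n fun l => meanCost (subList q j l).length (qpos q s j) := by
  have hpair : Measurable fun q : I × I => (q, s) := measurable_id.prodMk measurable_const
  have hm : ∀ j, Measurable fun q : I × I => qhit q s j *
      EE n fun l => meanCost (subList q j l).length (qpos q s j) := fun j =>
    ((measurable_qhit j).comp hpair).mul (((goodFam_meanCost j).comp hpair).measurable_EE n)
  have hi : Integrable fun q : I × I => ∑ j, qhit q s j *
      EE n fun l => meanCost (subList q j l).length (qpos q s j) := by
    refine integrable_finsetSum _ fun j _ => integrable_of_bdd (hm j) n fun q => ?_
    rw [abs_mul, abs_of_nonneg (qhit_nonneg _ _ _)]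
    refine (mul_le_of_le_one_left (abs_nonneg _) (qhit_le_one _ _ _)).trans ?_
    refine abs_EE_le fun l hl => (abs_meanCost_le _ _).trans ?_
    rw [_root_.subList, List.length_map, ← hl]
    exact_mod_cast length_inQuad_le q j l
  have e : ∫ q : I × I, (1 + ∑ j, qhit q s j *
      EE n fun l => meanCost (subList q j l).length (qpos q s j)) = meanCost (n + 1) s := by
    rw [meanCost, EE_succ (goodFun_listCost s)]
    refine integral_congr_ae (ae_interior.mono fun q hq => ?_)
    have hg : ∀ j, GoodFun fun l => listCost (subList q j l) (qpos q s j) := fun j =>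
      (goodFun_listCost _).subList q j
    simp only [listCost_cons_of_interior hq]
    rw [EE_add (GoodFun.of_length fun _ => (1 : ℝ)) (GoodFam.sum fun j => (hg j).const_mul _),
      EE_const, EE_sum _ fun j _ => (hg j).const_mul _]
    congr 1
    refine Finset.sum_congr rfl fun j _ => ?_
    rw [EE_const_mul, EE_subList q j n (goodFun_listCost _)]
    rfl
  rw [← e, integral_add (integrable_const _) hi]
  simp

/-- Binomial moments of the number of points in a quadrant. -/
theorem EE_choose (q : I × I) (j : Fin 4) (n k : ℕ) :
    EE n (fun l => ((subList q j l).length.choose k : ℝ)) = n.choose k * qarea q j ^ k := by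
  have good : ∀ k, GoodFun fun l => ((subList q j l).length.choose k : ℝ) := fun k =>
    GoodFun.subList (G := fun l => (l.length.choose k : ℝ))
      (GoodFun.of_length fun m => (m.choose k : ℝ)) q j
  have hm : MeasurableSet (quad q ⁻¹' {j}) :=
    (measurable_quad.comp (measurable_const.prodMk measurable_id)) (measurableSet_singleton j)
  induction n generalizing k with
  | zero =>
    rw [EE_zero]
    rcases k with _ | k <;> simp [subList, inQuad]
  | succ n ih =>
    rcases k with _ | k
    · simp [EE_const]
    · rw [EE_succ (good _)]
      have e : ∀ p, EE n (fun l => ((subList q j (p :: l)).length.choose (k + 1) : ℝ))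
          = n.choose (k + 1) * qarea q j ^ (k + 1)
            + (quad q ⁻¹' {j}).indicator (fun _ => n.choose k * qarea q j ^ k) p := by
        intro p
        by_cases hp : quad q p = j
        · rw [indicator_of_mem (show p ∈ quad q ⁻¹' {j} from hp), ← ih, ← ih,
            ← EE_add (good _) (good _)]
          refine EE_congr fun l _ => ?_
          rw [subList_cons, if_pos hp, List.length_cons, Nat.choose_succ_succ]
          push_cast; ring
        · rw [indicator_of_notMem (show p ∉ quad q ⁻¹' {j} from hp), add_zero, ← ih]
          refine EE_congr fun l _ => ?_
          rw [subList_cons, if_neg hp]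
      simp only [e]
      rw [integral_add (integrable_const _) ((integrable_const _).indicator hm),
        integral_indicator hm]
      have := integral_quad_qscale (𝕜 := ℝ) q j (f := fun _ => n.choose k * qarea q j ^ k)
        measurable_const
      rw [this, Nat.choose_succ_succ]
      simp
      ring

/-- The side length of the `j`-th quadrant in the first direction. -/
def qwidth (q : I × I) (j : Fin 4) : ℝ := if j = 0 ∨ j = 1 then (q.1 : ℝ) else 1 - q.1

/-- A uniform location, given that its line meets the `j`-th quadrant, has a uniform relative
position there. -/
theorem integral_qhit_mul_qpos (q : I × I) (j : Fin 4) {g : I → ℝ} (hg : Measurable g) :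
    ∫ s, qhit q s j * g (qpos q s j) = qwidth q j * ∫ s, g s := by
  have hl : ∫ s, (if s < q.1 then (1 : ℝ) else 0) * g (leftPos q.1 s) = q.1 * ∫ s, g s := by
    have hm : Measurable (leftPos q.1) :=
      measurable_leftPos.comp (measurable_const.prodMk measurable_id)
    have e : (fun s => (if s < q.1 then (1 : ℝ) else 0) * g (leftPos q.1 s))
        = (Iio q.1).indicator fun s => g (leftPos q.1 s) := by
      funext s
      by_cases h : s < q.1 <;> simp [indicator, h]
    rw [e, integral_indicator measurableSet_Iio, ← integral_map (f := g) hm.aemeasurable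
      hg.aestronglyMeasurable, map_leftPos_restrict, integral_smul_measure,
      ENNReal.toReal_ofReal q.1.2.1, smul_eq_mul]
  have hr : ∫ s, (if s < q.1 then (0 : ℝ) else 1) * g (rightPos q.1 s) = (1 - q.1) * ∫ s, g s := by
    have hm : Measurable (rightPos q.1) :=
      measurable_rightPos.comp (measurable_const.prodMk measurable_id)
    have e : (fun s => (if s < q.1 then (0 : ℝ) else 1) * g (rightPos q.1 s))
        = (Ici q.1).indicator fun s => g (rightPos q.1 s) := by
      funext s
      by_cases h : s < q.1 <;> simp [indicator, h]
    rw [e, integral_indicator measurableSet_Ici, ← integral_map (f := g) hm.aemeasurable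
      hg.aestronglyMeasurable, map_rightPos_restrict, integral_smul_measure,
      ENNReal.toReal_ofReal (sub_nonneg.2 q.1.2.2), smul_eq_mul]
  fin_cases j
  · simpa [qhit, qpos, qwidth] using hl
  · simpa [qhit, qpos, qwidth] using hl
  · simpa [qhit, qpos, qwidth] using hr
  · simpa [qhit, qpos, qwidth] using hr

theorem measurable_qwidth (j : Fin 4) : Measurable fun q : I × I => qwidth q j := by
  unfold qwidth
  split_ifs
  · exact measurable_subtype_coe.comp measurable_fst
  · exact measurable_const.sub (measurable_subtype_coe.comp measurable_fst)

theorem qwidth_nonneg (q : I × I) (j : Fin 4) : 0 ≤ qwidth q j := by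
  unfold qwidth
  split_ifs
  · exact q.1.2.1
  · exact sub_nonneg.2 q.1.2.2

theorem qwidth_le_one (q : I × I) (j : Fin 4) : qwidth q j ≤ 1 := by
  unfold qwidth
  split_ifs
  · exact q.1.2.2
  · linarith [q.1.2.1]

theorem integral_qwidth_mul_qarea_pow (j : Fin 4) (k : ℕ) :
    ∫ q : I × I, qwidth q j * qarea q j ^ k = 1 / ((k + 1) * (k + 2)) := by
  have h := integral_mul_qarea_rpow (fun x => if j = 0 ∨ j = 1 then (x : ℝ) else 1 - x)
    (Nat.cast_nonneg k) j
  simp only [Real.rpow_natCast, ← pow_succ'] at h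
  change ∫ q : I × I, qwidth q j * qarea q j ^ k = _ at h
  rw [h]
  have h1 := integral_rpow_unitInterval (Nat.cast_nonneg (k + 1))
  have h2 := integral_one_sub_rpow_unitInterval (Nat.cast_nonneg (k + 1))
  simp only [Real.rpow_natCast] at h1 h2
  split_ifs
  · rw [h1]; push_cast; rw [div_mul_div_comm]; ring_nf
  · rw [h2]; push_cast; rw [div_mul_div_comm]; ring_nf

/-- The expected cost of a query at an independent uniform location. -/
def avgCost (n : ℕ) : ℝ := ∫ s, meanCost n s

theorem avgCost_nonneg (n : ℕ) : 0 ≤ avgCost n := integral_nonneg fun s => meanCost_nonneg n s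

/-- A uniform location falls into a given side with probability equal to its width, and is
uniform there; so the average cost satisfies a recursion of its own. -/
theorem avgCost_succ (n : ℕ) : avgCost (n + 1) = 1 + ∑ j, ∫ q : I × I, qwidth q j *
    EE n fun l => avgCost (subList q j l).length := by
  have hbd : ∀ (q : I × I) j (l : List (I × I)) (k : ℕ), l.length ≤ k → ∀ s,
      |meanCost (subList q j l).length s| ≤ k := fun q j l k hl s => by
    refine (abs_meanCost_le _ _).trans ?_
    rw [_root_.subList, List.length_map]
    exact_mod_cast (length_inQuad_le q j l).trans hl
  -- the joint functional of the splitting point and the location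
  have hgood : ∀ j, GoodFam fun (p : (I × I) × I) (l : List (I × I)) => qhit p.1 p.2 j *
      meanCost (subList p.1 j l).length (qpos p.1 p.2 j) := fun j =>
    (GoodFam.of_param (measurable_qhit j) (C := 1) fun p => by
      rw [Real.norm_of_nonneg (qhit_nonneg _ _ _)]; exact qhit_le_one _ _ _).mul
      (goodFam_meanCost j)
  have hm : ∀ j, Measurable fun p : (I × I) × I => EE n fun l => qhit p.1 p.2 j *
      meanCost (subList p.1 j l).length (qpos p.1 p.2 j) := fun j => (hgood j).measurable_EE n
  have hb : ∀ j (p : (I × I) × I), |EE n fun l => qhit p.1 p.2 j *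
      meanCost (subList p.1 j l).length (qpos p.1 p.2 j)| ≤ n := fun j p => by
    refine abs_EE_le fun l hl => ?_
    rw [abs_mul, abs_of_nonneg (qhit_nonneg _ _ _)]
    exact (mul_le_of_le_one_left (abs_nonneg _) (qhit_le_one _ _ _)).trans (hbd _ _ _ _ hl.le _)
  have hpair : ∀ s : I, Measurable fun q : I × I => (q, s) := fun s =>
    measurable_id.prodMk measurable_const
  have hi : ∀ j, Integrable (fun p : I × (I × I) => EE n fun l => qhit p.2 p.1 j *
      meanCost (subList p.2 j l).length (qpos p.2 p.1 j)) := fun j =>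
    integrable_of_bdd ((hm j).comp measurable_swap) n fun p => hb j p.swap
  have hi' : ∀ j, Integrable fun s : I => ∫ q : I × I, EE n fun l => qhit q s j *
      meanCost (subList q j l).length (qpos q s j) := fun j => (hi j).integral_prod_left
  have e1 : ∀ s, meanCost (n + 1) s = 1 + ∑ j, ∫ q : I × I, EE n fun l => qhit q s j *
      meanCost (subList q j l).length (qpos q s j) := by
    intro s
    rw [meanCost_succ, ← integral_finsetSum]
    · simp only [EE_const_mul]
    · exact fun j _ => integrable_of_bdd ((hm j).comp (hpair s)) n fun q => hb j (q, s)
  rw [avgCost]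
  simp only [e1]
  rw [integral_add (integrable_const _) (integrable_finsetSum _ fun j _ => hi' j),
    integral_finsetSum _ fun j _ => hi' j]
  simp only [integral_const, probReal_univ, one_smul]
  congr 1
  refine Finset.sum_congr rfl fun j _ => ?_
  rw [integral_integral_swap (hi j)]
  refine integral_congr_ae (ae_of_all _ fun q => ?_)
  have hg : GoodFam fun (s : I) (l : List (I × I)) => qhit q s j *
      meanCost (subList q j l).length (qpos q s j) :=
    (hgood j).comp (f := fun s => (q, s)) (measurable_const.prodMk measurable_id)
  change ∫ s, EE n (fun l => qhit q s j * meanCost (subList q j l).length (qpos q s j)) = _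
  rw [integral_EE_swap hg]
  refine Eq.trans ?_ (EE_const_mul (qwidth q j) _)
  exact EE_congr fun l _ => integral_qhit_mul_qpos q j (measurable_meanCost _)

theorem avgCost_zero : avgCost 0 = 0 := by simp [avgCost, meanCost_zero]

/-- The recursion for the average cost in terms of its Newton coefficients. -/
theorem avgCost_succ_newton {c : ℕ → ℝ} (N : ℕ)
    (hc : ∀ n ≤ N, avgCost n = ∑ k ∈ Finset.range (N + 1), (n.choose k : ℝ) * c k) (n : ℕ) (hn : n ≤ N) :
    ((n : ℝ) + 1) * (n + 2) * (avgCost (n + 1) - 1)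
      = 4 * ∑ k ∈ Finset.range (N + 1), ((n + 2).choose (k + 2) : ℝ) * c k := by
  have e : ∀ j, ∫ q : I × I, qwidth q j * EE n (fun l => avgCost (subList q j l).length)
      = ∑ k ∈ Finset.range (N + 1), (n.choose k : ℝ) * c k * (1 / ((k + 1) * (k + 2))) := by
    intro j
    have e1 : ∀ q, EE n (fun l => avgCost (subList q j l).length)
        = ∑ k ∈ Finset.range (N + 1), c k * (n.choose k * qarea q j ^ k) := by
      intro q
      have good : ∀ k, GoodFun fun l => ((subList q j l).length.choose k : ℝ) := fun k =>
        GoodFun.subList (G := fun l => (l.length.choose k : ℝ))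
          (GoodFun.of_length fun m => (m.choose k : ℝ)) q j
      simp only [← EE_choose, ← EE_const_mul]
      rw [← EE_sum _ fun k _ => (good k).const_mul _]
      refine EE_congr fun l hl => ?_
      rw [hc]
      · exact Finset.sum_congr rfl fun k _ => mul_comm _ _
      · rw [_root_.subList, List.length_map]
        exact ((length_inQuad_le q j l).trans hl.le).trans hn
    simp only [e1, Finset.mul_sum]
    rw [integral_finsetSum]
    · refine Finset.sum_congr rfl fun k _ => ?_
      rw [← integral_qwidth_mul_qarea_pow j k, ← integral_const_mul]
      exact integral_congr_ae (ae_of_all _ fun q => by ring)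
    · intro k _
      refine integrable_of_bdd ((measurable_qwidth j).mul
        (((measurable_qarea j).pow_const k).const_mul _ |>.const_mul _)) (|c k * n.choose k|) fun q => ?_
      rw [abs_mul, abs_of_nonneg (qwidth_nonneg _ _), ← mul_assoc, abs_mul,
        abs_of_nonneg (pow_nonneg (qarea_nonneg _ _) _)]
      exact (mul_le_of_le_one_left (by positivity [qarea_nonneg q j]) (qwidth_le_one _ _)).trans
        (mul_le_of_le_one_right (abs_nonneg _)
          (pow_le_one₀ (qarea_nonneg _ _) (qarea_le_one _ _)))
  rw [avgCost_succ]
  simp only [e, Finset.sum_const, Finset.card_univ, Fintype.card_fin]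
  rw [add_sub_cancel_left, nsmul_eq_mul, Finset.mul_sum, Finset.mul_sum, Finset.mul_sum]
  refine Finset.sum_congr rfl fun k _ => ?_
  have h1 := Nat.add_one_mul_choose_eq n k
  have h2 := Nat.add_one_mul_choose_eq (n + 1) (k + 1)
  have h3 : ((n : ℝ) + 1) * (n + 2) * n.choose k
      = (n + 2).choose (k + 2) * ((k + 1) * (k + 2)) := by
    have h1' : ((n : ℝ) + 1) * n.choose k = (n + 1).choose (k + 1) * (k + 1) := by exact_mod_cast h1
    have h2' : ((n : ℝ) + 1 + 1) * (n + 1).choose (k + 1)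
        = (n + 2).choose (k + 2) * (k + 1 + 1) := by exact_mod_cast h2
    linear_combination ((n : ℝ) + 2) * h1' + (k + 1) * h2'
  have h4 : ((k : ℝ) + 1) * (k + 2) ≠ 0 := by positivity
  field_simp
  push_cast
  linear_combination (4 * c k) * h3

/-- The Newton coefficients of the average cost are eliminated by taking second differences in
the recursion, which leaves a linear recurrence of second order. -/
theorem tendsto_avgCost : Tendsto (fun n : ℕ => avgCost n / (n : ℝ) ^ qβ) atTop
    (𝓝 (Real.Gamma (2 * qβ + 2) / (2 * Real.Gamma (qβ + 1) ^ 3))) := by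
  set c : ℕ → ℝ := fun k => (fwdDiff 1)^[k] avgCost 0 with hcdef
  have hc : ∀ N n, n ≤ N → avgCost n = ∑ k ∈ Finset.range (N + 1), (n.choose k : ℝ) * c k := by
    intro N n hn
    have h := shift_eq_sum_fwdDiff_iter 1 avgCost n 0
    simp only [smul_eq_mul, mul_one, zero_add, nsmul_eq_mul] at h
    rw [h]
    refine Finset.sum_subset (Finset.range_mono (by omega)) fun k _ hk => ?_
    rw [Nat.choose_eq_zero_of_lt (by simpa using hk)]
    simp
  have h1 : avgCost 1 = 1 := by
    have h := avgCost_succ_newton 0 (hc 0) 0 le_rfl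
    have h0 := hc 0 0 le_rfl
    rw [avgCost_zero] at h0
    simp at h h0
    rw [← h0] at h
    linarith
  have h2 : avgCost 2 = 5 / 3 := by
    have h := avgCost_succ_newton 1 (hc 1) 1 le_rfl
    have h0 := hc 1 0 (by norm_num)
    have h0' := hc 1 1 (by norm_num)
    rw [avgCost_zero] at h0
    rw [h1] at h0'
    simp [Finset.sum_range_succ] at h h0 h0'
    rw [← h0] at h h0'
    norm_num at h h0'
    rw [← h0'] at h
    linarith
  refine tendsto_of_recurrence avgCost_zero h1 h2 fun n => ?_
  have r1 := avgCost_succ_newton (n + 2) (hc (n + 2)) (n + 2) le_rfl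
  have r2 := avgCost_succ_newton (n + 2) (hc (n + 2)) (n + 1) (by omega)
  have r3 := avgCost_succ_newton (n + 2) (hc (n + 2)) n (by omega)
  have r4 := hc (n + 2) (n + 2) le_rfl
  have e : ∑ k ∈ Finset.range (n + 2 + 1), ((n + 2 + 2).choose (k + 2) : ℝ) * c k
      - 2 * ∑ k ∈ Finset.range (n + 2 + 1), ((n + 1 + 2).choose (k + 2) : ℝ) * c k
      + ∑ k ∈ Finset.range (n + 2 + 1), ((n + 2).choose (k + 2) : ℝ) * c k
      = ∑ k ∈ Finset.range (n + 2 + 1), ((n + 2).choose k : ℝ) * c k := by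
    rw [Finset.mul_sum, ← Finset.sum_sub_distrib, ← Finset.sum_add_distrib]
    refine Finset.sum_congr rfl fun k _ => ?_
    rw [show n + 2 + 2 = (n + 3) + 1 by ring, show n + 1 + 2 = (n + 2) + 1 by ring,
      show n + 3 = (n + 2) + 1 by ring]
    simp only [Nat.choose_succ_succ' _ (k + 1), Nat.choose_succ_succ' _ k]
    push_cast
    ring
  push_cast at r1 r2 r3
  change _ * (avgCost (n + 3) - 1) = _ at r1
  change _ * (avgCost (n + 2) - 1) = _ at r2
  linear_combination r1 - 2 * r2 + r3 + 4 * e - 4 * r4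

/-! ### Change of variables in the mean operator -/

theorem integral_ite_lt (F : ℝ → ℝ) (s : I) :
    ∫ x : I, (if s < x then F x else 0) = ∫ t in Ioo (s : ℝ) 1, F t := by
  have h := integral_unitInterval fun t => (Ioi (s : ℝ)).indicator F t
  rw [intervalIntegral.integral_of_le zero_le_one, integral_Ioc_eq_integral_Ioo,
    setIntegral_indicator measurableSet_Ioi] at h
  have hset : Ioo (0 : ℝ) 1 ∩ Ioi (s : ℝ) = Ioo (s : ℝ) 1 := by
    ext t
    have := s.2.1
    simp only [mem_inter_iff, mem_Ioo, mem_Ioi]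
    constructor
    · rintro ⟨⟨-, h1⟩, h2⟩; exact ⟨h2, h1⟩
    · rintro ⟨h1, h2⟩; exact ⟨⟨by linarith, h2⟩, h1⟩
  rw [hset] at h
  rw [← h]
  refine integral_congr_ae (ae_of_all _ fun x => ?_)
  by_cases hx : s < x
  · simp [indicator, hx]
  · simp [indicator, hx]

/-- The substitution `u = s / x`. -/
theorem integral_leftPos {s : I} (hs : 0 < s) (φ : ℝ → ℝ) (g : I → ℝ) :
    ∫ x : I, (if s < x then φ x * g (leftPos x s) else 0)
      = ∫ u : I, (if s < u then φ (s / u) * (s / (u : ℝ) ^ 2) * g u else 0) := by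
  have hs0 : (0 : ℝ) < s := hs
  set G : ℝ → ℝ := fun t => g (projIcc 0 1 zero_le_one t) with hG
  have e1 := integral_ite_lt (fun t => φ t * G (s / t)) s
  have e2 := integral_ite_lt (fun u => φ (s / u) * (s / u ^ 2) * G u) s
  have hGu : ∀ u : I, G u = g u := fun u => by rw [hG]; simp
  simp only [hGu] at e2
  rw [e2]
  refine Eq.trans e1 ?_
  have himg : (fun u : ℝ => (s : ℝ) / u) '' Ioo (s : ℝ) 1 = Ioo (s : ℝ) 1 := by
    ext t
    simp only [mem_image, mem_Ioo]
    constructor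
    · rintro ⟨u, ⟨h1, h2⟩, rfl⟩
      have hu : 0 < u := hs0.trans h1
      exact ⟨by rw [lt_div_iff₀ hu]; nlinarith, by rw [div_lt_one hu]; exact h1⟩
    · rintro ⟨h1, h2⟩
      have ht : 0 < t := hs0.trans h1
      refine ⟨s / t, ⟨by rw [lt_div_iff₀ ht]; nlinarith, by rw [div_lt_one ht]; exact h1⟩, ?_⟩
      field_simp
  have hinj : InjOn (fun u : ℝ => (s : ℝ) / u) (Ioo (s : ℝ) 1) := by
    intro u hu v hv h
    have hu0 : u ≠ 0 := (hs0.trans hu.1).ne'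
    have hv0 : v ≠ 0 := (hs0.trans hv.1).ne'
    simp only at h
    rw [div_eq_div_iff hu0 hv0] at h
    exact (mul_left_cancel₀ hs0.ne' h).symm
  have hder : ∀ u ∈ Ioo (s : ℝ) 1, HasDerivWithinAt (fun u : ℝ => (s : ℝ) / u)
      (-(s / u ^ 2)) (Ioo (s : ℝ) 1) u := by
    intro u hu
    have hu0 : u ≠ 0 := (hs0.trans hu.1).ne'
    have := ((hasDerivAt_inv hu0).const_mul (s : ℝ)).hasDerivWithinAt (s := Ioo (s : ℝ) 1)
    simpa [div_eq_mul_inv] using this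
  have h := integral_image_eq_integral_abs_deriv_smul measurableSet_Ioo hder hinj
    (fun t => φ t * G (s / t))
  rw [himg] at h
  rw [h]
  refine setIntegral_congr_fun measurableSet_Ioo fun u hu => ?_
  have hu0 : 0 < u := hs0.trans hu.1
  simp only [abs_neg, smul_eq_mul]
  rw [abs_of_pos (by positivity), show (s : ℝ) / (s / u) = u by field_simp]
  ring

/-- The reflection of the unit interval exchanges the two sides of the splitting point. -/
theorem integral_rightPos {s : I} (hs : s < 1) (φ : ℝ → ℝ) (g : I → ℝ) :
    ∫ x : I, (if s < x then 0 else φ (1 - x) * g (rightPos x s))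
      = ∫ x : I, (if unitInterval.symm s < x then
          φ x * g (unitInterval.symm (leftPos x (unitInterval.symm s))) else 0) := by
  have hs1 : (s : ℝ) < 1 := hs
  rw [← integral_unitInterval_symm]
  have hne : ∀ᵐ x : I, x ≠ unitInterval.symm s := by simp [ae_iff]
  refine integral_congr_ae (hne.mono fun x hx => ?_)
  have hx' : (x : ℝ) ≠ 1 - s := fun h => hx (Subtype.ext (by simpa using h))
  simp only [← Subtype.coe_lt_coe, unitInterval.coe_symm_eq, sub_sub_cancel]
  by_cases h : (s : ℝ) < 1 - x
  · rw [if_pos h, if_neg (by linarith)]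
  · have h2 : 1 - (s : ℝ) < x := lt_of_le_of_ne (by linarith) hx'.symm
    rw [if_neg h, if_pos h2]
    congr 2
    have hx0 : (x : ℝ) ≠ 0 := by linarith
    apply Subtype.ext
    have h3 : unitInterval.symm s < x := by rw [← Subtype.coe_lt_coe]; simpa using h2
    have h4 : unitInterval.symm x ≤ s := by
      rw [← Subtype.coe_le_coe, unitInterval.coe_symm_eq]; linarith
    rw [coe_rightPos h4, unitInterval.coe_symm_eq, unitInterval.coe_symm_eq, coe_leftPos h3]
    simp only [unitInterval.coe_symm_eq, sub_sub_cancel]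
    field_simp
    ring

/-- The density of the relative position `s / x` is bounded, uniformly for `s` away from zero. -/
theorem integral_leftPos_le {s : I} (hs : 0 < s) {g : I → ℝ} (hg : ∀ u, 0 ≤ g u)
    (hi : Integrable g) :
    ∫ x : I, (if s < x then g (leftPos x s) else 0) ≤ 1 / s * ∫ u, g u := by
  have hs0 : (0 : ℝ) < s := hs
  have h := integral_leftPos hs (fun _ => 1) g
  simp only [one_mul] at h
  rw [h, ← integral_const_mul]
  refine integral_mono_of_nonneg (ae_of_all _ fun u => ?_) (hi.const_mul _)
    (ae_of_all _ fun u => ?_)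
  · simp only [Pi.zero_apply]
    split_ifs
    · exact mul_nonneg (by positivity) (hg u)
    · exact le_rfl
  · simp only
    split_ifs with hu
    · have hu0 : (s : ℝ) < u := hu
      refine mul_le_mul_of_nonneg_right ?_ (hg u)
      rw [div_le_div_iff₀ (by nlinarith) hs0]
      nlinarith
    · exact mul_nonneg (by positivity) (hg u)

theorem integrable_comp_symm {g : I → ℝ} (hi : Integrable g) :
    Integrable fun u => g (unitInterval.symm u) :=
  (unitInterval.measurePreserving_symm.integrable_comp_emb
    unitInterval.symmMeasurableEquiv.measurableEmbedding).2 hi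

theorem integral_rightPos_le {s : I} (hs : s < 1) {g : I → ℝ} (hg : ∀ u, 0 ≤ g u)
    (hi : Integrable g) :
    ∫ x : I, (if s < x then 0 else g (rightPos x s)) ≤ 1 / (1 - s) * ∫ u, g u := by
  have h := integral_rightPos hs (fun _ => 1) g
  simp only [one_mul] at h
  have hs' : 0 < unitInterval.symm s := by
    rw [← Subtype.coe_lt_coe]; simpa using hs
  have h2 := integral_leftPos_le hs' (g := fun u => g (unitInterval.symm u)) (fun u => hg _)
    (integrable_comp_symm hi)
  rw [integral_unitInterval_symm, unitInterval.coe_symm_eq] at h2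
  rw [h]
  exact h2

/-- The kernel of the recursion is bounded away from the boundary of the interval, so pointwise
values are controlled by averages. -/
theorem integral_sum_qhit_mul_le {s : I} (h0 : 0 < s) (h1 : s < 1) {g : I → ℝ} (hg : ∀ u, 0 ≤ g u)
    (hm : Measurable g) {C : ℝ} (hC : ∀ u, |g u| ≤ C) :
    ∫ q : I × I, ∑ j, qhit q s j * g (qpos q s j)
      ≤ 2 * (1 / s + 1 / (1 - s)) * ∫ u, g u := by
  have hi : Integrable g := integrable_of_bdd hm C hC
  have hij : ∀ j, Integrable fun q : I × I => qhit q s j * g (qpos q s j) := by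
    intro j
    have hp : Measurable fun q : I × I => (q, s) := measurable_id.prodMk measurable_const
    refine integrable_of_bdd (((measurable_qhit j).comp hp).mul
      (hm.comp ((measurable_qpos j).comp hp))) C fun q => ?_
    rw [abs_mul, abs_of_nonneg (qhit_nonneg _ _ _)]
    exact (mul_le_of_le_one_left (abs_nonneg _) (qhit_le_one _ _ _)).trans (hC _)
  rw [integral_finsetSum _ fun j _ => hij j, Fin.sum_univ_four]
  have hfst : ∀ f : I → ℝ, ∫ q : I × I, f q.1 = ∫ x, f x := fun f => by
    have := integral_mul_qarea_rpow f le_rfl 0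
    simpa using this
  have hl : ∀ j : Fin 4, j = 0 ∨ j = 1 → ∫ q : I × I, qhit q s j * g (qpos q s j)
      ≤ 1 / s * ∫ u, g u := by
    intro j hj
    refine le_trans (le_of_eq ?_) (integral_leftPos_le h0 hg hi)
    rw [← hfst]
    refine integral_congr_ae (ae_of_all _ fun q => ?_)
    rcases hj with rfl | rfl <;> by_cases h : s < q.1 <;> simp [qhit, qpos, h]
  have hr : ∀ j : Fin 4, j = 2 ∨ j = 3 → ∫ q : I × I, qhit q s j * g (qpos q s j)
      ≤ 1 / (1 - s) * ∫ u, g u := by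
    intro j hj
    refine le_trans (le_of_eq ?_) (integral_rightPos_le h1 hg hi)
    rw [← hfst]
    refine integral_congr_ae (ae_of_all _ fun q => ?_)
    rcases hj with rfl | rfl <;> by_cases h : s < q.1 <;> simp [qhit, qpos, h]
  linarith [hl 0 (by simp), hl 1 (by simp), hr 2 (by simp), hr 3 (by simp)]

/-- The total weight of the quadrants met by the line at `s`. Near the boundary of the interval
essentially only the two quadrants on one side count, and the weight is smaller than `1`. -/
theorem sum_integral_qhit_mul_qarea_le_min (s : I) :
    ∑ j, ∫ q : I × I, qhit q s j * qarea q j ^ qβ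
      ≤ 2 / (qβ + 1) ^ 2 + 2 / (qβ + 1) * min (s : ℝ) (1 - s) := by
  have hb := qβ_pos
  have hle := fun j => integral_qhit_mul_qarea_le s j hb.le
  have hs0 := s.2.1
  have hs1 := s.2.2
  have hl : ∀ j : Fin 4, j = 0 ∨ j = 1 → ∫ q : I × I, qhit q s j * qarea q j ^ qβ
      ≤ (1 - s) * (1 / (qβ + 1)) := by
    intro j hj
    have h := integral_mul_qarea_rpow (fun x => if s < x then 1 else 0) hb.le j
    have e : ∫ q : I × I, qhit q s j * qarea q j ^ qβ
        = ∫ q : I × I, (if s < q.1 then 1 else 0) * qarea q j ^ qβ := by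
      rcases hj with rfl | rfl <;> rfl
    rw [e, h]
    refine mul_le_mul_of_nonneg_right ?_ (by positivity)
    have h2 : ∫ x : I, (if s < x then (1 : ℝ) else 0) = 1 - s := by
      rw [integral_ite_lt (fun _ => 1)]
      simp [hs1]
    rw [← h2]
    refine integral_mono_of_nonneg (ae_of_all _ fun x => ?_) ?_ (ae_of_all _ fun x => ?_)
    · simp only [Pi.zero_apply, hj, if_true]
      split_ifs
      · exact mul_nonneg zero_le_one (Real.rpow_nonneg x.2.1 _)
      · simp
    · refine integrable_of_bdd (Measurable.ite measurableSet_Ioi measurable_const measurable_const)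
        1 fun x => ?_
      split_ifs <;> simp
    · simp only [hj, if_true]
      split_ifs
      · simpa using Real.rpow_le_one x.2.1 x.2.2 hb.le
      · simp
  have hr : ∀ j : Fin 4, j = 2 ∨ j = 3 → ∫ q : I × I, qhit q s j * qarea q j ^ qβ
      ≤ s * (1 / (qβ + 1)) := by
    intro j hj
    have h := integral_mul_qarea_rpow (fun x => if s < x then 0 else 1) hb.le j
    have e : ∫ q : I × I, qhit q s j * qarea q j ^ qβ
        = ∫ q : I × I, (if s < q.1 then 0 else 1) * qarea q j ^ qβ := by
      rcases hj with rfl | rfl <;> rfl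
    have hj' : ¬ (j = 0 ∨ j = 1) := by rcases hj with rfl | rfl <;> simp
    rw [e, h]
    refine mul_le_mul_of_nonneg_right ?_ (by positivity)
    have hint : Integrable fun x : I => if s < x then (1 : ℝ) else 0 :=
      integrable_of_bdd (Measurable.ite measurableSet_Ioi measurable_const measurable_const)
        1 fun x => by split_ifs <;> simp
    have h2 : ∫ x : I, (if s < x then (0 : ℝ) else 1) = s := by
      have e : ∀ x : I, (if s < x then (0 : ℝ) else 1) = 1 - if s < x then (1 : ℝ) else 0 := by
        intro x; split_ifs <;> simp
      simp only [e]
      rw [integral_sub (integrable_const _) hint, integral_ite_lt (fun _ => 1)]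
      simp [hs1]
    conv_rhs => rw [← h2]
    refine integral_mono_of_nonneg (ae_of_all _ fun x => ?_) ?_ (ae_of_all _ fun x => ?_)
    · simp only [Pi.zero_apply, hj', if_false]
      split_ifs
      · simp
      · exact mul_nonneg zero_le_one (Real.rpow_nonneg (sub_nonneg.2 x.2.2) _)
    · refine integrable_of_bdd (Measurable.ite measurableSet_Ioi measurable_const measurable_const)
        1 fun x => ?_
      split_ifs <;> simp
    · simp only [hj', if_false]
      split_ifs
      · simp
      · simpa using Real.rpow_le_one (sub_nonneg.2 x.2.2) (by linarith [x.2.1]) hb.le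
  rw [Fin.sum_univ_four]
  have e1 : 2 / (qβ + 1) ^ 2 = 2 * (1 / (qβ + 1) ^ 2) := by ring
  have e2 : ∀ m, 2 / (qβ + 1) * m = 2 * (m * (1 / (qβ + 1))) := fun m => by ring
  rw [e1, e2]
  rcases min_choice (s : ℝ) (1 - s) with h | h <;> rw [h]
  · linarith [hle 0, hle 1, hr 2 (by simp), hr 3 (by simp)]
  · linarith [hle 2, hle 3, hl 0 (by simp), hl 1 (by simp)]

/-! ### Moments of the numbers of points in the quadrants -/

theorem EE_length (q : I × I) (j : Fin 4) (n : ℕ) :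
    EE n (fun l => ((subList q j l).length : ℝ)) = n * qarea q j := by
  have := EE_choose q j n 1
  simpa using this

theorem goodFun_length_subList (q : I × I) (j : Fin 4) (g : ℕ → ℝ) :
    GoodFun fun l => g (subList q j l).length :=
  GoodFun.subList (G := fun l => g l.length) (GoodFun.of_length g) q j

theorem EE_length_sq_le (q : I × I) (j : Fin 4) (n : ℕ) :
    EE n (fun l => ((subList q j l).length : ℝ) ^ 2) ≤ (n * qarea q j) ^ 2 + n * qarea q j := by
  have h1 := EE_choose q j n 2
  have h2 := EE_length q j n
  have e : EE n (fun l => ((subList q j l).length : ℝ) ^ 2)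
      = 2 * (n.choose 2 * qarea q j ^ 2) + n * qarea q j := by
    rw [← h1, ← h2, ← EE_const_mul, ← EE_add
      ((goodFun_length_subList q j fun m => (m.choose 2 : ℝ)).const_mul 2)
      (goodFun_length_subList q j fun m => (m : ℝ))]
    refine EE_congr fun l _ => ?_
    rw [Nat.cast_choose_two]
    ring
  rw [e, Nat.cast_choose_two]
  have := sq_nonneg (qarea q j)
  have hn : (0 : ℝ) ≤ n := Nat.cast_nonneg n
  nlinarith [mul_nonneg hn this]

/-- Jensen's inequality for the concave powers. -/
theorem EE_rpow_le {n : ℕ} {g : ℕ → ℝ} (hg : ∀ k, 0 ≤ g k) (q : I × I) (j : Fin 4) {κ c : ℝ}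
    (h0 : 0 ≤ κ) (h1 : κ ≤ 1) (hc : 0 < c)
    (h : EE n (fun l => g (subList q j l).length) ≤ c) :
    EE n (fun l => g (subList q j l).length ^ κ) ≤ c ^ κ := by
  have hgood := goodFun_length_subList q j g
  -- the tangent line at `c`
  have tangent : ∀ x, 0 ≤ x → x ^ κ ≤ c ^ κ * (1 - κ) + c ^ κ * κ / c * x := by
    intro x hx
    have hb := rpow_one_add_le_one_add_mul_self (s := x / c - 1) (p := κ)
      (by have := div_nonneg hx hc.le; linarith) h0 h1
    rw [add_sub_cancel, Real.div_rpow hx hc.le, div_le_iff₀ (by positivity)] at hb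
    calc x ^ κ ≤ (1 + κ * (x / c - 1)) * c ^ κ := hb
      _ = _ := by field_simp; ring
  calc EE n (fun l => g (subList q j l).length ^ κ)
      ≤ EE n (fun l => c ^ κ * (1 - κ) + c ^ κ * κ / c * g (subList q j l).length) :=
        EE_mono (goodFun_length_subList q j fun m => g m ^ κ)
          (GoodFam.add (GoodFun.of_length fun _ => c ^ κ * (1 - κ)) (hgood.const_mul _))
          fun l _ => tangent _ (hg _)
    _ = c ^ κ * (1 - κ) + c ^ κ * κ / c * EE n (fun l => g (subList q j l).length) := by
        rw [EE_add (GoodFun.of_length fun _ => c ^ κ * (1 - κ)) (hgood.const_mul _), EE_const,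
          EE_const_mul]
    _ ≤ c ^ κ * (1 - κ) + c ^ κ * κ / c * c := by
        have : 0 ≤ c ^ κ * κ / c := by positivity
        gcongr
    _ = c ^ κ := by field_simp; ring

theorem Interior.qarea_pos {q : I × I} (hq : Interior q) (j : Fin 4) : 0 < qarea q j := by
  obtain ⟨⟨hx0, hx1⟩, hy0, hy1⟩ := hq
  have h1 : (0 : ℝ) < q.1 := hx0
  have h2 : (0 : ℝ) < 1 - q.1 := sub_pos.2 hx1
  have h3 : (0 : ℝ) < q.2 := hy0
  have h4 : (0 : ℝ) < 1 - q.2 := sub_pos.2 hy1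
  fin_cases j
  · exact mul_pos h1 h3
  · exact mul_pos h1 h4
  · exact mul_pos h2 h3
  · exact mul_pos h2 h4

theorem EE_length_rpow_le {q : I × I} (hq : Interior q) (j : Fin 4) (n : ℕ) :
    EE n (fun l => ((subList q j l).length : ℝ) ^ qβ) ≤ (n : ℝ) ^ qβ * qarea q j ^ qβ := by
  have hb := qβ_pos
  rcases Nat.eq_zero_or_pos n with rfl | hn
  · simp [EE_zero, subList, inQuad, Real.zero_rpow hb.ne']
  · have hn' : (0 : ℝ) < n := by exact_mod_cast hn
    rw [← Real.mul_rpow hn'.le (qarea_nonneg _ _)]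
    exact EE_rpow_le (g := fun k => (k : ℝ)) (fun k => Nat.cast_nonneg k) q j hb.le
      (by linarith [qβ_lt]) (mul_pos hn' (hq.qarea_pos j)) (EE_length q j n).le

/-- The variance of the number of points, which is at most `n`, accounts for the second term. -/
theorem EE_length_rpow_two_mul_le {q : I × I} (hq : Interior q) (j : Fin 4) (n : ℕ) :
    EE n (fun l => ((subList q j l).length : ℝ) ^ (2 * qβ))
      ≤ (n : ℝ) ^ (2 * qβ) * qarea q j ^ (2 * qβ) + (n : ℝ) ^ qβ := by
  have hb := qβ_pos
  have hb1 : qβ ≤ 1 := by linarith [qβ_lt]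
  rcases Nat.eq_zero_or_pos n with rfl | hn
  · have : 2 * qβ ≠ 0 := by positivity
    simp [EE_zero, subList, inQuad, Real.zero_rpow hb.ne', Real.zero_rpow this]
  · have hn' : (0 : ℝ) < n := by exact_mod_cast hn
    have ha := hq.qarea_pos j
    have hna := mul_pos hn' ha
    have e : ∀ k : ℕ, (k : ℝ) ^ (2 * qβ) = ((k : ℝ) ^ 2) ^ qβ := fun k => by
      rw [← Real.rpow_natCast (k : ℝ) 2, ← Real.rpow_mul (Nat.cast_nonneg k)]
      norm_num
    simp only [e]
    refine (EE_rpow_le (g := fun k => (k : ℝ) ^ 2) (fun k => sq_nonneg _) q j hb.le hb1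
      (by positivity) (EE_length_sq_le q j n)).trans ?_
    refine (Real.rpow_add_le_add_rpow (by positivity) (by positivity) hb.le hb1).trans ?_
    refine add_le_add (le_of_eq ?_) ?_
    · rw [mul_pow, Real.mul_rpow (by positivity) (by positivity)]
      congr 1
      rw [← Real.rpow_natCast (qarea q j) 2, ← Real.rpow_mul ha.le]
      norm_num
    · exact Real.rpow_le_rpow hna.le (mul_le_of_le_one_right hn'.le (qarea_le_one _ _)) hb.le

/-! ### Uniform bounds for the moments of the cost -/

/-- Dropping the last point preserves the law of the others. -/
theorem EE_take {𝕜 : Type} [RCLike 𝕜] {G : List (I × I) → 𝕜} (hG : GoodFun G) (n : ℕ) :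
    EE n G = ∫ v : Fin (n + 1) → I × I, G (List.ofFn fun i : Fin n => v i.castSucc) := by
  have mp := measurePreserving_snd (μ := (volume : Measure (I × I)))
    (ν := (volume : Measure (Fin n → I × I))) |>.comp
      (volume_preserving_piFinSuccAbove (fun _ : Fin (n + 1) => I × I) (Fin.last n))
  rw [EE, ← mp.map_eq, integral_map mp.measurable.aemeasurable (hG.meas n).aestronglyMeasurable]
  refine integral_congr_ae (ae_of_all _ fun v => ?_)
  simp only [Function.comp]
  congr 2
  funext i
  simp [MeasurableEquiv.piFinSuccAbove, Fin.init]

theorem listCost_append_singleton_ge (l : List (I × I)) (p : I × I) (s : I) :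
    listCost l s ≤ listCost (l ++ [p]) s := by
  rw [listCost, listCost, QuadTree.ofList, QuadTree.ofList, List.foldl_append]
  exact_mod_cast QuadTree.cost_insert_ge p _ s

/-- Inserting a further point does not decrease the cost. -/
theorem meanCost_mono (s : I) : Monotone fun n => meanCost n s := by
  refine monotone_nat_of_le_succ fun n => ?_
  have hG := goodFun_listCost s
  have hle : ∀ v : Fin (n + 1) → I × I, listCost (List.ofFn fun i : Fin n => v i.castSucc) s
      ≤ listCost (List.ofFn v) s := fun v => by
    rw [List.ofFn_succ_last]
    exact listCost_append_singleton_ge _ _ _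
  rw [meanCost, meanCost, EE_take hG]
  exact integral_mono_of_nonneg (ae_of_all _ fun v => listCost_nonneg _ _) (hG.integrable (n + 1))
    (ae_of_all _ hle)

theorem length_subList_le (q : I × I) (j : Fin 4) (l : List (I × I)) :
    (subList q j l).length ≤ l.length := by
  rw [subList, List.length_map]
  exact length_inQuad_le q j l

theorem exists_avgCost_le : ∃ A, 0 ≤ A ∧ ∀ n : ℕ, avgCost n ≤ A * (n : ℝ) ^ qβ := by
  obtain ⟨A, hA⟩ := tendsto_avgCost.bddAbove_range
  refine ⟨max A 0, le_max_right _ _, fun n => ?_⟩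
  rcases Nat.eq_zero_or_pos n with rfl | hn
  · simp [avgCost_zero, Real.zero_rpow qβ_pos.ne']
  · have hn' : (0 : ℝ) < (n : ℝ) ^ qβ := by positivity
    rw [← div_le_iff₀ hn']
    exact (hA ⟨n, rfl⟩).trans (le_max_left _ _)

/-- The mean cost is of order `n ^ β`, uniformly in the location. Away from the boundary the
bound follows from that of the average cost, near the boundary the recursion contracts. -/
theorem exists_meanCost_le : ∃ M, 0 ≤ M ∧ ∀ (n : ℕ) (s : I), meanCost n s ≤ M * (n : ℝ) ^ qβ := by
  obtain ⟨A, hA0, hA⟩ := exists_avgCost_le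
  have hb := qβ_pos
  have hb' := qβ_gt
  set M : ℝ := 10 + 160 * A with hM
  have hM0 : 0 ≤ M := by positivity
  refine ⟨M, hM0, fun n => ?_⟩
  induction n using Nat.strong_induction_on with
  | _ n ih =>
    rcases n with _ | n
    · intro s; simp [meanCost_zero, Real.zero_rpow hb.ne']
    intro s
    have hpow : (n : ℝ) ^ qβ ≤ ((n + 1 : ℕ) : ℝ) ^ qβ :=
      Real.rpow_le_rpow (Nat.cast_nonneg _) (by push_cast; linarith) hb.le
    have hpow1 : (1 : ℝ) ≤ ((n + 1 : ℕ) : ℝ) ^ qβ :=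
      Real.one_le_rpow (by push_cast; linarith [(Nat.cast_nonneg n : (0 : ℝ) ≤ n)]) hb.le
    have hn0 : (0 : ℝ) ≤ (n : ℝ) ^ qβ := by positivity
    have hpair : Measurable fun q : I × I => (q, s) := measurable_id.prodMk measurable_const
    have hi : ∀ j, Integrable fun q : I × I => qhit q s j *
        EE n fun l => meanCost (subList q j l).length (qpos q s j) := by
      intro j
      refine integrable_of_bdd (((measurable_qhit j).comp hpair).mul
        (((goodFam_meanCost j).comp hpair).measurable_EE n)) n fun q => ?_
      rw [abs_mul, abs_of_nonneg (qhit_nonneg _ _ _)]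
      refine (mul_le_of_le_one_left (abs_nonneg _) (qhit_le_one _ _ _)).trans ?_
      refine abs_EE_le fun l hl => (abs_meanCost_le _ _).trans ?_
      rw [← hl]
      exact_mod_cast length_subList_le q j l
    have hgood : ∀ q j, GoodFun fun l => meanCost (subList q j l).length (qpos q s j) := fun q j =>
      goodFun_length_subList q j fun k => meanCost k (qpos q s j)
    rw [meanCost_succ]
    by_cases hs : (1 : ℝ) / 20 ≤ s ∧ (s : ℝ) ≤ 19 / 20
    -- away from the boundary the recursion is bounded by the average cost
    · have h0 : 0 < s := show (0 : ℝ) < s by linarith [hs.1]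
      have h1 : s < 1 := show (s : ℝ) < 1 by linarith [hs.2]
      have h2 : ∫ q : I × I, ∑ j, qhit q s j *
          EE n (fun l => meanCost (subList q j l).length (qpos q s j))
          ≤ ∫ q : I × I, ∑ j, qhit q s j * meanCost n (qpos q s j) := by
        refine integral_mono (integrable_finsetSum _ fun j _ => hi j)
          (integrable_finsetSum _ fun j _ => ?_) fun q => Finset.sum_le_sum fun j _ => ?_
        · refine integrable_of_bdd (((measurable_qhit j).comp hpair).mul
            ((measurable_meanCost n).comp ((measurable_qpos j).comp hpair))) n fun q => ?_
          rw [abs_mul, abs_of_nonneg (qhit_nonneg _ _ _)]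
          exact (mul_le_of_le_one_left (abs_nonneg _) (qhit_le_one _ _ _)).trans
            (abs_meanCost_le _ _)
        · refine mul_le_mul_of_nonneg_left ?_ (qhit_nonneg _ _ _)
          rw [← EE_const n (meanCost n (qpos q s j))]
          refine EE_mono (hgood q j) (GoodFun.of_length fun _ => meanCost n (qpos q s j))
            fun l hl => meanCost_mono _ ?_
          rw [← hl]
          exact length_subList_le q j l
      have h3 := integral_sum_qhit_mul_le h0 h1 (meanCost_nonneg n) (measurable_meanCost n)
        (abs_meanCost_le n)
      have h4 : 2 * (1 / (s : ℝ) + 1 / (1 - s)) ≤ 80 := by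
        have e1 : 1 / (s : ℝ) ≤ 20 := by
          rw [div_le_iff₀ (by linarith [hs.1])]; linarith [hs.1]
        have e2 : 1 / (1 - (s : ℝ)) ≤ 20 := by
          rw [div_le_iff₀ (by linarith [hs.2])]; linarith [hs.2]
        linarith
      have h5 : 2 * (1 / (s : ℝ) + 1 / (1 - s)) * ∫ u, meanCost n u ≤ 80 * (A * (n : ℝ) ^ qβ) :=
        mul_le_mul h4 (hA n) (avgCost_nonneg n) (by norm_num)
      have h6 : A * (n : ℝ) ^ qβ ≤ A * ((n + 1 : ℕ) : ℝ) ^ qβ := mul_le_mul_of_nonneg_left hpow hA0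
      have h7 : 0 ≤ A * ((n + 1 : ℕ) : ℝ) ^ qβ := by positivity
      rw [hM]
      linarith
    -- near the boundary the induction hypothesis is contracted by `9 / 10`
    · have hmin : min (s : ℝ) (1 - s) ≤ 1 / 20 := by
        by_contra! h
        have := lt_min_iff.1 h
        exact hs ⟨this.1.le, by linarith [this.2]⟩
      have hfac : ∑ j, ∫ q : I × I, qhit q s j * qarea q j ^ qβ ≤ 9 / 10 := by
        refine (sum_integral_qhit_mul_qarea_le_min s).trans ?_
        have e1 : 2 / (qβ + 1) ^ 2 ≤ 0.8204 := by
          rw [div_le_iff₀ (by positivity)]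
          nlinarith
        have e2 : 2 / (qβ + 1) ≤ 1.2809 := by
          rw [div_le_iff₀ (by positivity)]
          nlinarith
        have e3 : 2 / (qβ + 1) * min (s : ℝ) (1 - s) ≤ 1.2809 * (1 / 20) :=
          mul_le_mul e2 hmin (le_min s.2.1 (by linarith [s.2.2])) (by norm_num)
        norm_num at e1 e3 ⊢
        linarith
      have h2 : ∫ q : I × I, ∑ j, qhit q s j *
          EE n (fun l => meanCost (subList q j l).length (qpos q s j))
          ≤ ∫ q : I × I, ∑ j, M * (n : ℝ) ^ qβ * (qhit q s j * qarea q j ^ qβ) := by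
        refine integral_mono_ae (integrable_finsetSum _ fun j _ => hi j)
          (integrable_finsetSum _ fun j _ => (integrable_qhit_mul_qarea s j hb.le).const_mul _)
          (ae_interior.mono fun q hq => Finset.sum_le_sum fun j _ => ?_)
        have h3 : EE n (fun l => meanCost (subList q j l).length (qpos q s j))
            ≤ M * ((n : ℝ) ^ qβ * qarea q j ^ qβ) := by
          refine le_trans ?_ (mul_le_mul_of_nonneg_left (EE_length_rpow_le hq j n) hM0)
          rw [← EE_const_mul]
          refine EE_mono (hgood q j)
            ((goodFun_length_subList q j fun k => (k : ℝ) ^ qβ).const_mul M) fun l hl => ?_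
          exact ih _ (Nat.lt_succ_of_le ((length_subList_le q j l).trans hl.le)) _
        calc _ ≤ qhit q s j * (M * ((n : ℝ) ^ qβ * qarea q j ^ qβ)) :=
              mul_le_mul_of_nonneg_left h3 (qhit_nonneg _ _ _)
          _ = _ := by ring
      rw [integral_finsetSum _ fun j _ => (integrable_qhit_mul_qarea s j hb.le).const_mul _] at h2
      simp only [integral_const_mul] at h2
      rw [← Finset.mul_sum] at h2
      have h3 := mul_le_mul_of_nonneg_left hfac (mul_nonneg hM0 hn0)
      have h4 := mul_le_mul_of_nonneg_left hpow hM0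
      have h5 : 10 ≤ M := by rw [hM]; linarith
      nlinarith

/-- The second moment of the cost of the query at `s` in a tree of `n` uniform points. -/
def sqCost (n : ℕ) (s : I) : ℝ := EE n fun l => listCost l s ^ 2

theorem goodFam_listCost_sq : GoodFam fun (s : I) l => listCost l s ^ 2 := by
  simp only [sq]
  exact goodFam_listCost.mul goodFam_listCost

theorem sqCost_le (n : ℕ) (s : I) : sqCost n s ≤ (n : ℝ) ^ 2 := by
  refine (le_abs_self _).trans (abs_EE_le fun l hl => ?_)
  rw [abs_of_nonneg (sq_nonneg _), ← hl]
  exact pow_le_pow_left₀ (listCost_nonneg l s) (listCost_le_length l s) 2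

theorem EE_subList_mul (q : I × I) {i j : Fin 4} (hij : i ≠ j) (n : ℕ)
    {G K : List (I × I) → ℝ} (hG : GoodFun G) (hK : GoodFun K) :
    EE n (fun l => G (subList q i l) * K (subList q j l))
      = EE n (fun l => EE (subList q i l).length G * EE (subList q j l).length K) := by
  have g1 : ∀ k, GoodFun fun l => if k = i then G l else 1 := fun k => by
    by_cases h : k = i
    · simpa [h] using hG
    · simpa [h] using GoodFun.of_length (𝕜 := ℝ) fun _ => 1
  have g2 : ∀ k, GoodFun fun l => if k = j then K l else 1 := fun k => by
    by_cases h : k = j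
    · simpa [h] using hK
    · simpa [h] using GoodFun.of_length (𝕜 := ℝ) fun _ => 1
  have h := EE_prod_subList q n (G := fun k l => (if k = i then G l else 1)
    * (if k = j then K l else 1)) fun k => (g1 k).mul (g2 k)
  have e : ∀ k m, EE m (fun l => (if k = i then G l else 1) * (if k = j then K l else 1))
      = (if k = i then EE m G else 1) * (if k = j then EE m K else 1) := by
    intro k m
    by_cases h1 : k = i
    · subst h1; simp [hij]
    · by_cases h2 : k = j
      · subst h2; simp [h1]
      · simp [h1, h2, EE_const]
  simp only [e, Finset.prod_mul_distrib, Finset.prod_ite_eq', Finset.mem_univ, if_true] at h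
  exact h

theorem sq_one_add_sum (h X : Fin 4 → ℝ) (hh : ∀ j, h j = 0 ∨ h j = 1) :
    (1 + ∑ j, h j * X j) ^ 2 = 1 + ∑ j, 2 * h j * X j + ∑ j, h j * X j ^ 2
      + ∑ i, ∑ j, (if i = j then 0 else h i * h j) * (X i * X j) := by
  have e : ∀ j, h j * h j = h j := fun j => by rcases hh j with h | h <;> rw [h] <;> norm_num
  simp only [Fin.sum_univ_four]
  simp
  linear_combination X 0 ^ 2 * e 0 + X 1 ^ 2 * e 1 + X 2 ^ 2 * e 2 + X 3 ^ 2 * e 3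

/-- The square of the cost is the sum of the squares in the subtrees, up to terms that are
controlled by the mean cost: distinct subtrees are conditionally independent. -/
theorem sqCost_cons_le {M : ℝ} (hM0 : 0 ≤ M)
    (hM : ∀ (n : ℕ) (s : I), meanCost n s ≤ M * (n : ℝ) ^ qβ) {q : I × I} (hq : Interior q)
    (n : ℕ) (s : I) : EE n (fun l => listCost (q :: l) s ^ 2) ≤
      (∑ j, qhit q s j * EE n fun l => sqCost (subList q j l).length (qpos q s j))
        + (1 + 8 * (M * (n : ℝ) ^ qβ) + 16 * (M * (n : ℝ) ^ qβ) ^ 2) := by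
  set X : Fin 4 → List (I × I) → ℝ := fun j l => listCost (subList q j l) (qpos q s j) with hX
  have hXg : ∀ j, GoodFun (X j) := fun j => (goodFun_listCost _).subList q j
  have hMn : 0 ≤ M * (n : ℝ) ^ qβ := by positivity
  have hmean : ∀ j (l : List (I × I)), l.length = n →
      meanCost (subList q j l).length (qpos q s j) ≤ M * (n : ℝ) ^ qβ := fun j l hl => by
    refine (hM _ _).trans (mul_le_mul_of_nonneg_left ?_ hM0)
    refine Real.rpow_le_rpow (Nat.cast_nonneg _) ?_ qβ_pos.le
    rw [← hl]
    exact_mod_cast length_subList_le q j l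
  have h1 : ∀ j, EE n (X j) ≤ M * (n : ℝ) ^ qβ := fun j => by
    rw [hX, EE_subList q j n (goodFun_listCost _), ← EE_const n (M * (n : ℝ) ^ qβ)]
    exact EE_mono (goodFun_length_subList q j fun k => meanCost k (qpos q s j))
      (GoodFun.of_length fun _ => M * (n : ℝ) ^ qβ) (hmean j)
  have h2 : ∀ j, EE n (fun l => X j l ^ 2)
      = EE n fun l => sqCost (subList q j l).length (qpos q s j) := fun j =>
    EE_subList q j n (goodFam_listCost_sq.apply (qpos q s j))
  have h3 : ∀ i j, i ≠ j → EE n (fun l => X i l * X j l) ≤ (M * (n : ℝ) ^ qβ) ^ 2 := by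
    intro i j hij
    rw [hX, EE_subList_mul q hij n (goodFun_listCost _) (goodFun_listCost _),
      ← EE_const n ((M * (n : ℝ) ^ qβ) ^ 2)]
    refine EE_mono ((goodFun_length_subList q i fun k => meanCost k (qpos q s i)).mul
      (goodFun_length_subList q j fun k => meanCost k (qpos q s j)))
      (GoodFun.of_length fun _ => (M * (n : ℝ) ^ qβ) ^ 2) fun l hl => ?_
    rw [sq]
    exact mul_le_mul (hmean i l hl) (hmean j l hl) (meanCost_nonneg _ _) hMn
  have hexp : ∀ l, listCost (q :: l) s ^ 2 = 1 + ∑ j, 2 * qhit q s j * X j l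
      + ∑ j, qhit q s j * X j l ^ 2
      + ∑ i, ∑ j, (if i = j then 0 else qhit q s i * qhit q s j) * (X i l * X j l) := fun l => by
    rw [listCost_cons_of_interior hq,
      sq_one_add_sum _ (fun j => X j l) (qhit_eq_zero_or_one q s)]
  have gone : GoodFun fun _ : List (I × I) => (1 : ℝ) := GoodFun.of_length fun _ => 1
  have g1 : ∀ j, GoodFun fun l => 2 * qhit q s j * X j l := fun j => (hXg j).const_mul _
  have g2 : ∀ j, GoodFun fun l => qhit q s j * X j l ^ 2 := fun j => ((hXg j).pow 2).const_mul _
  have g3 : ∀ i j, GoodFun fun l =>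
      (if i = j then 0 else qhit q s i * qhit q s j) * (X i l * X j l) := fun i j =>
    ((hXg i).mul (hXg j)).const_mul _
  have s1 : GoodFun fun l => ∑ j, 2 * qhit q s j * X j l := GoodFam.sum g1
  have s2 : GoodFun fun l => ∑ j, qhit q s j * X j l ^ 2 := GoodFam.sum g2
  have s3' : ∀ i, GoodFun fun l => ∑ j, (if i = j then 0 else qhit q s i * qhit q s j)
      * (X i l * X j l) := fun i => GoodFam.sum (g3 i)
  have s3 : GoodFun fun l => ∑ i, ∑ j, (if i = j then 0 else qhit q s i * qhit q s j)
      * (X i l * X j l) := GoodFam.sum s3'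
  have p1 : GoodFun fun l => 1 + ∑ j, 2 * qhit q s j * X j l := GoodFam.add gone s1
  have p2 : GoodFun fun l => 1 + ∑ j, 2 * qhit q s j * X j l + ∑ j, qhit q s j * X j l ^ 2 :=
    GoodFam.add p1 s2
  simp only [hexp]
  rw [EE_add p2 s3, EE_add p1 s2, EE_add gone s1, EE_const, EE_sum _ fun j _ => g1 j,
    EE_sum _ fun j _ => g2 j, EE_sum _ fun i _ => s3' i]
  simp only [EE_sum _ fun j _ => g3 _ j, EE_const_mul, h2]
  have b1 : ∑ j, 2 * qhit q s j * EE n (X j) ≤ ∑ _j : Fin 4, 2 * (M * (n : ℝ) ^ qβ) := by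
    refine Finset.sum_le_sum fun j _ => ?_
    rw [mul_assoc]
    refine mul_le_mul_of_nonneg_left ?_ two_pos.le
    have : 0 ≤ EE n (X j) := EE_nonneg fun l => listCost_nonneg _ _
    exact (mul_le_of_le_one_left this (qhit_le_one _ _ _)).trans (h1 j)
  have b3 : ∑ i, ∑ j, (if i = j then 0 else qhit q s i * qhit q s j)
      * EE n (fun l => X i l * X j l) ≤ ∑ _i : Fin 4, ∑ _j : Fin 4, (M * (n : ℝ) ^ qβ) ^ 2 := by
    refine Finset.sum_le_sum fun i _ => Finset.sum_le_sum fun j _ => ?_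
    split_ifs with hij
    · rw [zero_mul]; positivity
    · have : 0 ≤ EE n (fun l => X i l * X j l) :=
        EE_nonneg fun l => mul_nonneg (listCost_nonneg _ _) (listCost_nonneg _ _)
      exact (mul_le_of_le_one_left this (mul_le_one₀ (qhit_le_one _ _ _) (qhit_nonneg _ _ _)
        (qhit_le_one _ _ _))).trans (h3 i j hij)
  simp only [Finset.sum_const, Finset.card_univ, Fintype.card_fin, nsmul_eq_mul] at b1 b3
  push_cast at b1 b3
  linarith

/-- The second moment of the cost is of order `n ^ (2β)`, uniformly in the location. -/
theorem exists_sqCost_le :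
    ∃ V, 0 ≤ V ∧ ∀ (n : ℕ) (s : I), sqCost n s ≤ V * (n : ℝ) ^ (2 * qβ) := by
  obtain ⟨M, hM0, hM⟩ := exists_meanCost_le
  have hb := qβ_pos
  have hb2 : 0 ≤ 2 * qβ := by positivity
  -- from `n₀` on the terms of lower order are negligible
  obtain ⟨n₀, hn₀⟩ := eventually_atTop.1
    (((tendsto_rpow_atTop hb).comp tendsto_natCast_atTop_atTop).eventually_ge_atTop 40)
  set D : ℝ := 1 + 8 * M + 16 * M ^ 2 with hD
  have hD0 : 0 ≤ D := by positivity
  set V : ℝ := 100 * D + (n₀ : ℝ) ^ 2 with hV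
  have hV0 : 0 ≤ V := by positivity
  refine ⟨V, hV0, fun n => ?_⟩
  induction n using Nat.strong_induction_on with
  | _ n ih =>
    rcases n with _ | n
    · intro s
      refine (sqCost_le 0 s).trans ?_
      simp [Real.zero_rpow (by positivity : 2 * qβ ≠ 0)]
    intro s
    have hpow : (n : ℝ) ^ (2 * qβ) ≤ ((n + 1 : ℕ) : ℝ) ^ (2 * qβ) :=
      Real.rpow_le_rpow (Nat.cast_nonneg _) (by push_cast; linarith) hb2
    have hpow1 : (1 : ℝ) ≤ ((n + 1 : ℕ) : ℝ) ^ (2 * qβ) :=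
      Real.one_le_rpow (by push_cast; linarith [(Nat.cast_nonneg n : (0 : ℝ) ≤ n)]) hb2
    rcases Nat.lt_or_ge n n₀ with hlt | hge
    · refine (sqCost_le _ _).trans ?_
      have h1 : ((n + 1 : ℕ) : ℝ) ^ 2 ≤ (n₀ : ℝ) ^ 2 := by
        refine pow_le_pow_left₀ (Nat.cast_nonneg _) ?_ 2
        exact_mod_cast hlt
      calc ((n + 1 : ℕ) : ℝ) ^ 2 ≤ V := by rw [hV]; linarith
        _ ≤ _ := le_mul_of_one_le_right hV0 hpow1
    · have hN : (40 : ℝ) ≤ (n : ℝ) ^ qβ := hn₀ n hge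
      have hsq : (n : ℝ) ^ (2 * qβ) = ((n : ℝ) ^ qβ) ^ 2 := by
        rw [← Real.rpow_natCast ((n : ℝ) ^ qβ) 2, ← Real.rpow_mul (Nat.cast_nonneg n)]
        congr 1; push_cast; ring
      set w : ℝ := (n : ℝ) ^ qβ with hw
      have hpair : Measurable fun q : I × I => (q, s) := measurable_id.prodMk measurable_const
      have hgood : GoodFun fun l => listCost l s ^ 2 := goodFam_listCost_sq.apply s
      have hgq : ∀ q j, GoodFun fun l => sqCost (subList q j l).length (qpos q s j) := fun q j =>
        goodFun_length_subList q j fun k => sqCost k (qpos q s j)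
      have hint : Integrable fun q : I × I => ∑ j, (V * w ^ 2) *
          (qhit q s j * qarea q j ^ (2 * qβ)) := integrable_finsetSum _ fun j _ =>
        (integrable_qhit_mul_qarea s j hb2).const_mul _
      have key : sqCost (n + 1) s ≤ ∫ q : I × I, ((∑ j, (V * w ^ 2) *
          (qhit q s j * qarea q j ^ (2 * qβ)))
          + (4 * (V * w) + (1 + 8 * (M * w) + 16 * (M * w) ^ 2))) := by
        rw [sqCost, EE_succ hgood]
        refine integral_mono_ae ?_ (hint.add (integrable_const _)) (ae_interior.mono fun q hq => ?_)
        · exact (hgood.cons.integrable n volume).integral_prod_left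
        refine (sqCost_cons_le hM0 hM hq n s).trans ?_
        have hj : ∀ j, qhit q s j * EE n (fun l => sqCost (subList q j l).length (qpos q s j))
            ≤ (V * w ^ 2) * (qhit q s j * qarea q j ^ (2 * qβ)) + V * w := by
          intro j
          have h1 : EE n (fun l => sqCost (subList q j l).length (qpos q s j))
              ≤ V * (w ^ 2 * qarea q j ^ (2 * qβ) + w) := by
            have h2 := EE_length_rpow_two_mul_le hq j n
            rw [hsq] at h2
            refine le_trans ?_ (mul_le_mul_of_nonneg_left h2 hV0)
            rw [← EE_const_mul]
            refine EE_mono (hgq q j)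
              ((goodFun_length_subList q j fun k => (k : ℝ) ^ (2 * qβ)).const_mul V) fun l hl => ?_
            exact ih _ (Nat.lt_succ_of_le ((length_subList_le q j l).trans hl.le)) _
          have h3 := mul_le_mul_of_nonneg_left h1 (qhit_nonneg q s j)
          have h4 : qhit q s j * (V * w) ≤ V * w :=
            mul_le_of_le_one_left (mul_nonneg hV0 (by linarith)) (qhit_le_one _ _ _)
          linarith
        have hsum := Finset.sum_le_sum fun j (_ : j ∈ Finset.univ) => hj j
        rw [Finset.sum_add_distrib] at hsum
        simp only [Finset.sum_const, Finset.card_univ, Fintype.card_fin, nsmul_eq_mul] at hsum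
        push_cast at hsum
        linarith
      rw [integral_add hint (integrable_const _), integral_finsetSum _ fun j _ =>
        (integrable_qhit_mul_qarea s j hb2).const_mul _] at key
      simp only [integral_const_mul, integral_const, probReal_univ, one_smul] at key
      rw [← Finset.mul_sum] at key
      have hθ := (sum_integral_qhit_mul_qarea_le s hb2).trans (le_of_eq (rfl : _ = qθ))
      have hθ' := qθ_lt
      have h1 : V * w ^ 2 * ∑ j, ∫ q : I × I, qhit q s j * qarea q j ^ (2 * qβ)
          ≤ V * w ^ 2 * 0.888 :=
        mul_le_mul_of_nonneg_left (hθ.trans hθ'.le) (by positivity)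
      have h2 : 4 * (V * w) ≤ 0.1 * (V * w ^ 2) := by
        have := mul_le_mul_of_nonneg_left hN (mul_nonneg hV0 (by linarith : 0 ≤ w))
        norm_num at this ⊢
        nlinarith
      have h3 : 1 + 8 * (M * w) + 16 * (M * w) ^ 2 ≤ D * w ^ 2 := by
        rw [hD]
        have e1 : 1 ≤ w ^ 2 := by nlinarith
        have e2 : M * w ≤ M * w ^ 2 := mul_le_mul_of_nonneg_left (by nlinarith) hM0
        nlinarith
      have h4 : D * w ^ 2 ≤ 0.01 * (V * w ^ 2) := by
        have : 100 * D ≤ V := by rw [hV]; linarith [sq_nonneg (n₀ : ℝ)]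
        have := mul_le_mul_of_nonneg_right this (sq_nonneg w)
        norm_num at this ⊢
        linarith
      have h5 : V * w ^ 2 ≤ V * ((n + 1 : ℕ) : ℝ) ^ (2 * qβ) := by
        rw [← hsq]; exact mul_le_mul_of_nonneg_left hpow hV0
      have h6 : 0 ≤ V * w ^ 2 := by positivity
      norm_num at h1 h2 h4
      linarith

/-! ### The recursion for the characteristic functions -/

/-- The characteristic function of the costs, in a tree of `n` uniform points, of the queries at
the points `s i`. -/
def costChar {ι : Type} [Fintype ι] (n : ℕ) (s : ι → I) (t : ι → ℝ) : ℂ :=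
  EE n fun l => Complex.exp ((∑ i, t i * listCost l (s i) : ℝ) * Complex.I)

/-- The factor `1 / (K₁ n ^ β)` that rescales the costs; it is `0` for `n = 0`. -/
def qnorm (n : ℕ) : ℝ := (qK₁ * (n : ℝ) ^ qβ)⁻¹

theorem qK₁_pos : 0 < qK₁ := by
  have := qβ_pos
  have h1 := Real.Gamma_pos_of_pos (by linarith : 0 < 2 * qβ + 2)
  have h2 := Real.Gamma_pos_of_pos (by linarith : 0 < qβ + 2)
  have h3 := Real.Gamma_pos_of_pos (by linarith : 0 < qβ + 1)
  have h4 := Real.Gamma_pos_of_pos (by linarith : 0 < qβ / 2 + 1)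
  unfold qK₁
  positivity

theorem qnorm_nonneg (n : ℕ) : 0 ≤ qnorm n :=
  inv_nonneg.2 (mul_nonneg qK₁_pos.le (Real.rpow_nonneg (Nat.cast_nonneg n) _))

theorem qnorm_mul_rpow_le (n : ℕ) : qnorm n * (n : ℝ) ^ qβ ≤ qK₁⁻¹ := by
  rcases Nat.eq_zero_or_pos n with rfl | hn
  · simp [Real.zero_rpow qβ_pos.ne', qK₁_pos.le]
  · have : (0 : ℝ) < (n : ℝ) ^ qβ := by positivity
    rw [qnorm, mul_inv, mul_assoc, inv_mul_cancel₀ this.ne', mul_one]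

section CostChar

variable {ι : Type} [Fintype ι]

theorem goodFam_costExp :
    GoodFam fun (p : (ι → I) × (ι → ℝ)) (l : List (I × I)) =>
      Complex.exp ((∑ i, p.2 i * listCost l (p.1 i) : ℝ) * Complex.I) where
  meas n := by
    have : Measurable fun p : ((ι → I) × (ι → ℝ)) × (Fin n → I × I) =>
        ∑ i, p.1.2 i * listCost (List.ofFn p.2) (p.1.1 i) := by
      refine Finset.measurable_sum _ fun i _ => Measurable.mul ?_ ?_
      · exact (measurable_pi_apply i).comp (measurable_snd.comp measurable_fst)
      · have h : Measurable fun p : ((ι → I) × (ι → ℝ)) × (Fin n → I × I) => (p.1.1 i, p.2) :=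
          ((measurable_pi_apply i).comp (measurable_fst.comp measurable_fst)).prodMk
            measurable_snd
        exact (measurable_listCost n).comp h
    fun_prop
  bdd _ := ⟨1, fun _ _ _ => (Complex.norm_exp_ofReal_mul_I _).le⟩

theorem goodFun_costExp (s : ι → I) (t : ι → ℝ) : GoodFun fun l : List (I × I) =>
    Complex.exp ((∑ i, t i * listCost l (s i) : ℝ) * Complex.I) := goodFam_costExp.apply (s, t)

theorem norm_costChar_le (n : ℕ) (s : ι → I) (t : ι → ℝ) : ‖costChar n s t‖ ≤ 1 :=
  norm_EE_le fun _ _ => (Complex.norm_exp_ofReal_mul_I _).le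

/-- The characteristic functions are Lipschitz continuous, with the mean costs as constants. -/
theorem norm_costChar_sub_le (n : ℕ) (s : ι → I) (t t' : ι → ℝ) :
    ‖costChar n s t - costChar n s t'‖ ≤ ∑ i, |t i - t' i| * meanCost n (s i) := by
  have h1 := (goodFun_costExp s t).integrable n
  have h2 := (goodFun_costExp s t').integrable n
  have h3 : GoodFun fun l => ∑ i, |t i - t' i| * listCost l (s i) :=
    GoodFam.sum fun i => (goodFun_listCost (s i)).const_mul _
  rw [costChar, costChar, EE, EE, ← integral_sub h1 h2]
  refine (norm_integral_le_of_norm_le (h3.integrable n) (ae_of_all _ fun v => ?_)).trans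
    (le_of_eq ?_)
  · refine (norm_cexp_sub_cexp_le _ _).trans ?_
    rw [← Finset.sum_sub_distrib]
    refine (Finset.abs_sum_le_sum_abs _ _).trans (le_of_eq ?_)
    refine Finset.sum_congr rfl fun i _ => ?_
    rw [← sub_mul, abs_mul, abs_of_nonneg (listCost_nonneg _ _)]
  · exact (EE_sum _ fun i _ => (goodFun_listCost (s i)).const_mul _).trans
      (Finset.sum_congr rfl fun i _ => EE_const_mul _ _)

/-- The contribution of one splitting point to the recursion for the characteristic functions. -/
theorem EE_costExp_cons {q : I × I} (hq : Interior q) (n : ℕ) (s : ι → I) (t : ι → ℝ) :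
    EE n (fun l => Complex.exp ((∑ i, t i * listCost (q :: l) (s i) : ℝ) * Complex.I))
      = Complex.exp ((∑ i, t i : ℝ) * Complex.I) * EE n fun l => ∏ j,
          costChar (subList q j l).length (fun i => qpos q (s i) j)
            fun i => t i * qhit q (s i) j := by
  have h := EE_prod_subList q n (G := fun j l => Complex.exp ((∑ i, t i * qhit q (s i) j *
    listCost l (qpos q (s i) j) : ℝ) * Complex.I)) fun j =>
      goodFun_costExp (fun i => qpos q (s i) j) fun i => t i * qhit q (s i) j
  simp only [costChar]
  rw [← h, ← EE_const_mul]
  refine EE_congr fun l _ => ?_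
  rw [← Complex.exp_sum, ← Complex.exp_add, ← Finset.sum_mul, ← add_mul, ← Complex.ofReal_sum,
    ← Complex.ofReal_add]
  congr 3
  rw [Finset.sum_comm, ← Finset.sum_add_distrib]
  refine Finset.sum_congr rfl fun i _ => ?_
  rw [listCost_cons_of_interior hq, mul_add, mul_one, Finset.mul_sum]
  congr 1
  exact Finset.sum_congr rfl fun j _ => by ring

theorem costChar_succ (n : ℕ) (s : ι → I) (t : ι → ℝ) : costChar (n + 1) s t
    = ∫ q : I × I, EE n fun l =>
        Complex.exp ((∑ i, t i * listCost (q :: l) (s i) : ℝ) * Complex.I) :=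
  EE_succ (goodFun_costExp s t) n

/-- If the rescaled costs converge, then so do the costs in a subtree that contains asymptotically
a proportion `a` of all points. -/
theorem tendsto_costChar_of_proportion {φ : (ι → I) → (ι → ℝ) → ℂ}
    (hφ : ∀ s t, Tendsto (fun n => costChar n s fun i => qnorm n * t i) atTop (𝓝 (φ s t)))
    {k : ℕ → ℕ} {a : ℝ} (ha : 0 < a)
    (hk : Tendsto (fun n : ℕ => (k n : ℝ) / n) atTop (𝓝 a)) (s : ι → I) (t : ι → ℝ) :
    Tendsto (fun n => costChar (k n) s fun i => qnorm (n + 1) * t i) atTop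
      (𝓝 (φ s fun i => a ^ qβ * t i)) := by
  obtain ⟨M, hM0, hM⟩ := exists_meanCost_le
  have hb := qβ_pos
  have hk1 : Tendsto (fun n : ℕ => (k n : ℝ) / (n + 1)) atTop (𝓝 a) := by
    have h := hk.mul (tendsto_natCast_div_add_atTop (1 : ℝ))
    rw [mul_one] at h
    refine h.congr' ?_
    filter_upwards [eventually_ne_atTop 0] with n hn
    have : (n : ℝ) ≠ 0 := by exact_mod_cast hn
    field_simp
  have hpos : ∀ᶠ n : ℕ in atTop, 0 < k n := by
    filter_upwards [hk1.eventually (lt_mem_nhds ha)] with n hn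
    by_contra h
    rw [Nat.pos_iff_ne_zero.not.trans not_not] at h
    simp [h] at hn
  have hkinf : Tendsto k atTop atTop := by
    have h : Tendsto (fun n : ℕ => (k n : ℝ) / n * n) atTop atTop :=
      hk.pos_mul_atTop ha tendsto_natCast_atTop_atTop
    refine tendsto_natCast_atTop_iff (R := ℝ).1 (h.congr' ?_)
    filter_upwards [eventually_ne_atTop 0] with n hn
    exact div_mul_cancel₀ _ (by exact_mod_cast hn)
  have h1 : Tendsto (fun n => costChar (k n) s fun i => qnorm (k n) * (a ^ qβ * t i)) atTop
      (𝓝 (φ s fun i => a ^ qβ * t i)) := (hφ s fun i => a ^ qβ * t i).comp hkinf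
  -- the two rescalings differ by a vanishing amount
  have h2 : Tendsto (fun n => (costChar (k n) s fun i => qnorm (n + 1) * t i)
      - costChar (k n) s fun i => qnorm (k n) * (a ^ qβ * t i)) atTop (𝓝 0) := by
    have hlim : Tendsto (fun n : ℕ => ∑ i, |((k n : ℝ) / (n + 1)) ^ qβ - a ^ qβ| * |t i|
        * (M * qK₁⁻¹)) atTop (𝓝 0) := by
      have h3 : Tendsto (fun n : ℕ => |((k n : ℝ) / (n + 1)) ^ qβ - a ^ qβ|) atTop (𝓝 0) := by
        have := ((hk1.rpow_const (p := qβ) (Or.inl ha.ne')).sub_const (a ^ qβ)).abs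
        simpa using this
      have := tendsto_finsetSum Finset.univ fun (i : ι) _ =>
        (h3.mul_const |t i|).mul_const (M * qK₁⁻¹)
      simpa using this
    refine squeeze_zero_norm' ?_ hlim
    filter_upwards [hpos] with n hn
    refine (norm_costChar_sub_le _ _ _ _).trans (Finset.sum_le_sum fun i _ => ?_)
    have hkn : (0 : ℝ) < (k n : ℝ) := by exact_mod_cast hn
    have hkp : (0 : ℝ) < (k n : ℝ) ^ qβ := by positivity
    have e : qnorm (n + 1) = qnorm (k n) * ((k n : ℝ) / (n + 1)) ^ qβ := by
      rw [qnorm, qnorm, Real.div_rpow hkn.le (by positivity)]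
      have h5 := qK₁_pos.ne'
      have h6 : ((n : ℝ) + 1) ^ qβ ≠ 0 := by positivity
      push_cast
      field_simp
    have e2 : qnorm (n + 1) * t i - qnorm (k n) * (a ^ qβ * t i)
        = qnorm (k n) * ((((k n : ℝ) / (n + 1)) ^ qβ - a ^ qβ) * t i) := by rw [e]; ring
    rw [e2, abs_mul, abs_of_nonneg (qnorm_nonneg _), abs_mul]
    have h7 : qnorm (k n) * meanCost (k n) (s i) ≤ M * qK₁⁻¹ := by
      refine (mul_le_mul_of_nonneg_left (hM _ _) (qnorm_nonneg _)).trans ?_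
      have := mul_le_mul_of_nonneg_left (qnorm_mul_rpow_le (k n)) hM0
      linarith
    have h8 := mul_le_mul_of_nonneg_left h7
      (mul_nonneg (abs_nonneg (((k n : ℝ) / (n + 1)) ^ qβ - a ^ qβ)) (abs_nonneg (t i)))
    linarith
  simpa using h2.add h1

theorem tendsto_qnorm_succ : Tendsto (fun n => qnorm (n + 1)) atTop (𝓝 0) := by
  have h1 := ((tendsto_rpow_atTop qβ_pos).comp tendsto_natCast_atTop_atTop).const_mul_atTop qK₁_pos
  exact (tendsto_add_atTop_iff_nat 1).2 h1.inv_tendsto_atTop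

end CostChar

/-! ### Limits in distribution are fixed points -/

theorem length_subList_ofFn (q : I × I) (j : Fin 4) (p : ℕ → I × I) (n : ℕ) :
    (((subList q j (List.ofFn fun i : Fin n => p i)).length : ℕ) : ℝ)
      = ∑ i ∈ Finset.range n, (quad q ⁻¹' {j}).indicator (fun _ => (1 : ℝ)) (p i) := by
  induction n with
  | zero => simp [subList, inQuad]
  | succ n ih =>
    rw [Finset.sum_range_succ, ← ih, subList, subList, List.length_map, List.length_map,
      List.ofFn_succ_last, inQuad, List.filter_append, List.length_append]
    push_cast
    congr 1
    by_cases h : quad q (p n) = j <;> simp [h, indicator]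

section Limit

variable {Ω : Type*} [MeasurableSpace Ω] {P : Measure Ω} [IsProbabilityMeasure P]
  {p : ℕ → Ω → I × I}

/-- The law of large numbers for the numbers of points in a quadrant. -/
theorem ae_tendsto_length (hmeas : ∀ i, Measurable (p i)) (hindep : iIndepFun p P)
    (hunif : ∀ i, P.map (p i) = volume) (q : I × I) (j : Fin 4) :
    ∀ᵐ ω ∂P, Tendsto (fun n : ℕ =>
      ((subList q j (List.ofFn fun i : Fin n => p i ω)).length : ℝ) / n) atTop
        (𝓝 (qarea q j)) := by
  have hset : MeasurableSet (quad q ⁻¹' {j}) :=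
    (measurable_quad.comp (measurable_const.prodMk measurable_id)) (measurableSet_singleton j)
  set g : I × I → ℝ := (quad q ⁻¹' {j}).indicator fun _ => 1 with hg
  have hgm : Measurable g := measurable_const.indicator hset
  have hgi : ∀ i, Integrable (fun ω => g (p i ω)) P := fun i =>
    integrable_of_bdd (hgm.comp (hmeas i)) 1 fun ω => by
      by_cases h : p i ω ∈ quad q ⁻¹' {j} <;> simp [hg, h]
  have hlln := strong_law_ae_real (fun i ω => g (p i ω)) (hgi 0)
    (fun i k hik => (hindep.indepFun hik).comp hgm hgm)
    fun i => IdentDistrib.comp (f := p i) (g := p 0)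
      ⟨(hmeas i).aemeasurable, (hmeas 0).aemeasurable, by rw [hunif, hunif]⟩ hgm
  have hint : ∫ ω, g (p 0 ω) ∂P = qarea q j := by
    rw [← integral_map (f := g) (hmeas 0).aemeasurable hgm.aestronglyMeasurable, hunif, hg,
      integral_indicator hset]
    have := integral_quad_qscale (𝕜 := ℝ) q j (f := fun _ => 1) measurable_const
    rw [this]
    simp
  filter_upwards [hlln] with ω hω
  rw [hint] at hω
  refine hω.congr fun n => ?_
  rw [length_subList_ofFn q j (fun i => p i ω)]

/-- The recursion for the characteristic functions of a solution. -/
theorem fddChar_quadMap {ι : Type} [Fintype ι] {ν : Measure CadlagFun} [IsProbabilityMeasure ν]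
    (s : ι → I) (t : ι → ℝ) :
    fddChar (Measure.map (fun q : (I × I) × (Fin 4 → CadlagFun) => quadMap q.1.1 q.1.2 q.2)
      ((volume : Measure (I × I)).prod (Measure.pi fun _ => ν))) s t
      = ∫ q : I × I, ∏ j, fddChar ν (fun i => qpos q (s i) j)
          fun i => qarea q j ^ qβ * (t i * qhit q (s i) j) := by
  have hm := (measurable_fddExp s t).comp measurable_quadMap
  have hi : Integrable (fun x : (I × I) × (Fin 4 → CadlagFun) =>
      Complex.exp ((∑ i, t i * quadMap x.1.1 x.1.2 x.2 (s i) : ℝ) * Complex.I))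
      ((volume : Measure (I × I)).prod (Measure.pi fun _ => ν)) :=
    Integrable.of_bound hm.aestronglyMeasurable 1
      (ae_of_all _ fun _ => (Complex.norm_exp_ofReal_mul_I _).le)
  rw [fddChar, integral_map measurable_quadMap.aemeasurable
    (measurable_fddExp s t).aestronglyMeasurable, integral_prod _ hi]
  refine integral_congr_ae (ae_of_all _ fun q => ?_)
  simp only [fddChar]
  rw [← integral_fintype_prod_eq_prod (μ := fun _ : Fin 4 => ν)]
  refine integral_congr_ae (ae_of_all _ fun f => ?_)
  simp only
  rw [← Complex.exp_sum, ← Finset.sum_mul, ← Complex.ofReal_sum, Finset.sum_comm]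
  congr 3
  refine Finset.sum_congr rfl fun i _ => ?_
  rw [quadMap_eq_sum, Finset.mul_sum]
  refine Finset.sum_congr rfl fun j _ => ?_
  rw [qwt]
  ring

theorem rescaledCost_apply (x : ℕ → I × I) (n : ℕ) (s : I) :
    rescaledCost x n s = qnorm n * listCost (List.ofFn fun i : Fin n => x i) s := by
  rw [listCost, ← QuadTree.build_eq_ofList]
  rfl

theorem CadlagFun.continuous_eval (s : I) : Continuous fun f : CadlagFun => f s :=
  (UniformFun.uniformContinuous_eval ℝ s).continuous.comp continuous_induced_dom

theorem complex_integral_exp {α : Type*} [MeasurableSpace α] (m : Measure α) [IsFiniteMeasure m]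
    {f : α → ℝ} (hf : Measurable f) : ∫ a, Complex.exp ((f a : ℝ) * Complex.I) ∂m
      = ((∫ a, Real.cos (f a) ∂m : ℝ) : ℂ) + ((∫ a, Real.sin (f a) ∂m : ℝ) : ℂ) * Complex.I := by
  have h1 : Integrable (fun a => ((Real.cos (f a) : ℝ) : ℂ)) m :=
    (integrable_of_bdd (Real.measurable_cos.comp hf) 1 fun a => Real.abs_cos_le_one _).ofReal
  have h2 : Integrable (fun a => ((Real.sin (f a) : ℝ) : ℂ)) m :=
    (integrable_of_bdd (Real.measurable_sin.comp hf) 1 fun a => Real.abs_sin_le_one _).ofReal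
  rw [← integral_complex_ofReal, ← integral_complex_ofReal, ← integral_mul_const,
    ← integral_add h1 (h2.mul_const _)]
  refine integral_congr_ae (ae_of_all _ fun a => ?_)
  simp only [Complex.exp_mul_I, Complex.ofReal_cos, Complex.ofReal_sin]

/-- The cosine and the sine of a linear functional of the process are admissible test functions. -/
theorem tendsto_costChar (hmeas : ∀ i, Measurable (p i)) (hindep : iIndepFun p P)
    (hunif : ∀ i, P.map (p i) = volume) {ν : Measure CadlagFun} [IsProbabilityMeasure ν]
    (hν : ConvergesInDistribution P (fun n ω => rescaledCost (fun i => p i ω) n) ν)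
    {ι : Type} [Fintype ι] (s : ι → I) (t : ι → ℝ) :
    Tendsto (fun n => costChar n s fun i => qnorm n * t i) atTop (𝓝 (fddChar ν s t)) := by
  have hc : Continuous fun f : CadlagFun => ∑ i, t i * f (s i) :=
    continuous_finsetSum _ fun i _ => (CadlagFun.continuous_eval _).const_mul _
  have hm : Measurable fun f : CadlagFun => ∑ i, t i * f (s i) :=
    Finset.measurable_sum _ fun i _ => (CadlagFun.measurable_eval _).const_mul _
  have l1 := hν (fun f => Real.cos (∑ i, t i * f (s i))) (Real.continuous_cos.comp hc)
    (Real.measurable_cos.comp hm) ⟨1, fun f => Real.abs_cos_le_one _⟩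
  have l2 := hν (fun f => Real.sin (∑ i, t i * f (s i))) (Real.continuous_sin.comp hc)
    (Real.measurable_sin.comp hm) ⟨1, fun f => Real.abs_sin_le_one _⟩
  have l3 := ((Complex.continuous_ofReal.tendsto _).comp l1).add
    (((Complex.continuous_ofReal.tendsto _).comp l2).mul_const Complex.I)
  rw [← complex_integral_exp ν hm] at l3
  refine l3.congr fun n => ?_
  have hcost : ∀ i, Measurable fun ω => rescaledCost (fun i => p i ω) n (s i) := fun i => by
    simp only [rescaledCost_apply]
    exact (((goodFun_listCost (s i)).meas n).comp
      (measurable_pi_iff.2 fun i : Fin n => hmeas i)).const_mul _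
  have hsum : Measurable fun ω => ∑ i, t i * rescaledCost (fun i => p i ω) n (s i) :=
    Finset.measurable_sum _ fun i _ => (hcost i).const_mul _
  refine (complex_integral_exp P hsum).symm.trans ?_
  rw [costChar, ← integral_ofFn_eq_EE hmeas hindep hunif n (goodFun_costExp _ _)]
  refine integral_congr_ae (ae_of_all _ fun ω => ?_)
  simp only [rescaledCost_apply]
  congr 3
  exact Finset.sum_congr rfl fun i _ => by ring

/-- The recursive structure of the quadtree passes to the limit. -/
theorem isFixedPointLaw_of_convergesInDistribution (hmeas : ∀ i, Measurable (p i))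
    (hindep : iIndepFun p P) (hunif : ∀ i, P.map (p i) = volume) {ν : Measure CadlagFun}
    [IsProbabilityMeasure ν]
    (hν : ConvergesInDistribution P (fun n ω => rescaledCost (fun i => p i ω) n) ν) :
    IsFixedPointLaw ν := by
  have := Measure.isProbabilityMeasure_map (μ := (volume : Measure (I × I)).prod
    (Measure.pi fun _ : Fin 4 => ν)) measurable_quadMap.aemeasurable
  refine CadlagFun.measure_ext fun J t => ?_
  rw [fddChar_quadMap]
  set s : J → I := fun i => i
  have hφ := fun s t => tendsto_costChar hmeas hindep hunif hν (ι := J) s t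
  have hlim := (tendsto_add_atTop_iff_nat 1).2 (hφ s t)
  refine tendsto_nhds_unique ?_ hlim
  simp only [costChar_succ]
  refine tendsto_integral_of_dominated_convergence (fun _ => 1) (fun n => ?_) (integrable_const _)
    (fun n => ae_of_all _ fun q => norm_EE_le fun l _ => (Complex.norm_exp_ofReal_mul_I _).le)
    (ae_interior.mono fun q hq => ?_)
  · exact ((goodFun_costExp s fun i => qnorm (n + 1) * t i).cons.measurable_EE
      n).aestronglyMeasurable
  simp only [EE_costExp_cons hq]
  -- the toll of the root vanishes in the limit
  have h1 : Tendsto (fun n => Complex.exp ((∑ i, qnorm (n + 1) * t i : ℝ) * Complex.I)) atTop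
      (𝓝 1) := by
    have h2 : Tendsto (fun n => ∑ i, qnorm (n + 1) * t i) atTop (𝓝 0) := by
      have := tendsto_finsetSum Finset.univ fun (i : J) _ => tendsto_qnorm_succ.mul_const (t i)
      simpa using this
    have hc : Continuous fun x : ℝ => Complex.exp (x * Complex.I) := by fun_prop
    have := (hc.tendsto 0).comp h2
    simpa [Function.comp_def] using this
  have h2 : Tendsto (fun n => EE n fun l => ∏ j, costChar (subList q j l).length
      (fun i => qpos q (s i) j) fun i => qnorm (n + 1) * t i * qhit q (s i) j) atTop
      (𝓝 (∏ j, fddChar ν (fun i => qpos q (s i) j)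
        fun i => qarea q j ^ qβ * (t i * qhit q (s i) j))) := by
    have hgood : ∀ n, GoodFun fun l : List (I × I) => ∏ j, costChar (subList q j l).length
        (fun i => qpos q (s i) j) fun i => qnorm (n + 1) * t i * qhit q (s i) j := fun n =>
      GoodFun.prod fun j => GoodFun.subList (G := fun l : List (I × I) => costChar l.length
        (fun i => qpos q (s i) j) fun i => qnorm (n + 1) * t i * qhit q (s i) j)
        (GoodFun.of_length fun k => costChar k (fun i => qpos q (s i) j)
          fun i => qnorm (n + 1) * t i * qhit q (s i) j) q j
    have hP : (∏ j, fddChar ν (fun i => qpos q (s i) j)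
        fun i => qarea q j ^ qβ * (t i * qhit q (s i) j))
        = ∫ _ω, (∏ j, fddChar ν (fun i => qpos q (s i) j)
        fun i => qarea q j ^ qβ * (t i * qhit q (s i) j)) ∂P := by simp
    rw [hP]
    simp only [← integral_ofFn_eq_EE hmeas hindep hunif _ (hgood _)]
    refine tendsto_integral_of_dominated_convergence (fun _ => 1) (fun n => ?_)
      (integrable_const _) (fun n => ae_of_all _ fun ω => ?_) ?_
    · exact (((hgood n).meas n).comp
        (measurable_pi_iff.2 fun i : Fin n => hmeas i)).aestronglyMeasurable
    · rw [norm_prod]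
      exact Finset.prod_le_one (fun _ _ => norm_nonneg _) fun j _ => norm_costChar_le _ _ _
    · have hall : ∀ᵐ ω ∂P, ∀ j, Tendsto (fun n : ℕ =>
          ((subList q j (List.ofFn fun i : Fin n => p i ω)).length : ℝ) / n) atTop
            (𝓝 (qarea q j)) := ae_all_iff.2 fun j => ae_tendsto_length hmeas hindep hunif q j
      filter_upwards [hall] with ω hω
      refine tendsto_finsetProd _ fun j _ => ?_
      have := tendsto_costChar_of_proportion hφ (hq.qarea_pos j) (hω j)
        (fun i => qpos q (s i) j) fun i => t i * qhit q (s i) j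
      simpa only [mul_assoc] using this
  simpa using h1.mul h2

end Limit

/-! ### The mean function of a limit law -/

/-- The mean operator `T` of the recursive equation. -/
def meanOp (g : I → ℝ) (s : I) : ℝ := ∫ q : I × I, ∑ j, qwt q s j * g (qpos q s j)

theorem measurable_qwt_mul {g : I → ℝ} (hg : Measurable g) (j : Fin 4) :
    Measurable fun p : (I × I) × I => qwt p.1 p.2 j * g (qpos p.1 p.2 j) :=
  (measurable_qwt j).mul (hg.comp (measurable_qpos j))

theorem abs_qwt_mul_le {g : I → ℝ} {C : ℝ} (hC : ∀ u, |g u| ≤ C) (q : I × I) (s : I) (j : Fin 4) :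
    |qwt q s j * g (qpos q s j)| ≤ C := by
  rw [abs_mul, abs_of_nonneg (qwt_nonneg _ _ _)]
  exact (mul_le_of_le_one_left (abs_nonneg _) (qwt_le_one _ _ _)).trans (hC _)

theorem integrable_qwt_mul {g : I → ℝ} (hg : Measurable g) {C : ℝ} (hC : ∀ u, |g u| ≤ C) (s : I)
    (j : Fin 4) : Integrable fun q : I × I => qwt q s j * g (qpos q s j) :=
  integrable_of_bdd ((measurable_qwt_mul hg j).comp (measurable_id.prodMk measurable_const)) C
    fun q => abs_qwt_mul_le hC q s j

theorem meanOp_sub {g k : I → ℝ} (hg : Measurable g) (hk : Measurable k) {C D : ℝ}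
    (hC : ∀ u, |g u| ≤ C) (hD : ∀ u, |k u| ≤ D) (s : I) :
    meanOp (fun u => g u - k u) s = meanOp g s - meanOp k s := by
  rw [meanOp, meanOp, meanOp, ← integral_sub
    (integrable_finsetSum _ fun j _ => integrable_qwt_mul hg hC s j)
    (integrable_finsetSum _ fun j _ => integrable_qwt_mul hk hD s j)]
  refine integral_congr_ae (ae_of_all _ fun q => ?_)
  simp only [mul_sub, Finset.sum_sub_distrib]

/-- The mean operator preserves integrals: each quadrant contributes `1 / ((β + 1) (β + 2)) = 1 / 4`. -/
theorem integral_meanOp {g : I → ℝ} (hg : Measurable g) {C : ℝ} (hC : ∀ u, |g u| ≤ C) :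
    Integrable (meanOp g) ∧ ∫ s, meanOp g s = ∫ u, g u := by
  have hb := qβ_pos
  have hij : ∀ j, Integrable fun p : I × (I × I) => qwt p.2 p.1 j * g (qpos p.2 p.1 j) := fun j =>
    integrable_of_bdd ((measurable_qwt_mul hg j).comp measurable_swap) C
      fun p => abs_qwt_mul_le hC p.2 p.1 j
  have e : ∀ s, meanOp g s = ∑ j, ∫ q : I × I, qwt q s j * g (qpos q s j) := fun s =>
    integral_finsetSum _ fun j _ => integrable_qwt_mul hg hC s j
  have e' : meanOp g = fun s => ∑ j, ∫ q : I × I, qwt q s j * g (qpos q s j) := funext e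
  refine ⟨?_, ?_⟩
  · rw [e']
    exact integrable_finsetSum _ fun j _ => (hij j).integral_prod_left
  rw [e', integral_finsetSum _ fun j _ => (hij j).integral_prod_left]
  have hw : ∀ j, ∫ s, ∫ q : I × I, qwt q s j * g (qpos q s j) = 1 / 4 * ∫ u, g u := by
    intro j
    rw [integral_integral_swap (hij j)]
    have e1 : ∀ q : I × I, ∫ s, qwt q s j * g (qpos q s j)
        = (qwidth q j * qarea q j ^ qβ) * ∫ u, g u := by
      intro q
      have := integral_qhit_mul_qpos q j hg
      simp only [qwt, mul_comm (qhit q _ j) (qarea q j ^ qβ), mul_assoc]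
      rw [integral_const_mul, this]
      ring
    simp only [e1]
    rw [integral_mul_const]
    congr 1
    have h := integral_mul_qarea_rpow (fun x => if j = 0 ∨ j = 1 then (x : ℝ) else 1 - x) hb.le j
    change ∫ q : I × I, qwidth q j * qarea q j ^ qβ = _ at h
    rw [h]
    have hx : ∀ x : ℝ, 0 ≤ x → x * x ^ qβ = x ^ (qβ + 1) := fun x hx => by
      rw [Real.rpow_add_one' hx (by positivity), mul_comm]
    have h3 : (∫ x : I, (if j = 0 ∨ j = 1 then (x : ℝ) else 1 - x)
        * (if j = 0 ∨ j = 1 then (x : ℝ) else 1 - x) ^ qβ) = 1 / (qβ + 2) := by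
      split_ifs
      · rw [← (by ring : qβ + 1 + 1 = qβ + 2), ← integral_rpow_unitInterval (by positivity)]
        exact integral_congr_ae (ae_of_all _ fun x => hx _ x.2.1)
      · rw [← (by ring : qβ + 1 + 1 = qβ + 2), ← integral_one_sub_rpow_unitInterval (by positivity)]
        exact integral_congr_ae (ae_of_all _ fun x => hx _ (sub_nonneg.2 x.2.2))
    rw [h3, div_mul_div_comm, mul_comm (qβ + 2), qβ_eq, one_mul]
  simp only [hw, Finset.sum_const, Finset.card_univ, Fintype.card_fin, nsmul_eq_mul]
  push_cast
  ring

/-- The mean operator has a kernel that is bounded below: after the substitution `u = s / x` the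
part of the integral on the left of the splitting point has a density that is at least `s²` on
`u > s`, and by reflection the other part has one that is at least `(1 - s)²` on `u < s`. -/
theorem le_meanOp {g : I → ℝ} (hg : Measurable g) (h0 : ∀ u, 0 ≤ g u) {C : ℝ}
    (hC : ∀ u, |g u| ≤ C) (s : I) :
    ((s : ℝ) ^ 2 * (1 - s) ^ 2) * ∫ u, g u ≤ meanOp g s := by
  have hb := qβ_pos
  have hb1 : qβ ≤ 1 := by linarith [qβ_lt]
  have hi : Integrable g := integrable_of_bdd hg C hC
  have hs0 := s.2.1
  have hs1 := s.2.2
  by_cases hdeg : s = 0 ∨ s = 1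
  · have : ((s : ℝ) ^ 2 * (1 - s) ^ 2) = 0 := by rcases hdeg with rfl | rfl <;> simp
    rw [this, zero_mul]
    exact integral_nonneg fun q => Finset.sum_nonneg fun j _ =>
      mul_nonneg (qwt_nonneg _ _ _) (h0 _)
  rw [not_or] at hdeg
  have hsp : 0 < s := unitInterval.pos_iff_ne_zero.2 hdeg.1
  have hs1' : s < 1 := unitInterval.lt_one_iff_ne_one.2 hdeg.2
  have hsp' : (0 : ℝ) < s := hsp
  have hσ : 0 < unitInterval.symm s := by
    rw [← Subtype.coe_lt_coe, unitInterval.coe_symm_eq]; simpa using hs1'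
  -- the common estimate for the two sides
  have side : ∀ {v : I}, 0 < v → ∀ k : I → ℝ, Measurable k → (∀ u, 0 ≤ k u) → (∀ u, |k u| ≤ C) →
      (v : ℝ) ^ 2 * ∫ u, (if v < u then k u else 0)
        ≤ ∫ x : I, (if v < x then (x : ℝ) ^ qβ * k (leftPos x v) else 0) := by
    intro v hv k hk hk0 hkC
    have hv0 : (0 : ℝ) < v := hv
    have hv1 : (v : ℝ) ≤ 1 := v.2.2
    rw [integral_leftPos hv (fun x => x ^ qβ) k, ← integral_const_mul]
    refine integral_mono_of_nonneg (ae_of_all _ fun u => ?_) ?_ (ae_of_all _ fun u => ?_)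
    · simp only [Pi.zero_apply]
      split_ifs
      · exact mul_nonneg (sq_nonneg _) (hk0 u)
      · simp
    · refine integrable_of_bdd (Measurable.ite measurableSet_Ioi ?_ measurable_const)
        (1 / v * C) fun u => ?_
      · have hu : Measurable fun u : I => (u : ℝ) := measurable_subtype_coe
        exact (((measurable_const.div hu).pow_const _).mul
          (measurable_const.div (hu.pow_const 2))).mul hk
      · have hC0 : 0 ≤ C := (abs_nonneg _).trans (hkC u)
        split_ifs with huv
        · have hu0 : (v : ℝ) < u := huv
          have hup : (0 : ℝ) < u := hv0.trans hu0
          rw [abs_mul]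
          refine mul_le_mul ?_ (hkC u) (abs_nonneg _) (by positivity)
          rw [abs_of_nonneg (by positivity)]
          have h1 : ((v : ℝ) / u) ^ qβ ≤ 1 :=
            Real.rpow_le_one (by positivity) (div_le_one_of_le₀ hu0.le hup.le) hb.le
          have h2 : (v : ℝ) / (u : ℝ) ^ 2 ≤ 1 / v := by
            rw [div_le_div_iff₀ (by positivity) hv0]
            nlinarith
          calc _ ≤ 1 * (1 / (v : ℝ)) := mul_le_mul h1 h2 (by positivity) zero_le_one
            _ = _ := one_mul _
        · rw [abs_zero]; positivity
    · simp only
      split_ifs with huv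
      · have hu0 : (v : ℝ) < u := huv
        have hup : (0 : ℝ) < u := hv0.trans hu0
        have hu1 : (u : ℝ) ≤ 1 := u.2.2
        refine mul_le_mul_of_nonneg_right ?_ (hk0 u)
        have h1 : (v : ℝ) ≤ ((v : ℝ) / u) ^ qβ := by
          have h2 : (v : ℝ) ≤ v / u := le_div_self hv0.le hup hu1
          refine h2.trans ?_
          have := Real.rpow_le_rpow_of_exponent_ge (by positivity : 0 < (v : ℝ) / u)
            (div_le_one_of_le₀ hu0.le hup.le) hb1
          rwa [Real.rpow_one] at this
        have h2 : (v : ℝ) ≤ v / (u : ℝ) ^ 2 := le_div_self hv0.le (by positivity) (by nlinarith)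
        rw [sq]
        exact mul_le_mul h1 h2 hv0.le (by positivity)
      · simp
  have hL := side hsp g hg h0 hC
  have hR := side hσ (fun u => g (unitInterval.symm u))
    (hg.comp unitInterval.measurable_symm) (fun u => h0 _) fun u => hC _
  have hR2 := integral_rightPos hs1' (fun x => x ^ qβ) g
  rw [← hR2, unitInterval.coe_symm_eq] at hR
  have hiL : Integrable fun u => if s < u then g u else 0 :=
    integrable_of_bdd (Measurable.ite measurableSet_Ioi hg measurable_const) C fun u => by
      split_ifs
      · exact hC u
      · rw [abs_zero]; exact (abs_nonneg _).trans (hC u)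
  have hiR : Integrable fun u => if u < s then g u else 0 :=
    integrable_of_bdd (Measurable.ite measurableSet_Iio hg measurable_const) C fun u => by
      split_ifs
      · exact hC u
      · rw [abs_zero]; exact (abs_nonneg _).trans (hC u)
  have hsym : ∫ u, (if unitInterval.symm s < u then g (unitInterval.symm u) else 0)
      = ∫ u, (if u < s then g u else 0) := by
    rw [← integral_unitInterval_symm]
    refine integral_congr_ae (ae_of_all _ fun u => ?_)
    simp only [unitInterval.symm_symm, unitInterval.symm_lt_symm]
  rw [hsym] at hR
  have hsplit : ∫ u, g u = (∫ u, (if s < u then g u else 0)) + ∫ u, (if u < s then g u else 0) := by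
    rw [← integral_add hiL hiR]
    have hne : ∀ᵐ u : I, u ≠ s := by simp [ae_iff]
    refine integral_congr_ae (hne.mono fun u hu => ?_)
    rcases lt_or_gt_of_ne hu with h | h
    · simp [h, not_lt.2 h.le]
    · simp [h, not_lt.2 h.le]
  have hTm := integral_sum_qwt_mul g hg hC s
  have e1 : ∫ x : I, (if s < x then g (leftPos x s) else 0) * (x : ℝ) ^ qβ
      = ∫ x : I, (if s < x then (x : ℝ) ^ qβ * g (leftPos x s) else 0) := by
    refine integral_congr_ae (ae_of_all _ fun x => ?_)
    by_cases h : s < x <;> simp [h, mul_comm]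
  have e2 : ∫ x : I, (if s < x then 0 else g (rightPos x s)) * (1 - (x : ℝ)) ^ qβ
      = ∫ x : I, (if s < x then 0 else (1 - (x : ℝ)) ^ qβ * g (rightPos x s)) := by
    refine integral_congr_ae (ae_of_all _ fun x => ?_)
    by_cases h : s < x <;> simp [h, mul_comm]
  rw [e1, e2] at hTm
  rw [meanOp, hTm]
  have hl0 : 0 ≤ ∫ u, (if s < u then g u else 0) :=
    integral_nonneg fun u => by simp only [Pi.zero_apply]; split_ifs; exacts [h0 u, le_rfl]
  have hr0 : 0 ≤ ∫ u, (if u < s then g u else 0) :=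
    integral_nonneg fun u => by simp only [Pi.zero_apply]; split_ifs; exacts [h0 u, le_rfl]
  have hc : 1 ≤ 2 / (qβ + 1) := by rw [le_div_iff₀ (by positivity)]; linarith
  have hsum := add_le_add hL hR
  have hpos : 0 ≤ (s : ℝ) ^ 2 * (∫ u, (if s < u then g u else 0))
      + (1 - (s : ℝ)) ^ 2 * ∫ u, (if u < s then g u else 0) := by positivity
  have f1 : (s : ℝ) ^ 2 * (1 - s) ^ 2 ≤ s ^ 2 :=
    mul_le_of_le_one_right (sq_nonneg _) (by nlinarith)
  have f2 : (s : ℝ) ^ 2 * (1 - s) ^ 2 ≤ (1 - s) ^ 2 :=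
    mul_le_of_le_one_left (sq_nonneg _) (by nlinarith)
  have f3 := mul_le_mul_of_nonneg_right f1 hl0
  have f4 := mul_le_mul_of_nonneg_right f2 hr0
  have f5 := le_mul_of_one_le_left (hpos.trans hsum) hc
  rw [hsplit]
  linarith

theorem integral_sq_mul_sq : ∫ s : I, (s : ℝ) ^ 2 * (1 - s) ^ 2 = 1 / 30 := by
  rw [integral_unitInterval fun s => s ^ 2 * (1 - s) ^ 2]
  have : ∀ s : ℝ, s ^ 2 * (1 - s) ^ 2 = s ^ 2 - 2 * s ^ 3 + s ^ 4 := fun s => by ring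
  simp only [this]
  rw [intervalIntegral.integral_add, intervalIntegral.integral_sub,
    intervalIntegral.integral_const_mul, integral_pow, integral_pow, integral_pow]
  · norm_num
  all_goals exact Continuous.intervalIntegrable (by fun_prop) _ _

theorem qpos_one {q : I × I} (hq : q.1 < 1) (j : Fin 4) (h : qhit q 1 j ≠ 0) :
    qpos q 1 j = 1 := by
  have hlt : ¬ (1 : I) < q.1 := not_lt.2 hq.le
  have hr : rightPos q.1 1 = 1 := by
    apply Subtype.ext
    rw [coe_rightPos hq.le]
    have : (1 : ℝ) - q.1 ≠ 0 := (sub_pos.2 (show (q.1 : ℝ) < 1 from hq)).ne'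
    simp [this]
  fin_cases j
  · exact absurd (if_neg hlt) h
  · exact absurd (if_neg hlt) h
  · exact hr
  · exact hr

/-- A bounded function of mean zero that is invariant under the mean operator vanishes. -/
theorem eq_zero_of_meanOp_eq {d : I → ℝ} (hd : Measurable d) {C : ℝ} (hC : ∀ u, |d u| ≤ C)
    (hT : ∀ s, meanOp d s = d s) (h0 : ∫ u, d u = 0) (s : I) : d s = 0 := by
  have hi : Integrable d := integrable_of_bdd hd C hC
  -- positive and negative parts
  set a : I → ℝ := fun u => max (d u) 0 with ha
  set b : I → ℝ := fun u => max (-d u) 0 with hb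
  have ham : Measurable a := hd.max measurable_const
  have hbm : Measurable b := hd.neg.max measurable_const
  have ha0 : ∀ u, 0 ≤ a u := fun u => le_max_right _ _
  have hb0 : ∀ u, 0 ≤ b u := fun u => le_max_right _ _
  have haC : ∀ u, |a u| ≤ C := fun u => by
    rw [abs_of_nonneg (ha0 u)]
    exact max_le ((le_abs_self _).trans (hC u)) ((abs_nonneg _).trans (hC u))
  have hbC : ∀ u, |b u| ≤ C := fun u => by
    rw [abs_of_nonneg (hb0 u)]
    exact max_le ((neg_le_abs _).trans (hC u)) ((abs_nonneg _).trans (hC u))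
  have hai := integrable_of_bdd (μ := (volume : Measure I)) ham C haC
  have hbi := integrable_of_bdd (μ := (volume : Measure I)) hbm C hbC
  have hsub : ∀ u, a u - b u = d u := fun u => by
    rcases le_total 0 (d u) with h | h
    · simp [ha, hb, h]
    · simp [ha, hb, h]
  have habs : ∀ u, a u + b u = |d u| := fun u => by
    rcases le_total 0 (d u) with h | h
    · simp [ha, hb, h, abs_of_nonneg h]
    · simp [ha, hb, h, abs_of_nonpos h]
  have hab : ∫ u, a u = ∫ u, b u := by
    have : ∫ u, (a u - b u) = 0 := by simp only [hsub]; exact h0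
    rw [integral_sub hai hbi] at this
    linarith
  set A : ℝ := ∫ u, a u with hA
  have hA2 : ∫ u, |d u| = 2 * A := by
    simp only [← habs]
    rw [integral_add hai hbi, ← hab]
    ring
  -- the positive and the negative part both spread over the whole interval and cancel partially
  have key : ∀ s : I, |d s| ≤ meanOp a s + meanOp b s - 2 * (((s : ℝ) ^ 2 * (1 - s) ^ 2) * A) := by
    intro s
    have h1 := le_meanOp ham ha0 haC s
    have h2 := le_meanOp hbm hb0 hbC s
    rw [← hab] at h2
    have h3 : d s = meanOp a s - meanOp b s := by
      rw [← hT s, ← meanOp_sub ham hbm haC hbC]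
      simp only [hsub]
    rw [h3, abs_le]
    constructor <;> linarith
  obtain ⟨hTai, hTa⟩ := integral_meanOp ham haC
  obtain ⟨hTbi, hTb⟩ := integral_meanOp hbm hbC
  have hwi : Integrable fun s : I => 2 * (((s : ℝ) ^ 2 * (1 - s) ^ 2) * A) := by
    have hc : Continuous fun s : I => 2 * (((s : ℝ) ^ 2 * (1 - s) ^ 2) * A) := by fun_prop
    exact hc.integrable_of_hasCompactSupport (HasCompactSupport.of_compactSpace _)
  have hint := integral_mono hi.abs ((hTai.add hTbi).sub hwi) key
  -- integrated, the bound reads `2 A ≤ 2 A - A / 15`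
  rw [hA2] at hint
  rw [integral_sub' (hTai.add hTbi) hwi, integral_add' hTai hTbi, hTa, hTb, ← hab,
    integral_const_mul, integral_mul_const, integral_sq_mul_sq] at hint
  have hA0 : A = 0 := le_antisymm (by linarith) (integral_nonneg ha0)
  -- the values at the end points are contracted
  have hend : (s = 0 ∨ s = 1) → d s = 0 := by
    intro hs
    have hpos : ∀ᵐ q : I × I, ∀ j, qwt q s j * d (qpos q s j) = qwt q s j * d s := by
      filter_upwards [ae_interior] with q hq j
      by_cases hj : qhit q s j = 0
      · simp [qwt, hj]
      congr 2
      rcases hs with rfl | rfl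
      · exact qpos_zero q j hj
      · exact qpos_one hq.1.2 j hj
    have hij : ∀ j, Integrable fun q : I × I => qwt q s j * d s := fun j =>
      (integrable_qhit_mul_qarea s j qβ_pos.le).mul_const _
    have h1 : d s = (∑ j, ∫ q : I × I, qhit q s j * qarea q j ^ qβ) * d s := by
      conv_lhs => rw [← hT s, meanOp]
      rw [integral_congr_ae (hpos.mono fun q hq => Finset.sum_congr rfl fun j _ => hq j),
        integral_finsetSum _ fun j _ => hij j, Finset.sum_mul]
      exact Finset.sum_congr rfl fun j _ => integral_mul_const _ _
    have h2 := sum_integral_qhit_mul_qarea_le_min s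
    have h3 : min (s : ℝ) (1 - s) = 0 := by rcases hs with rfl | rfl <;> simp
    have h4 : 2 / (qβ + 1) ^ 2 < 1 := by
      have := qβ_gt
      rw [div_lt_one (by positivity)]
      nlinarith
    rw [h3, mul_zero, add_zero] at h2
    have h5 : (1 - ∑ j, ∫ q : I × I, qhit q s j * qarea q j ^ qβ) * d s = 0 := by linarith
    rcases mul_eq_zero.1 h5 with h | h
    · linarith
    · exact h
  by_cases hs : s = 0 ∨ s = 1
  · exact hend hs
  rw [not_or] at hs
  have hs0 : 0 < s := unitInterval.pos_iff_ne_zero.2 hs.1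
  have hs1 : s < 1 := unitInterval.lt_one_iff_ne_one.2 hs.2
  -- in the interior the kernel of the mean operator is bounded
  have hup : ∀ {k : I → ℝ}, Measurable k → (∀ u, 0 ≤ k u) → (∀ u, |k u| ≤ C) → ∫ u, k u = 0 →
      meanOp k s ≤ 0 := by
    intro k hk hk0 hkC hkz
    have h := integral_sum_qhit_mul_le hs0 hs1 hk0 hk hkC
    rw [hkz, mul_zero] at h
    refine le_trans (integral_mono_of_nonneg (ae_of_all _ fun q => Finset.sum_nonneg fun j _ =>
      mul_nonneg (qwt_nonneg _ _ _) (hk0 _)) ?_ (ae_of_all _ fun q =>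
        Finset.sum_le_sum fun j _ => ?_)) h
    · refine integrable_finsetSum _ fun j _ => ?_
      have hp : Measurable fun q : I × I => (q, s) := measurable_id.prodMk measurable_const
      refine integrable_of_bdd (((measurable_qhit j).comp hp).mul
        (hk.comp ((measurable_qpos j).comp hp))) C fun q => ?_
      rw [abs_mul, abs_of_nonneg (qhit_nonneg _ _ _)]
      exact (mul_le_of_le_one_left (abs_nonneg _) (qhit_le_one _ _ _)).trans (hkC _)
    · refine mul_le_mul_of_nonneg_right ?_ (hk0 _)
      exact mul_le_of_le_one_right (qhit_nonneg _ _ _)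
        (Real.rpow_le_one (qarea_nonneg _ _) (qarea_le_one _ _) qβ_pos.le)
  have h1 := key s
  have h2 := hup ham ha0 haC hA0
  have h3 := hup hbm hb0 hbC (by rw [← hab]; exact hA0)
  rw [hA0] at h1
  exact abs_nonpos_iff.1 (by linarith)

/-! ### The normalising constant -/

/-- A Beta integral. -/
theorem integral_qh : ∫ s, qh s = Real.Gamma (qβ / 2 + 1) ^ 2 / Real.Gamma (qβ + 2) := by
  have hb := qβ_pos
  have hα : 0 < qβ / 2 + 1 := by positivity
  have h := beta_eq_betaIntegralReal (qβ / 2 + 1) (qβ / 2 + 1) hα hα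
  rw [beta, ← sq, show qβ / 2 + 1 + (qβ / 2 + 1) = qβ + 2 by ring] at h
  rw [h, Complex.betaIntegral, intervalIntegral.integral_of_le zero_le_one,
    ← RCLike.re_to_complex, ← integral_re]
  · unfold qh
    rw [integral_unitInterval fun s => (s * (1 - s)) ^ (qβ / 2),
      intervalIntegral.integral_of_le zero_le_one]
    refine setIntegral_congr_fun measurableSet_Ioc fun x hx => ?_
    have h1 : 0 ≤ 1 - x := sub_nonneg.2 hx.2
    have e : ((qβ / 2 + 1 : ℝ) : ℂ) - 1 = ((qβ / 2 : ℝ) : ℂ) := by push_cast; ring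
    have e2 : (1 : ℂ) - x = ((1 - x : ℝ) : ℂ) := by push_cast; ring
    simp only [e, e2]
    rw [← Complex.ofReal_cpow hx.1.le, ← Complex.ofReal_cpow h1, ← Complex.ofReal_mul,
      RCLike.re_to_complex, Complex.ofReal_re, Real.mul_rpow hx.1.le h1]
  · have := Complex.betaIntegral_convergent (u := ((qβ / 2 + 1 : ℝ) : ℂ))
      (v := ((qβ / 2 + 1 : ℝ) : ℂ)) (by simpa using hα) (by simpa using hα)
    rwa [intervalIntegrable_iff_integrableOn_Ioc_of_le zero_le_one] at this

/-- The constant `K₁` is the ratio of the growth constant of the average cost to the integral of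
the mean function. -/
theorem integral_qh_eq_div : ∫ s, qh s
    = qK₁⁻¹ * (Real.Gamma (2 * qβ + 2) / (2 * Real.Gamma (qβ + 1) ^ 3)) := by
  have hb := qβ_pos
  have h1 := (Real.Gamma_pos_of_pos (by linarith : 0 < 2 * qβ + 2)).ne'
  have h2 := (Real.Gamma_pos_of_pos (by linarith : 0 < qβ + 2)).ne'
  have h3 := (Real.Gamma_pos_of_pos (by linarith : 0 < qβ + 1)).ne'
  have h4 := (Real.Gamma_pos_of_pos (by linarith : 0 < qβ / 2 + 1)).ne'
  rw [integral_qh, qK₁]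
  field_simp

/-! ### Moments of a limit law -/

section LimitMoments

variable {Ω : Type*} [MeasurableSpace Ω] {P : Measure Ω} [IsProbabilityMeasure P]
  {p : ℕ → Ω → I × I}

theorem qnorm_sq_mul_rpow_le (n : ℕ) : qnorm n ^ 2 * (n : ℝ) ^ (2 * qβ) ≤ qK₁⁻¹ ^ 2 := by
  have e : (n : ℝ) ^ (2 * qβ) = ((n : ℝ) ^ qβ) ^ 2 := by
    rw [← Real.rpow_natCast ((n : ℝ) ^ qβ) 2, ← Real.rpow_mul (Nat.cast_nonneg n)]
    congr 1; push_cast; ring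
  rw [e, ← mul_pow]
  exact pow_le_pow_left₀ (mul_nonneg (qnorm_nonneg n) (Real.rpow_nonneg (Nat.cast_nonneg n) _))
    (qnorm_mul_rpow_le n) 2

theorem goodFun_comp_listCost (s : I) (c : ℝ) {g : ℝ → ℝ} (hg : Measurable g) {B : ℝ}
    (hB : ∀ x, |g x| ≤ B) : GoodFun fun l => g (c * listCost l s) where
  meas n := hg.comp (((goodFun_listCost s).const_mul c).meas n |>.comp measurable_snd)
  bdd _ := ⟨B, fun _ _ _ => hB _⟩

theorem tendsto_EE_comp (hmeas : ∀ i, Measurable (p i)) (hindep : iIndepFun p P)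
    (hunif : ∀ i, P.map (p i) = volume) {ν : Measure CadlagFun}
    (hν : ConvergesInDistribution P (fun n ω => rescaledCost (fun i => p i ω) n) ν) (s : I)
    {g : ℝ → ℝ} (hg : Continuous g) {B : ℝ} (hB : ∀ x, |g x| ≤ B) :
    Tendsto (fun n => EE n fun l => g (qnorm n * listCost l s)) atTop (𝓝 (∫ f, g (f s) ∂ν)) := by
  have h := hν (fun f => g (f s)) (hg.comp (CadlagFun.continuous_eval s))
    (hg.measurable.comp (CadlagFun.measurable_eval s)) ⟨B, fun f => hB _⟩
  simp only [rescaledCost_apply] at h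
  refine h.congr fun n => ?_
  exact integral_ofFn_eq_EE hmeas hindep hunif n (goodFun_comp_listCost s _ hg.measurable hB)

/-- Monotone convergence for second moments, in terms of bounded truncations. -/
theorem memLp_two_of_truncations {α : Type*} [MeasurableSpace α] {m : Measure α}
    [IsFiniteMeasure m] {f : α → ℝ} (hf : Measurable f) {B : ℝ} (hB : 0 ≤ B)
    (h : ∀ k : ℕ, ∫ a, min (f a ^ 2) k ∂m ≤ B) : MemLp f 2 m ∧ ∫ a, f a ^ 2 ∂m ≤ B := by
  have hk : ∀ k : ℕ, ∫⁻ a, ENNReal.ofReal (min (f a ^ 2) k) ∂m ≤ ENNReal.ofReal B := by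
    intro k
    rw [← ofReal_integral_eq_lintegral_ofReal]
    · exact ENNReal.ofReal_le_ofReal (h k)
    · refine integrable_of_bdd ((hf.pow_const 2).min measurable_const) k fun a => ?_
      rw [abs_of_nonneg (le_min (sq_nonneg _) (Nat.cast_nonneg k))]
      exact min_le_right _ _
    · exact ae_of_all _ fun a => le_min (sq_nonneg _) (Nat.cast_nonneg k)
  have hlim : Tendsto (fun k : ℕ => ∫⁻ a, ENNReal.ofReal (min (f a ^ 2) k) ∂m) atTop
      (𝓝 (∫⁻ a, ENNReal.ofReal (f a ^ 2) ∂m)) := by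
    refine lintegral_tendsto_of_tendsto_of_monotone
      (fun k => (((hf.pow_const 2).min measurable_const).ennreal_ofReal).aemeasurable)
      (ae_of_all _ fun a k k' hkk => ENNReal.ofReal_le_ofReal
        (min_le_min_left _ (by exact_mod_cast hkk))) (ae_of_all _ fun a => ?_)
    refine tendsto_const_nhds.congr' ?_
    filter_upwards [eventually_ge_atTop ⌈f a ^ 2⌉₊] with k hk
    rw [min_eq_left (Nat.ceil_le.1 hk)]
  have hle := le_of_tendsto' hlim hk
  have hi : Integrable (fun a => f a ^ 2) m := by
    refine ⟨(hf.pow_const 2).aestronglyMeasurable, ?_⟩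
    rw [hasFiniteIntegral_iff_ofReal (ae_of_all _ fun a => sq_nonneg _)]
    exact hle.trans_lt ENNReal.ofReal_lt_top
  refine ⟨(memLp_two_iff_integrable_sq hf.aestronglyMeasurable).2 hi, ?_⟩
  rw [integral_eq_lintegral_of_nonneg_ae (ae_of_all _ fun a => sq_nonneg _)
    (hf.pow_const 2).aestronglyMeasurable]
  exact ENNReal.toReal_le_of_le_ofReal hB hle

/-- The truncation of a real number to `[-c, c]` changes it by at most `x² / c`. -/
theorem abs_sub_truncate_le {c : ℝ} (hc : 0 < c) (x : ℝ) :
    |x - max (-c) (min x c)| ≤ x ^ 2 / c := by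
  rw [le_div_iff₀ hc]
  rcases le_total x (-c) with h1 | h1
  · rw [min_eq_left (by linarith), max_eq_left h1, abs_of_nonpos (by linarith)]
    nlinarith
  rcases le_total x c with h2 | h2
  · rw [min_eq_left h2, max_eq_right h1, sub_self, abs_zero, zero_mul]
    positivity
  · rw [min_eq_right h2, max_eq_right (by linarith), abs_of_nonneg (by linarith)]
    nlinarith

/-- The second moments of a limit law are bounded, and its means are the limits of the rescaled
mean costs. -/
theorem limit_moments (hmeas : ∀ i, Measurable (p i)) (hindep : iIndepFun p P)
    (hunif : ∀ i, P.map (p i) = volume) {ν : Measure CadlagFun} [IsProbabilityMeasure ν]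
    (hν : ConvergesInDistribution P (fun n ω => rescaledCost (fun i => p i ω) n) ν) :
    (∃ B : ℝ, ∀ s : I, MemLp (fun f : CadlagFun => f s) 2 ν ∧ ∫ f, f s ^ 2 ∂ν ≤ B) ∧
      ∀ s : I, Tendsto (fun n => qnorm n * meanCost n s) atTop (𝓝 (∫ f, f s ∂ν)) := by
  obtain ⟨V, hV0, hV⟩ := exists_sqCost_le
  set B : ℝ := V * qK₁⁻¹ ^ 2 with hB
  have hB0 : 0 ≤ B := by positivity
  have hsq : ∀ n s, EE n (fun l => (qnorm n * listCost l s) ^ 2) ≤ B := by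
    intro n s
    simp only [mul_pow]
    rw [EE_const_mul]
    calc qnorm n ^ 2 * sqCost n s ≤ qnorm n ^ 2 * (V * (n : ℝ) ^ (2 * qβ)) :=
          mul_le_mul_of_nonneg_left (hV n s) (sq_nonneg _)
      _ = V * (qnorm n ^ 2 * (n : ℝ) ^ (2 * qβ)) := by ring
      _ ≤ B := mul_le_mul_of_nonneg_left (qnorm_sq_mul_rpow_le n) hV0
  have gX : ∀ n s, GoodFun fun l => qnorm n * listCost l s := fun n s =>
    (goodFun_listCost s).const_mul _
  have second : ∀ s : I, MemLp (fun f : CadlagFun => f s) 2 ν ∧ ∫ f, f s ^ 2 ∂ν ≤ B := by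
    intro s
    refine memLp_two_of_truncations (CadlagFun.measurable_eval s) hB0 fun k => ?_
    have hb : ∀ x : ℝ, |min (x ^ 2) (k : ℝ)| ≤ k := fun x => by
      rw [abs_of_nonneg (le_min (sq_nonneg _) (Nat.cast_nonneg k))]
      exact min_le_right _ _
    have hc : Continuous fun x : ℝ => min (x ^ 2) (k : ℝ) := by fun_prop
    refine le_of_tendsto' (tendsto_EE_comp hmeas hindep hunif hν s hc hb) fun n => ?_
    exact (EE_mono (goodFun_comp_listCost s _ hc.measurable hb) ((gX n s).pow 2)
      fun l _ => min_le_left _ _).trans (hsq n s)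
  refine ⟨⟨B, second⟩, fun s => ?_⟩
  have hfi : Integrable (fun f : CadlagFun => f s) ν := (second s).1.integrable (by norm_num)
  have hf2 : Integrable (fun f : CadlagFun => f s ^ 2) ν := (second s).1.integrable_sq
  rw [Metric.tendsto_atTop]
  intro ε hε
  obtain ⟨c, hc0, hc⟩ : ∃ c : ℝ, 0 < c ∧ B / c < ε / 3 := by
    refine ⟨3 * (B + 1) / ε, by positivity, ?_⟩
    rw [div_lt_iff₀ (by positivity)]
    field_simp
    linarith
  set g : ℝ → ℝ := fun x => max (-c) (min x c) with hg
  have hgc : Continuous g := by fun_prop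
  have hgb : ∀ x, |g x| ≤ c := fun x => abs_le.2 ⟨le_max_left _ _,
    max_le (by linarith) (min_le_right _ _)⟩
  obtain ⟨N, hN⟩ := Metric.tendsto_atTop.1 (tendsto_EE_comp hmeas hindep hunif hν s hgc hgb)
    (ε / 3) (by positivity)
  refine ⟨N, fun n hn => ?_⟩
  have h1 := hN n hn
  have hgi : Integrable (fun f : CadlagFun => g (f s)) ν :=
    integrable_of_bdd (hgc.measurable.comp (CadlagFun.measurable_eval s)) c fun f => hgb _
  have h2 : |(∫ f, f s ∂ν) - ∫ f, g (f s) ∂ν| ≤ B / c := by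
    rw [← integral_sub hfi hgi]
    refine (norm_integral_le_of_norm_le (hf2.div_const c)
      (ae_of_all _ fun f => by
        rw [Real.norm_eq_abs]; exact abs_sub_truncate_le hc0 _)).trans ?_
    rw [integral_div]
    exact div_le_div_of_nonneg_right (second s).2 hc0.le
  have h3 : |qnorm n * meanCost n s - EE n (fun l => g (qnorm n * listCost l s))| ≤ B / c := by
    have gg := goodFun_comp_listCost s (qnorm n) hgc.measurable hgb
    rw [meanCost, ← EE_const_mul, EE, EE, ← integral_sub ((gX n s).integrable n) (gg.integrable n)]
    refine (norm_integral_le_of_norm_le ((((gX n s).pow 2).integrable n).div_const c)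
      (ae_of_all _ fun f => by
        rw [Real.norm_eq_abs]; exact abs_sub_truncate_le hc0 _)).trans ?_
    rw [integral_div]
    exact div_le_div_of_nonneg_right (hsq n s) hc0.le
  rw [Real.dist_eq] at h1 ⊢
  rw [abs_le] at h2 h3
  rw [abs_lt] at h1 ⊢
  constructor <;> linarith [h1.1, h1.2, h2.1, h2.2, h3.1, h3.2]

/-- The mean function of a fixed point is invariant under the mean operator. -/
theorem IsFixedPointLaw.meanOp_eq {ν : Measure CadlagFun} [IsProbabilityMeasure ν]
    (hν : IsFixedPointLaw ν) (hi : ∀ s, Integrable (fun f : CadlagFun => f s) ν) (s : I) :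
    meanOp (fun u => ∫ f, f u ∂ν) s = ∫ f, f s ∂ν := by
  have hm : Measurable fun f : CadlagFun => f s := CadlagFun.measurable_eval s
  have hi2 : Integrable (fun q : (I × I) × (Fin 4 → CadlagFun) =>
      spliceSum CadlagFun.toFun q.1 q.2 s)
      ((volume : Measure (I × I)).prod (Measure.pi fun _ => ν)) := by
    have h := hi s
    rw [← hν] at h
    have h2 := (integrable_map_measure hm.aestronglyMeasurable
      measurable_quadMap.aemeasurable).1 h
    refine h2.congr (ae_of_all _ fun q => ?_)
    exact quadMap_eq_sum q.1 q.2 s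
  rw [meanOp, ← integral_spliceSum (Y := CadlagFun.toFun) hi hi2]
  conv_rhs => rw [← hν]
  rw [integral_map measurable_quadMap.aemeasurable hm.aestronglyMeasurable]
  exact integral_congr_ae (ae_of_all _ fun q => (quadMap_eq_sum q.1 q.2 s).symm)

/-- The mean function of a limit is invariant and has the same integral as the invariant function
`(s (1 - s))^{β/2}`, hence equals it. -/
theorem hasWeakMoments_of_convergesInDistribution (hmeas : ∀ i, Measurable (p i))
    (hindep : iIndepFun p P) (hunif : ∀ i, P.map (p i) = volume) {ν : Measure CadlagFun}
    [IsProbabilityMeasure ν]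
    (hν : ConvergesInDistribution P (fun n ω => rescaledCost (fun i => p i ω) n) ν) :
    HasWeakMoments ν := by
  obtain ⟨hB, hmean⟩ := limit_moments hmeas hindep hunif hν
  refine ⟨fun s => ?_, hB⟩
  obtain ⟨M, hM0, hM⟩ := exists_meanCost_le
  obtain ⟨B, hB⟩ := hB
  set m : I → ℝ := fun u => ∫ f, f u ∂ν with hm
  have hfix := isFixedPointLaw_of_convergesInDistribution hmeas hindep hunif hν
  have hmm : Measurable m :=
    measurable_of_tendsto_metrizable (fun n => (measurable_meanCost n).const_mul (qnorm n))
      (tendsto_pi_nhds.2 hmean)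
  have hnb : ∀ (n : ℕ) (u : I), |qnorm n * meanCost n u| ≤ M * qK₁⁻¹ := fun n u => by
    rw [abs_of_nonneg (mul_nonneg (qnorm_nonneg n) (meanCost_nonneg n u))]
    refine (mul_le_mul_of_nonneg_left (hM n u) (qnorm_nonneg n)).trans ?_
    have := mul_le_mul_of_nonneg_left (qnorm_mul_rpow_le n) hM0
    linarith
  have hmb : ∀ u, |m u| ≤ M * qK₁⁻¹ := fun u => le_of_tendsto' (hmean u).abs fun n => hnb n u
  have hint : ∫ u, m u = ∫ u, qh u := by
    have h1 : Tendsto (fun n => ∫ u, qnorm n * meanCost n u) atTop (𝓝 (∫ u, m u)) :=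
      tendsto_integral_of_dominated_convergence (fun _ => M * qK₁⁻¹)
        (fun n => ((measurable_meanCost n).const_mul (qnorm n)).aestronglyMeasurable)
        (integrable_const _) (fun n => ae_of_all _ fun u => hnb n u)
        (ae_of_all _ fun u => hmean u)
    have h2 := tendsto_avgCost.const_mul qK₁⁻¹
    rw [← integral_qh_eq_div] at h2
    refine tendsto_nhds_unique h1 (h2.congr fun n => ?_)
    rw [integral_const_mul, qnorm, mul_inv, ← avgCost]
    ring
  have hqC : ∀ u, |qh u| ≤ 1 := fun u => by rw [abs_of_nonneg (qh_nonneg u)]; exact qh_le_one u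
  have hqm : Measurable qh := continuous_qh.measurable
  have hd := eq_zero_of_meanOp_eq (d := fun u => m u - qh u) (hmm.sub hqm)
    (C := M * qK₁⁻¹ + 1) (fun u => (abs_sub _ _).trans (add_le_add (hmb u) (hqC u)))
    (fun u => by
      rw [meanOp_sub hmm hqm hmb hqC,
        hfix.meanOp_eq (fun s => (hB s).1.integrable (by norm_num)) u]
      rw [show meanOp qh u = qh u from integral_sum_qwt_mul_qh u])
    (by rw [integral_sub (integrable_of_bdd hmm _ hmb) (integrable_of_bdd hqm _ hqC), hint,
      sub_self]) s
  exact sub_eq_zero.1 hd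

end LimitMoments

end

theorem mainTheorem2 {Ω : Type*} [MeasurableSpace Ω] (P : Measure Ω) [IsProbabilityMeasure P]
    (p : ℕ → Ω → I × I) (hmeas : ∀ i, Measurable (p i))
    (hindep : iIndepFun p P) (hunif : ∀ i, P.map (p i) = volume) :
    ∃ μ : Measure CadlagFun, IsProbabilityMeasure μ ∧
      (∀ᵐ f ∂μ, Continuous f.toFun) ∧
      IsFixedPointLaw μ ∧ HasLimitMoments μ ∧
      (∀ ν : Measure CadlagFun, IsProbabilityMeasure ν →
        IsFixedPointLaw ν → HasLimitMoments ν → ν = μ) ∧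
      (∀ ν : Measure CadlagFun, IsProbabilityMeasure ν →
        ConvergesInDistribution P (fun n ω => rescaledCost (fun i => p i ω) n) ν → ν = μ) := by
  obtain ⟨μ, hμ, hcont, hfix, hmom⟩ := exists_limitLaw
  refine ⟨μ, hμ, hcont, hfix, hmom, fun ν hν hνfix hνmom => ?_, fun ν hν hlim => ?_⟩
  · exact fixedPointLaw_unique hνfix hfix hνmom.weak hmom.weak
  · exact fixedPointLaw_unique
      (isFixedPointLaw_of_convergesInDistribution hmeas hindep hunif hlim) hfix
      (hasWeakMoments_of_convergesInDistribution hmeas hindep hunif hlim) hmom.weak
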